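/- Let $(M,g)$ be a smooth Riemannian manifold of dimension $8$. An $SU(3)$ structure on $(M,g)$ is a smooth tensor field $\Upsilon$ of type $(0,3)$ which in orthonormal frames satisfies (i) $\Upsilon_{IJK}$ is totally symmetric, (ii) $\Upsilon_{IJJ}=0$, (iii) $\Upsilon_{JKI}\Upsilon_{LMI}+\Upsilon_{LJI}\Upsilon_{KMI}+\Upsilon_{KLI}\Upsilon_{JMI}=g_{JK}g_{LM}+g_{LJ}g_{KM}+g_{KL}g_{JM}$ (repeated indices are summed). An orthonormal frame with dual coframe $(\theta^1,\dots,\theta^8)$ is called adapted if in it $$\Upsilon=\tfrac12\det\begin{pmatrix}\theta^5-\sqrt3\,\theta^4&\sqrt3(\theta^3+i\theta^8)&\sqrt3(\theta^2+i\theta^7)\\ \sqrt3(\theta^3-i\theta^8)&\theta^5+\sqrt3\,\theta^4&\sqrt3(\theta^1+i\theta^6)\\ \sqrt3(\theta^2-i\theta^7)&\sqrt3(\theta^1-i\theta^6)&-2\theta^5\end{pmatrix}$$ (as a cubic form). Put $$\psi=(\theta^1\wedge\theta^4+\theta^2\wedge\theta^3+\sqrt3\,\theta^1\wedge\theta^5)\wedge\theta^6+(\theta^1\wedge\theta^3+\theta^4\wedge\theta^2+\sqrt3\,\theta^2\wedge\theta^5)\wedge\theta^7+(\theta^1\wedge\theta^2+2\,\theta^4\wedge\theta^3)\wedge\theta^8+\theta^6\wedge\theta^7\wedge\theta^8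 .$$ The structure is *restricted nearly integrable* if around every point there is a smooth adapted frame $(e_I)$ in which the components $\Gamma_{IJK}=g(e_I,\nabla^{LC}_{e_K}e_J)$ of the Levi-Civita connection take values in the $118$-dimensional space ${}^8\mathcal V=\{X\in\bigwedge^2\mathbb R^8\otimes\mathbb R^8:\ X_{M(JI}\Upsilon_{KL)M}=0,\ X_{IJK}\psi_{IJK}=0\}$, i.e. in the $SU(3)$-invariant complement of the line $\mathbb R\psi$ in the kernel of $X_{IJK}\mapsto X_{M(JI}\Upsilon_{KL)M}$. A *characteristic connection* is a smooth linear connection $\nabla$ on $TM$ with $\nabla g=0$ and $\nabla\Upsilon=0$ whose torsion $T(X,Y,Z)=g(\nabla_XY-\nabla_YX-[X,Y],Z)$ is totally skew-symmetric, i.e. a 3-form. The torsion is of *purely vectorial type*, $T\in{}^8\odot^2_8$, if at every point, in an adapted orthonormal basis, the tensor $\psi(T)_{IJ}=\psi_{IKL}T_{JKL}$ satisfies $\hat\Upsilon(\psi(T))=-6\,\psi(T)$, where $\hat\Upsilon(W)_{IK}=4\,\Upsilon_{IJM}\Upsilon_{KLM}W_{JL}$. (Such $T$ form the $8$-dimensional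 irreducible $SU(3)$-submodule of $\bigwedge^3\mathbb R^8$.) **Theorem.** Let $(M,g,\Upsilon)$ be a restricted nearly integrable $SU(3)$ structure in dimension eight with a characteristic connection $\nabla$ whose torsion $T$ is of purely vectorial type. Then the 3-form $T$ is coclosed, $$d(*T)=0,$$ where $*$ is the Hodge star of $g$ for any local orientation, and consequently the Ricci tensor $\mathrm{Ric}^\nabla(Y,Z)=\mathrm{tr}\big(X\mapsto R^\nabla(X,Y)Z\big)$ of the characteristic connection is symmetric. -/

import Mathlib

open Bundle Manifold Set
open scoped ContDiff

noncomputable section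

namespace SU3Dim8

/-- The model space of an `8`-manifold. -/
abbrev E8 : Type := EuclideanSpace ℝ (Fin 8)

/-! ### Model tensors on `ℝ⁸` -/

/-- The trace-free hermitian matrix with real coordinates `(x¹, …, x⁸)`; the coordinate `x^I` of the
mathematics is `x (I - 1)` here. -/
def hermMatrix (x : Fin 8 → ℝ) : Matrix (Fin 3) (Fin 3) ℂ :=
  let s : ℂ := ((Real.sqrt 3 : ℝ) : ℂ)
  let z₁ : ℂ := ⟨x 0, x 5⟩
  let z₂ : ℂ := ⟨x 1, x 6⟩
  let z₃ : ℂ := ⟨x 2, x 7⟩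
  !![(x 4 : ℂ) - s * (x 3 : ℂ), s * z₃, s * z₂;
     s * star z₃, (x 4 : ℂ) + s * (x 3 : ℂ), s * z₁;
     s * star z₂, s * star z₁, -2 * (x 4 : ℂ)]

/-- The model cubic form `Υ(x, x, x) = ½ det`. (The determinant is real, the matrix being
hermitian.) -/
def modelCubic (x : Fin 8 → ℝ) : ℝ := (hermMatrix x).det.re / 2

/-- Components `(θ^i ∧ θ^j ∧ θ^k)(e_a, e_b, e_c)` for a coframe `θ` dual to `e`. -/
def wedge3 (i j k a b c : Fin 8) : ℝ :=
  Matrix.det (Matrix.of fun r s : Fin 3 => if ![i, j, k] r = ![a, b, c] s then (1 : ℝ) else 0)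

/-- Components `ψ_{abc}` of the `SU(3)`-invariant 3-form
`ψ = τ₁ ∧ θ⁶ + τ₂ ∧ θ⁷ + τ₃ ∧ θ⁸ + θ⁶ ∧ θ⁷ ∧ θ⁸` with
`τ₁ = θ¹∧θ⁴ + θ²∧θ³ + √3 θ¹∧θ⁵`, `τ₂ = θ¹∧θ³ + θ⁴∧θ² + √3 θ²∧θ⁵`, `τ₃ = θ¹∧θ² + 2 θ⁴∧θ³`
(indices are shifted by one in the code). -/
def psi (a b c : Fin 8) : ℝ :=
  wedge3 0 3 5 a b c + wedge3 1 2 5 a b c + Real.sqrt 3 * wedge3 0 4 5 a b c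
  + wedge3 0 2 6 a b c + wedge3 3 1 6 a b c + Real.sqrt 3 * wedge3 1 4 6 a b c
  + wedge3 0 1 7 a b c + 2 * wedge3 3 2 7 a b c
  + wedge3 5 6 7 a b c

/-- The endomorphism `W^{IK} ↦ 4 Υ_{IJM} Υ_{KLM} W^{JL}` of `⊗²ℝ⁸`, in an orthonormal basis. -/
def hatUpsilon (Y : Fin 8 → Fin 8 → Fin 8 → ℝ) (W : Fin 8 → Fin 8 → ℝ) : Fin 8 → Fin 8 → ℝ :=
  fun i k => 4 * ∑ j, ∑ l, ∑ m, Y i j m * Y k l m * W j l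

/-- The tensor `ψ(ω)_{IJ} = ψ_{IKL} ω_{JKL}` associated with a 3-form `ω`. -/
def psiContract (w : Fin 8 → Fin 8 → Fin 8 → ℝ) : Fin 8 → Fin 8 → ℝ :=
  fun i j => ∑ k, ∑ l, psi i k l * w j k l

/-- The sum `X_{MJI} Υ_{MKL} + X_{MKI} Υ_{JML} + X_{MLI} Υ_{JKM}` (over `M`). -/
def upsilonRow (Y X : Fin 8 → Fin 8 → Fin 8 → ℝ) (i j k l : Fin 8) : ℝ :=
  ∑ m, (X m j i * Y m k l + X m k i * Y j m l + X m l i * Y j k m)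

/-- The map `Υ' : ⋀²ℝ⁸ ⊗ ℝ⁸ → ⊙⁴ℝ⁸`, `Υ'(X)_{IJKL} = 12 X_{M(JI} Υ_{KL)M}`. -/
def upsilonPrime (Y X : Fin 8 → Fin 8 → Fin 8 → ℝ) (i j k l : Fin 8) : ℝ :=
  upsilonRow Y X i j k l + upsilonRow Y X j i k l + upsilonRow Y X k i j l + upsilonRow Y X l i j k

/-- Membership in the 118-dimensional space `𝒱 ⊂ ⋀²ℝ⁸ ⊗ ℝ⁸`, in an adapted basis: the
`SU(3)`-invariant complement, in the 119-dimensional space `ker Υ'`, of the line spanned by `ψ`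
(the only invariant complement is the orthogonal one). -/
def MemV (Y X : Fin 8 → Fin 8 → Fin 8 → ℝ) : Prop :=
  (∀ i j k, X i j k = - X j i k) ∧
  (∀ i j k l, upsilonPrime Y X i j k l = 0) ∧
  ∑ i, ∑ j, ∑ k, X i j k * psi i j k = 0

/-! ### Tensor fields on an `8`-manifold -/

variable {M : Type*} [TopologicalSpace M] [ChartedSpace E8 M]

/-- (Not necessarily smooth) vector fields. -/
abbrev VField (M : Type*) [TopologicalSpace M] [ChartedSpace E8 M] : Type _ :=
  (p : M) → TangentSpace (𝓡 8) p

/-- (Not necessarily smooth) tensor fields of type `(0, 3)`. -/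
abbrev Tensor3 (M : Type*) [TopologicalSpace M] [ChartedSpace E8 M] : Type _ :=
  (p : M) → TangentSpace (𝓡 8) p →L[ℝ] TangentSpace (𝓡 8) p →L[ℝ] TangentSpace (𝓡 8) p →L[ℝ] ℝ

/-- The vector field `X` is smooth on `U`. -/
def SmoothOn [IsManifold (𝓡 8) ∞ M] (X : VField M) (U : Set M) : Prop :=
  ContMDiffOn (𝓡 8) (𝓡 8).tangent ∞ (fun p => (⟨p, X p⟩ : TangentBundle (𝓡 8) M)) U

/-- The tensor field `Υ` is smooth: `Υ(X, Y, Z)` is a smooth function for all smooth local vector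
fields `X`, `Y`, `Z`. -/
def Tensor3.IsSmooth [IsManifold (𝓡 8) ∞ M] (Υ : Tensor3 M) : Prop :=
  ∀ (U : Set M) (X Y Z : VField M), IsOpen U → SmoothOn X U → SmoothOn Y U → SmoothOn Z U →
    ContMDiffOn (𝓡 8) 𝓘(ℝ) ∞ (fun p => Υ p (X p) (Y p) (Z p)) U

/-- Components of a `(0, 3)` tensor with respect to vectors `e₁, …, e₈` at `p`. -/
def comp (Υ : Tensor3 M) {p : M} (e : Fin 8 → TangentSpace (𝓡 8) p) (i j k : Fin 8) : ℝ :=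
  Υ p (e i) (e j) (e k)

variable [IsManifold (𝓡 8) ∞ M]
  [RiemannianBundle (fun p : M => TangentSpace (𝓡 8) p)]

/-- An `SU(3)` structure on a Riemannian `8`-manifold: a smooth tensor field `Υ` with
i) `Υ` totally symmetric, ii) `Υ_{IJJ} = 0`,
iii) `Υ_{JKI}Υ_{LMI} + Υ_{LJI}Υ_{KMI} + Υ_{KLI}Υ_{JMI} = g_{JK}g_{LM} + g_{LJ}g_{KM} + g_{KL}g_{JM}`,
in orthonormal bases of the tangent spaces. -/
structure IsSU3Structure (Υ : Tensor3 M) : Prop where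
  smooth : Υ.IsSmooth
  symm₁₂ : ∀ (p : M) (u v w : TangentSpace (𝓡 8) p), Υ p u v w = Υ p v u w
  symm₂₃ : ∀ (p : M) (u v w : TangentSpace (𝓡 8) p), Υ p u v w = Υ p u w v
  traceFree : ∀ (p : M) (b : OrthonormalBasis (Fin 8) ℝ (TangentSpace (𝓡 8) p))
    (u : TangentSpace (𝓡 8) p), ∑ i, Υ p u (b i) (b i) = 0
  quadratic : ∀ (p : M) (b : OrthonormalBasis (Fin 8) ℝ (TangentSpace (𝓡 8) p))
    (u v w z : TangentSpace (𝓡 8) p),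
    ∑ i, (Υ p u v (b i) * Υ p w z (b i) + Υ p w u (b i) * Υ p v z (b i)
        + Υ p v w (b i) * Υ p u z (b i))
      = inner ℝ u v * inner ℝ w z + inner ℝ w u * inner ℝ v z + inner ℝ v w * inner ℝ u z

/-- `e` is an orthonormal basis of `T_pM` adapted to `Υ`: in the dual coframe `θ`, the cubic form
`Υ` is `½ det` of the hermitian matrix with coordinates `θ¹, …, θ⁸`. -/
def IsAdaptedAt (Υ : Tensor3 M) {p : M} (e : Fin 8 → TangentSpace (𝓡 8) p) : Prop :=
  Orthonormal ℝ e ∧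
    ∀ x : Fin 8 → ℝ, Υ p (∑ i, x i • e i) (∑ i, x i • e i) (∑ i, x i • e i) = modelCubic x

/-- `e` is a smooth orthonormal frame on the open set `U`. -/
def IsOrthonormalFrame (e : Fin 8 → VField M) (U : Set M) : Prop :=
  IsOpen U ∧ (∀ i, SmoothOn (e i) U) ∧ ∀ p ∈ U, Orthonormal ℝ (fun i => e i p)

/-- `e` is a smooth frame on the open set `U` adapted to `Υ`. -/
def IsAdaptedFrame (Υ : Tensor3 M) (e : Fin 8 → VField M) (U : Set M) : Prop :=
  IsOrthonormalFrame e U ∧ ∀ p ∈ U, IsAdaptedAt Υ (fun i => e i p)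

/-! ### Connections -/

/-- Linear connections on `M`, i.e. covariant derivatives on `TM`; `∇ Y p v` is `(∇_v Y)(p)`. -/
abbrev Connection (M : Type*) [TopologicalSpace M] [ChartedSpace E8 M]
    [IsManifold (𝓡 8) ∞ M] : Type _ :=
  CovariantDerivative (𝓡 8) E8 (fun p : M => TangentSpace (𝓡 8) p)

/-- The connection preserves `Υ`, i.e. `∇Υ = 0`:
`v(Υ(X, Y, Z)) = Υ(∇_v X, Y, Z) + Υ(X, ∇_v Y, Z) + Υ(X, Y, ∇_v Z)`. -/
def Preserves (nabla : Connection M) (Υ : Tensor3 M) : Prop :=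
  ∀ (p : M) (U : Set M) (X Y Z : VField M), IsOpen U → p ∈ U →
    SmoothOn X U → SmoothOn Y U → SmoothOn Z U →
    ∀ v : TangentSpace (𝓡 8) p,
      mvfderiv (𝓡 8) (fun q => Υ q (X q) (Y q) (Z q)) p v
        = Υ p (nabla X p v) (Y p) (Z p) + Υ p (X p) (nabla Y p v) (Z p)
          + Υ p (X p) (Y p) (nabla Z p v)

/-- The torsion tensor with all indices down, `T(u, v, w) = g(T(u, v), w)`. -/
def torsion3 (nabla : Connection M) (p : M) (u v w : TangentSpace (𝓡 8) p) : ℝ :=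
  inner ℝ (nabla.torsion p u v) w

/-- The curvature operator `R(X, Y)Z = ∇_X ∇_Y Z - ∇_Y ∇_X Z - ∇_[X,Y] Z`. -/
def curvature (nabla : Connection M) (X Y Z : VField M) : VField M := fun p =>
  nabla (fun q => nabla Z q (Y q)) p (X p) - nabla (fun q => nabla Z q (X q)) p (Y p)
    - nabla Z p (VectorField.mlieBracket (𝓡 8) X Y p)

variable [IsContMDiffRiemannianBundle (𝓡 8) ∞ E8 (fun p : M => TangentSpace (𝓡 8) p)]

instance instRiemannianOne :
    IsContMDiffRiemannianBundle (𝓡 8) 1 E8 (fun p : M => TangentSpace (𝓡 8) p) :=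
  IsContMDiffRiemannianBundle.of_le (n := ∞) (by simp)

/-- The Levi-Civita connection: metric and torsion-free. -/
def IsLeviCivita (nabla : Connection M) : Prop :=
  nabla.IsMetricCompatible ∧ nabla.torsion = 0

/-- The structure is restricted nearly integrable: around every point there is an adapted frame in
which the components `Γ_{IJK} = g(e_I, ∇_{e_K} e_J)` of the Levi-Civita connection take values in
the 118-dimensional space `𝒱`. -/
def IsRestrictedNearlyIntegrable (Υ : Tensor3 M) : Prop :=
  ∃ lc : Connection M, IsLeviCivita lc ∧
    ∀ p : M, ∃ (U : Set M) (e : Fin 8 → VField M), p ∈ U ∧ IsAdaptedFrame Υ e U ∧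
      ∀ q ∈ U, MemV (comp Υ (fun i => e i q))
        (fun i j k => inner ℝ (e i q) (lc (e j) q (e k q)))

/-- `nabla` is a characteristic connection: a smooth connection preserving `g` and `Υ` (that is, an
`𝔰𝔲(3)`-valued one) whose torsion `T(u, v, w) = g(T(u, v), w)` is a 3-form; equivalently, its
connection form `Γ` satisfies `Γ^{LC} = Γ + ½ T` with `T` a 3-form. These conditions determine `T`
up to adding a multiple of `ψ`, a freedom which a torsion of vectorial type does not have. -/
structure IsCharacteristicConnection (nabla : Connection M) (Υ : Tensor3 M) : Prop where
  smooth : nabla.ContMDiffCovariantDerivative ∞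
  metric : nabla.IsMetricCompatible
  preserves : Preserves nabla Υ
  skew : ∀ (p : M) (u v w : TangentSpace (𝓡 8) p),
    torsion3 nabla p u v w = - torsion3 nabla p u w v

/-- The torsion is of purely vectorial type, `T ∈ ⊙²₈`: in an adapted basis of each tangent space,
`ψ(T)` lies in the eigenspace of `Υ̂` with eigenvalue `-6`. (The condition does not depend on the
adapted basis: two such bases differ by an orthogonal map fixing `Υ`, which maps `ψ` to `±ψ`.) -/
def HasVectorialTorsion (nabla : Connection M) (Υ : Tensor3 M) : Prop :=
  ∀ p : M, ∃ e : Fin 8 → TangentSpace (𝓡 8) p, IsAdaptedAt Υ e ∧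
    ∀ i j, hatUpsilon (comp Υ e)
        (psiContract fun a b c => torsion3 nabla p (e a) (e b) (e c)) i j
      = -6 * psiContract (fun a b c => torsion3 nabla p (e a) (e b) (e c)) i j

/-! ### Hodge star, exterior derivative, Ricci tensor -/

/-- The volume form `θ¹ ∧ ⋯ ∧ θ⁸` of an orthonormal basis `e`. -/
def volForm {p : M} (e v : Fin 8 → TangentSpace (𝓡 8) p) : ℝ :=
  Matrix.det (Matrix.of fun a b : Fin 8 => inner ℝ (e a) (v b))

/-- The Hodge star of a 3-form, for the orientation given by the orthonormal basis `e`: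
`(*T)(w₁, …, w₅) = (1/6) T_{IJK} vol(e_I, e_J, e_K, w₁, …, w₅)`. -/
def hodgeStar3 {p : M}
    (T : TangentSpace (𝓡 8) p → TangentSpace (𝓡 8) p → TangentSpace (𝓡 8) p → ℝ)
    (e : Fin 8 → TangentSpace (𝓡 8) p) (w : Fin 5 → TangentSpace (𝓡 8) p) : ℝ :=
  (1 / 6) * ∑ i, ∑ j, ∑ k, T (e i) (e j) (e k) * volForm e (Fin.append ![e i, e j, e k] w)

/-- The exterior derivative of a differential form of degree `n + 1`, evaluated on vector fields:
`dφ(X₀, …, X_{n+1}) = ∑_i (-1)^i X_i(φ(…, X̂_i, …))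
  + ∑_{i<j} (-1)^{i+j} φ([X_i, X_j], …, X̂_i, …, X̂_j, …)`.
(The pair `i < j` is written as `i.castSucc`, `j.succ` with `i ≤ j`, which changes the sign.) -/
def extDerivative {n : ℕ} (φ : (p : M) → (Fin (n + 1) → TangentSpace (𝓡 8) p) → ℝ)
    (X : Fin (n + 2) → VField M) (p : M) : ℝ :=
  (∑ i : Fin (n + 2), (-1 : ℝ) ^ (i : ℕ) *
      mvfderiv (𝓡 8) (fun q => φ q (i.removeNth fun a => X a q)) p (X i p))
    - ∑ i : Fin (n + 1), ∑ j ∈ Finset.univ.filter (fun j : Fin (n + 1) => i ≤ j),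
        (-1 : ℝ) ^ ((i : ℕ) + (j : ℕ)) *
          φ p (Matrix.vecCons (VectorField.mlieBracket (𝓡 8) (X i.castSucc) (X j.succ) p)
            (j.removeNth (i.castSucc.removeNth fun a => X a p)))

/-- The 3-form `T` is coclosed, `d(*T) = 0`, where `*` is taken locally with respect to the
orientation of an arbitrary smooth orthonormal frame. -/
def IsCoclosed3
    (T : (p : M) → TangentSpace (𝓡 8) p → TangentSpace (𝓡 8) p → TangentSpace (𝓡 8) p → ℝ) :
    Prop :=
  ∀ (U : Set M) (e : Fin 8 → VField M), IsOrthonormalFrame e U →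
    ∀ X : Fin 6 → VField M, (∀ i, SmoothOn (X i) U) → ∀ p ∈ U,
      extDerivative (fun q w => hodgeStar3 (T q) (fun i => e i q) w) X p = 0

instance instFiniteDimensionalTangent (p : M) : FiniteDimensional ℝ (TangentSpace (𝓡 8) p) :=
  inferInstanceAs (FiniteDimensional ℝ E8)

/-- The Ricci tensor `Ric(v, w) = tr (u ↦ R(u, v) w)` of a connection. The value of the curvature at
`p` only depends on the values of its arguments at `p`, so we extend these to vector fields that are
smooth near `p`. -/
def ricci (nabla : Connection M) (p : M) (v w : TangentSpace (𝓡 8) p) : ℝ :=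
  let b := stdOrthonormalBasis ℝ (TangentSpace (𝓡 8) p)
  ∑ i, inner ℝ
    (curvature nabla (FiberBundle.extend E8 (b i)) (FiberBundle.extend E8 v)
      (FiberBundle.extend E8 w) p) (b i)

end SU3Dim8

end

open SU3Dim8

/-!
The torsion `T` of vectorial type has zero divergence `∇_a T_{ajk} = 0` for purely representation
theoretic reasons once the first Bianchi identity is available; both claims follow from that.

*Algebra.* In an orthonormal basis the quadratic condition on `Υ` is an anticommutation relation
for the eight symmetric matrices `Υ_a = (Υ_{abc})_{b,c}` (`IsSU3Tensor.anticommutator`). It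
implies that the operator `P : W_{JL} ↦ Υ_{IJM} Υ_{KLM} W_{JL}` satisfies `P² = P/2 + 5` on
2-forms (`IsSU3Tensor.contractOp_contractOp`), so that its eigenvalues there are `5/2` and `-2`.

*Vectorial type.* The condition `Υ̂(ψ(T)) = -6 ψ(T)` involves the 3-form `ψ`, and an adapted
basis. It implies an eigenvalue equation `skewOp d T = 3 T` in which only `Υ` occurs
(`isVectorial_of_hatUpsilon`), because the contraction `ψ_{ABM} ψ_{KLM}` is a polynomial in the
metric and `Υ` (`IsAdaptedTensor.sum_psi_mul_psi`). This last identity is the completeness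
relation for traceless hermitian `3 × 3` matrices, where `Υ` is the symmetric and `ψ` the skew
part of the trace of a triple product. The equation `skewOp d T = 3 T` makes sense in every
orthonormal basis and is preserved by the stabilizer of `Υ`. As `∇Υ = 0`, the covariant
derivatives of `T` satisfy it too (`isVectorial_covDeriv`).

*Divergence.* The curvature of `∇` takes values in the stabilizer of `Υ`
(`inStabilizer_curvature`). Its cyclic sum is the cyclic sum of `∇T` plus a totally skew term
quadratic in `T` (`sum_inner_curvature`). Let `τ` be the divergence of `T`. Comparing the
contraction of this identity with the metric and the one with `Υ_{aKm} Υ_{bem}` eliminates the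
curvature and the quadratic term, and leaves `P τ = τ / 4` (`IsSU3Tensor.divergence_eq_zero`). As
`1/4` is not an eigenvalue of `P`, `τ = 0` (`divergence_torsion`).

*Ricci tensor.* The metric contraction of the same identity says that `τ` is the skew part of the
Ricci tensor, up to a factor (`ricci_symm`).

*Coclosedness.* The connection `∇` is `∇^{LC} + ½ T`, and the correction does not change the
divergence of `T` (`divergence_leviCivita`). The exterior derivative of `*T` is the alternation of
`∇^{LC}(*T)`, the bracket terms being absorbed because `∇^{LC}` is torsion-free
(`extDerivative_eq_sum`), and `∇^{LC}(*T) = *∇^{LC}T` (`mvfderiv_hodgeStar3`). Finally the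
alternation of `*∇^{LC}T` vanishes with the divergence (`sum_hodgeStar3_eq_zero`): there is no
alternating 9-form in eight dimensions, which takes the shape of a `9 × 9` determinant with two
equal rows.
-/

/-! ### Algebra of `SU(3)` tensors -/

namespace SU3Dim8

open Matrix

/-- The algebraic conditions satisfied by the components of an `SU(3)` structure in an
orthonormal basis. -/
structure IsSU3Tensor (d : Fin 8 → Fin 8 → Fin 8 → ℝ) : Prop where
  symm₁₂ : ∀ i j k, d i j k = d j i k
  symm₂₃ : ∀ i j k, d i j k = d i k j
  traceFree : ∀ i, ∑ j, d i j j = 0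
  quadratic : ∀ j k l m, ∑ i, (d j k i * d l m i + d l j i * d k m i + d k l i * d j m i)
    = (1 : Matrix (Fin 8) (Fin 8) ℝ) j k * (1 : Matrix (Fin 8) (Fin 8) ℝ) l m
      + (1 : Matrix (Fin 8) (Fin 8) ℝ) l j * (1 : Matrix (Fin 8) (Fin 8) ℝ) k m
      + (1 : Matrix (Fin 8) (Fin 8) ℝ) k l * (1 : Matrix (Fin 8) (Fin 8) ℝ) j m

/-- The matrix `(t_{iab})_{a,b}` obtained by fixing the first index of a tensor. -/
def sliceMatrix (t : Fin 8 → Fin 8 → Fin 8 → ℝ) (i : Fin 8) : Matrix (Fin 8) (Fin 8) ℝ :=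
  Matrix.of (t i)

@[simp] lemma sliceMatrix_apply (t : Fin 8 → Fin 8 → Fin 8 → ℝ) (i a b : Fin 8) :
    sliceMatrix t i a b = t i a b := rfl

lemma transpose_sliceMatrix_of_symm {d : Fin 8 → Fin 8 → Fin 8 → ℝ}
    (h : ∀ i j k, d i j k = d i k j) (i : Fin 8) : (sliceMatrix d i)ᵀ = sliceMatrix d i := by
  ext a b; exact h i b a

/-- A 3-tensor is skew if it changes sign under transpositions of neighbouring indices. -/
def IsSkew3 (t : Fin 8 → Fin 8 → Fin 8 → ℝ) : Prop :=
  (∀ i j k, t i j k = - t j i k) ∧ ∀ i j k, t i j k = - t i k j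

lemma IsSkew3.cyc {t : Fin 8 → Fin 8 → Fin 8 → ℝ} (h : IsSkew3 t) (i j k : Fin 8) :
    t i j k = t j k i := by
  rw [h.1 i j k, h.2 j i k, neg_neg]

lemma IsSkew3.transpose_slice {t : Fin 8 → Fin 8 → Fin 8 → ℝ} (h : IsSkew3 t) (i : Fin 8) :
    (sliceMatrix t i)ᵀ = - sliceMatrix t i := by
  ext a b; simpa using h.2 i b a

/-- A sum of products of a skew and a symmetric array vanishes. -/
lemma sum_skew_mul_symm {x y : Fin 8 → Fin 8 → ℝ} (hx : ∀ a b, x a b = - x b a)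
    (hy : ∀ a b, y a b = y b a) : ∑ a, ∑ b, x a b * y a b = 0 := by
  have h : ∑ a, ∑ b, x a b * y a b = - ∑ a, ∑ b, x a b * y a b := by
    conv_lhs => rw [Finset.sum_comm]
    simp only [← Finset.sum_neg_distrib]
    refine Finset.sum_congr rfl fun a _ => Finset.sum_congr rfl fun b _ => ?_
    rw [hx b a, hy b a]; ring
  linarith

namespace IsSU3Tensor

variable {d : Fin 8 → Fin 8 → Fin 8 → ℝ} (hd : IsSU3Tensor d)
include hd

lemma swap₁₃ (i j k : Fin 8) : d i j k = d k j i := by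
  rw [hd.symm₁₂ i j k, hd.symm₂₃ j i k, hd.symm₁₂ j k i]

lemma transpose_slice (i : Fin 8) : (sliceMatrix d i)ᵀ = sliceMatrix d i :=
  transpose_sliceMatrix_of_symm hd.symm₂₃ i

lemma trace_slice (i : Fin 8) : (sliceMatrix d i).trace = 0 := hd.traceFree i

lemma sum_mul_eq (a b : Fin 8) :
    ∑ i, ∑ j, d a i j * d b i j = 5 * (1 : Matrix (Fin 8) (Fin 8) ℝ) a b := by
  have h : ∑ j, ∑ i, (d j j i * d a b i + d a j i * d j b i + d j a i * d j b i)
      = ∑ j : Fin 8, ((1 : Matrix (Fin 8) (Fin 8) ℝ) j j * (1 : Matrix (Fin 8) (Fin 8) ℝ) a b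
      + (1 : Matrix (Fin 8) (Fin 8) ℝ) a j * (1 : Matrix (Fin 8) (Fin 8) ℝ) j b
      + (1 : Matrix (Fin 8) (Fin 8) ℝ) j a * (1 : Matrix (Fin 8) (Fin 8) ℝ) j b) :=
    Finset.sum_congr rfl fun j _ => hd.quadratic j j a b
  have h0 : ∑ j, ∑ i, d j j i * d a b i = 0 := by
    rw [Finset.sum_comm]
    refine Finset.sum_eq_zero fun i _ => ?_
    rw [← Finset.sum_mul]
    have : ∑ j, d j j i = 0 := by
      rw [← hd.traceFree i]
      exact Finset.sum_congr rfl fun j _ => hd.swap₁₃ j j i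
    rw [this, zero_mul]
  have h1 : ∑ j, ∑ i, d a j i * d j b i = ∑ j, ∑ i, d a j i * d b j i := by
    simp only [hd.symm₁₂ b]
  have h2 : ∑ j, ∑ i, d j a i * d j b i = ∑ j, ∑ i, d a j i * d b j i := by
    simp only [hd.symm₁₂ _ a, hd.symm₁₂ _ b]
  have h3 : ∑ j : Fin 8, ((1 : Matrix (Fin 8) (Fin 8) ℝ) j j * (1 : Matrix (Fin 8) (Fin 8) ℝ) a b
      + (1 : Matrix (Fin 8) (Fin 8) ℝ) a j * (1 : Matrix (Fin 8) (Fin 8) ℝ) j b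
      + (1 : Matrix (Fin 8) (Fin 8) ℝ) j a * (1 : Matrix (Fin 8) (Fin 8) ℝ) j b)
      = 10 * (1 : Matrix (Fin 8) (Fin 8) ℝ) a b := by
    rcases eq_or_ne a b with rfl | hab
    · simp [Finset.sum_add_distrib, Matrix.one_apply]
      norm_num
    · simp [Finset.sum_add_distrib, Matrix.one_apply, hab, hab.symm]
  simp only [Finset.sum_add_distrib] at h h3
  rw [h3, h0, h1, h2] at h
  linarith

lemma trace_mul_slice (a b : Fin 8) :
    (sliceMatrix d a * sliceMatrix d b).trace = 5 * (1 : Matrix (Fin 8) (Fin 8) ℝ) a b := by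
  rw [← hd.sum_mul_eq a b]
  simp only [Matrix.trace, Matrix.diag, Matrix.mul_apply, sliceMatrix_apply]
  simp only [hd.symm₂₃ b]

/-- The quadratic condition on an `SU(3)` tensor says that the matrices `Υ_a` satisfy a Jordan type
anticommutation relation. -/
lemma anticommutator (b x : Fin 8) :
    sliceMatrix d b * sliceMatrix d x + sliceMatrix d x * sliceMatrix d b
      = (1 : Matrix (Fin 8) (Fin 8) ℝ) b x • (1 : Matrix (Fin 8) (Fin 8) ℝ)
        + Matrix.single b x 1 + Matrix.single x b 1 - ∑ j, d b x j • sliceMatrix d j := by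
  ext m n
  have h := hd.quadratic b x m n
  have e1 : (∑ j, d b x j • sliceMatrix d j) m n = ∑ i, d b x i * d m n i := by
    simp only [Matrix.sum_apply, Matrix.smul_apply, sliceMatrix_apply, smul_eq_mul]
    exact Finset.sum_congr rfl fun j _ => by rw [hd.symm₁₂ m n j, hd.swap₁₃ n m j, hd.symm₂₃ j m n]
  have e2 : (sliceMatrix d b * sliceMatrix d x) m n = ∑ i, d m b i * d x n i := by
    simp only [Matrix.mul_apply, sliceMatrix_apply]
    exact Finset.sum_congr rfl fun j _ => by rw [hd.symm₁₂ b m j, hd.symm₂₃ x j n]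
  have e3 : (sliceMatrix d x * sliceMatrix d b) m n = ∑ i, d x m i * d b n i := by
    simp only [Matrix.mul_apply, sliceMatrix_apply]
    exact Finset.sum_congr rfl fun j _ => by rw [hd.symm₂₃ b j n]
  simp only [Finset.sum_add_distrib] at h
  simp only [Matrix.add_apply, Matrix.sub_apply, e1, e2, e3, Matrix.smul_apply, smul_eq_mul]
  have e4 : (Matrix.single b x (1 : ℝ)) m n
      = (1 : Matrix (Fin 8) (Fin 8) ℝ) m b * (1 : Matrix (Fin 8) (Fin 8) ℝ) x n := by
    simp only [Matrix.single_apply, Matrix.one_apply, eq_comm (a := m)]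
    by_cases h1 : b = m <;> by_cases h2 : x = n <;> simp [h1, h2]
  have e5 : (Matrix.single x b (1 : ℝ)) m n
      = (1 : Matrix (Fin 8) (Fin 8) ℝ) x m * (1 : Matrix (Fin 8) (Fin 8) ℝ) b n := by
    simp only [Matrix.single_apply, Matrix.one_apply]
    by_cases h1 : x = m <;> by_cases h2 : b = n <;> simp [h1, h2]
  rw [e4, e5]
  linarith

/-- Trace of the anticommutation relation multiplied by a further matrix `Υ_j`. -/
lemma trace_mul_mul_slice (j c y : Fin 8) :
    (sliceMatrix d j * (sliceMatrix d c * sliceMatrix d y)).trace = -(3 / 2) * d j c y := by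
  have hc : (sliceMatrix d j * (sliceMatrix d y * sliceMatrix d c)).trace
      = (sliceMatrix d j * (sliceMatrix d c * sliceMatrix d y)).trace := by
    rw [← Matrix.trace_transpose, Matrix.transpose_mul, Matrix.transpose_mul, hd.transpose_slice,
      hd.transpose_slice, hd.transpose_slice, Matrix.trace_mul_comm]
  have h := congrArg (fun A => (sliceMatrix d j * A).trace) (hd.anticommutator c y)
  simp only [mul_add, mul_sub, Matrix.trace_add, Matrix.trace_sub, hc, Matrix.mul_smul,
    Matrix.trace_smul, mul_one, hd.trace_slice, Matrix.mul_sum, Matrix.trace_sum,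
    hd.trace_mul_slice, Matrix.trace_mul_single, sliceMatrix_apply] at h
  have e : ∑ i, d c y i • (5 * (1 : Matrix (Fin 8) (Fin 8) ℝ) j i) = 5 * d c y j := by
    simp [Matrix.one_apply, mul_comm]
  rw [e] at h
  rw [hd.swap₁₃ c y j, hd.symm₂₃ j y c] at h
  simp only [smul_eq_mul, mul_zero, MulOpposite.op_one, one_smul] at h
  linarith

end IsSU3Tensor

/-- The operator `W_{JL} ↦ Υ_{IJM} Υ_{KLM} W_{JL}` on 2-tensors, a quarter of `Υ̂`. -/
def contractOp (d : Fin 8 → Fin 8 → Fin 8 → ℝ) (W : Matrix (Fin 8) (Fin 8) ℝ) :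
    Matrix (Fin 8) (Fin 8) ℝ :=
  Matrix.of fun i k => (sliceMatrix d i * W * sliceMatrix d k).trace

lemma contractOp_smul (d : Fin 8 → Fin 8 → Fin 8 → ℝ) (c : ℝ) (W : Matrix (Fin 8) (Fin 8) ℝ) :
    contractOp d (c • W) = c • contractOp d W := by
  ext i k; simp [contractOp]

lemma contractOp_apply (d : Fin 8 → Fin 8 → Fin 8 → ℝ) (W : Matrix (Fin 8) (Fin 8) ℝ)
    (i k : Fin 8) : contractOp d W i k = (sliceMatrix d i * W * sliceMatrix d k).trace := rfl

namespace IsSU3Tensor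

variable {d : Fin 8 → Fin 8 → Fin 8 → ℝ} (hd : IsSU3Tensor d)
include hd

lemma contractOp_transpose (W : Matrix (Fin 8) (Fin 8) ℝ) :
    contractOp d Wᵀ = (contractOp d W)ᵀ := by
  ext i k
  rw [Matrix.transpose_apply, contractOp_apply, contractOp_apply, ← Matrix.trace_transpose]
  simp only [Matrix.transpose_mul, hd.transpose_slice, Matrix.transpose_transpose, mul_assoc]

lemma contractOp_eq_sum (W : Matrix (Fin 8) (Fin 8) ℝ) :
    contractOp d W = ∑ b, ∑ c, W b c • (sliceMatrix d b * sliceMatrix d c) := by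
  ext i k
  simp only [contractOp_apply, Matrix.trace, Matrix.diag, Matrix.mul_apply, Matrix.sum_apply,
    Matrix.smul_apply, sliceMatrix_apply, smul_eq_mul, Finset.sum_mul, Finset.mul_sum]
  rw [Finset.sum_congr rfl fun x _ => Finset.sum_comm, Finset.sum_comm]
  refine Finset.sum_congr rfl fun b _ => ?_
  rw [Finset.sum_comm]
  refine Finset.sum_congr rfl fun c _ => Finset.sum_congr rfl fun m _ => ?_
  rw [hd.swap₁₃ k c m, hd.symm₁₂ m c k, hd.swap₁₃ i m b]
  rw [hd.symm₁₂ b m i, hd.swap₁₃ m b i, hd.symm₁₂ i b m]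
  ring

/-- On skew 2-tensors the operator `W_{JL} ↦ Υ_{IJM} Υ_{KLM} W_{JL}` satisfies `P² = P/2 + 5`, so
that its eigenvalues there are `5/2` and `-2`. -/
lemma contractOp_contractOp {β : Matrix (Fin 8) (Fin 8) ℝ} (hβ : βᵀ = -β) :
    contractOp d (contractOp d β) = (1 / 2 : ℝ) • contractOp d β + (5 : ℝ) • β := by
  have hβ' : ∀ b c, β b c = - β c b := fun b c => by
    have := congrFun (congrFun hβ c) b
    simpa using this
  set D := sliceMatrix d with hD
  have hM : (contractOp d β)ᵀ = - contractOp d β := by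
    rw [← hd.contractOp_transpose, hβ]
    ext i k; simp [contractOp_apply]
  ext x y
  -- the contribution of one use of the anticommutation relation
  have key : ∀ x y, ∑ b, ∑ c, β b c * ((D x * D b + D b * D x) * (D c * D y)).trace
      = 5 * β x y + (1 / 2) * contractOp d β x y := by
    intro x y
    have t1 : ∀ b c, β b c * ((D x * D b + D b * D x) * (D c * D y)).trace
        = 5 * (β b c * ((1 : Matrix (Fin 8) (Fin 8) ℝ) x b * (1 : Matrix (Fin 8) (Fin 8) ℝ) c y))
          + β b c * (D c * D y) b x + β b c * (D c * D y) x b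
          + (3 / 2) * ∑ j, β b c * d x b j * d j c y := by
      intro b c
      rw [hd.anticommutator x b]
      simp only [sub_mul, add_mul, Matrix.trace_sub, Matrix.trace_add, Matrix.smul_mul, one_mul,
        Matrix.trace_smul, hd.trace_mul_slice, Matrix.trace_single_mul, Finset.sum_mul,
        Matrix.trace_sum, hd.trace_mul_mul_slice, hD, smul_eq_mul]
      rw [mul_sub, Finset.mul_sum, Finset.mul_sum, sub_eq_add_neg, ← Finset.sum_neg_distrib]
      congr 1
      · ring
      · exact Finset.sum_congr rfl fun j _ => by ring
    simp only [t1, Finset.sum_add_distrib, ← Finset.mul_sum]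
    have s1 : ∑ b, ∑ c, β b c * ((1 : Matrix (Fin 8) (Fin 8) ℝ) x b
        * (1 : Matrix (Fin 8) (Fin 8) ℝ) c y) = β x y := by
      simp [Matrix.one_apply]
    have s2 : ∑ b, ∑ c, β b c * (D c * D y) b x = 0 := by
      have : ∀ c, ∑ b, β b c * (D c * D y) b x = ∑ m, (∑ b, β b c * d c b m) * d y m x := by
        intro c
        simp only [hD, Matrix.mul_apply, sliceMatrix_apply, Finset.mul_sum, Finset.sum_mul]
        rw [Finset.sum_comm]
        exact Finset.sum_congr rfl fun _ _ => Finset.sum_congr rfl fun _ _ => by ring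
      rw [Finset.sum_comm, Finset.sum_congr rfl fun c _ => this c, Finset.sum_comm]
      refine Finset.sum_eq_zero fun m _ => ?_
      rw [← Finset.sum_mul, sum_skew_mul_symm (fun a b => hβ' b a) (fun a b => hd.symm₁₂ a b m),
        zero_mul]
    have s3 : ∑ b, ∑ c, β b c * (D c * D y) x b = - contractOp d β x y := by
      have : contractOp d β x y = - contractOp d β y x := by
        have := congrFun (congrFun hM y) x
        simpa using this
      rw [this, neg_neg, hd.contractOp_eq_sum]
      simp only [Matrix.sum_apply, Matrix.smul_apply, smul_eq_mul, Matrix.mul_apply, hD,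
          sliceMatrix_apply]
      refine Finset.sum_congr rfl fun b _ => Finset.sum_congr rfl fun c _ => ?_
      congr 1
      refine Finset.sum_congr rfl fun m _ => ?_
      rw [hd.symm₂₃ c x m, hd.symm₂₃ y m b, hd.symm₁₂ y b m]
      ring
    have s4 : ∑ b, ∑ c, ∑ j, β b c * d x b j * d j c y = contractOp d β x y := by
      rw [hd.contractOp_eq_sum]
      simp only [Matrix.sum_apply, Matrix.smul_apply, smul_eq_mul, Matrix.mul_apply,
        sliceMatrix_apply, Finset.mul_sum]
      refine Finset.sum_congr rfl fun b _ => Finset.sum_congr rfl fun c _ =>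
        Finset.sum_congr rfl fun m _ => ?_
      rw [hd.symm₁₂ x b m, hd.symm₁₂ m c y]; ring
    rw [s1, s2, s3, s4]; ring
  have expand : ∀ (A B : Matrix (Fin 8) (Fin 8) ℝ),
      (A * contractOp d β * B).trace = ∑ b, ∑ c, β b c * (A * D b * (D c * B)).trace := by
    intro A B
    rw [hd.contractOp_eq_sum]
    simp only [Matrix.mul_sum, Matrix.sum_mul, Matrix.trace_sum, Matrix.mul_smul, Matrix.smul_mul,
      Matrix.trace_smul, smul_eq_mul, mul_assoc, hD]
  -- moving `Υ_x` through `Υ_b Υ_c` to the right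
  have hsplit : contractOp d (contractOp d β) x y
      = (∑ b, ∑ c, β b c * ((D x * D b + D b * D x) * (D c * D y)).trace)
        - (∑ b, ∑ c, β b c * ((D b * ((D x * D c + D c * D x) * D y)).trace))
        + ∑ b, ∑ c, β b c * (1 * D b * (D c * (D x * D y))).trace := by
    rw [contractOp_apply, expand, ← Finset.sum_sub_distrib, ← Finset.sum_add_distrib]
    refine Finset.sum_congr rfl fun b _ => ?_
    rw [← Finset.sum_sub_distrib, ← Finset.sum_add_distrib]
    refine Finset.sum_congr rfl fun c _ => ?_
    rw [← mul_sub, ← mul_add]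
    congr 1
    rw [← Matrix.trace_sub, ← Matrix.trace_add]
    congr 1
    noncomm_ring
  have hlast : ∑ b, ∑ c, β b c * (1 * D b * (D c * (D x * D y))).trace
      = - contractOp d (contractOp d β) x y := by
    rw [← expand, contractOp_apply, one_mul, ← Matrix.trace_transpose]
    simp only [Matrix.transpose_mul, hM, hD, hd.transpose_slice]
    rw [mul_neg, Matrix.trace_neg, mul_assoc, mul_assoc, Matrix.trace_mul_comm (sliceMatrix d x),
      ← mul_assoc, Matrix.trace_mul_comm, mul_assoc]
  have hsecond : ∑ b, ∑ c, β b c * ((D b * ((D x * D c + D c * D x) * D y)).trace)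
      = - (5 * β x y + (1 / 2) * contractOp d β x y) := by
    rw [← key x y, Finset.sum_comm, ← Finset.sum_neg_distrib]
    refine Finset.sum_congr rfl fun b _ => ?_
    rw [← Finset.sum_neg_distrib]
    refine Finset.sum_congr rfl fun c _ => ?_
    rw [hβ' c b, neg_mul]
    congr 2
    rw [← Matrix.trace_transpose]
    simp only [Matrix.transpose_mul, Matrix.transpose_add, hD, hd.transpose_slice]
    rw [mul_assoc, Matrix.trace_mul_comm, add_comm]
    rw [mul_assoc]
  rw [hlast, hsecond, key] at hsplit
  simp only [Matrix.add_apply, Matrix.smul_apply, smul_eq_mul]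
  linarith

end IsSU3Tensor

end SU3Dim8

/-! ### Vectorial type and the contracted Bianchi identity -/

namespace SU3Dim8

open Matrix

/-- The operator `T_{IJK} ↦ Υ_{IAM} Υ_{JBM} T_{ABK} + (cyclic)` on 3-forms. It only involves `Υ`, so
that it makes sense in any orthonormal basis. -/
def skewOp (d t : Fin 8 → Fin 8 → Fin 8 → ℝ) (i j k : Fin 8) : ℝ :=
  (sliceMatrix t k * sliceMatrix d j * sliceMatrix d i).trace
    + (sliceMatrix t i * sliceMatrix d k * sliceMatrix d j).trace
    + (sliceMatrix t j * sliceMatrix d i * sliceMatrix d k).trace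

/-- The `8`-dimensional irreducible module of 3-forms, described as an eigenspace of `skewOp`. (The
other eigenvalues of that operator are `15/2`, `-3/2` and `-9/2`.) -/
def IsVectorial (d t : Fin 8 → Fin 8 → Fin 8 → ℝ) : Prop :=
  ∀ i j k, skewOp d t i j k = 3 * t i j k

/-- The derivation action of a matrix on 3-tensors. -/
def actTensor (G : Matrix (Fin 8) (Fin 8) ℝ) (t : Fin 8 → Fin 8 → Fin 8 → ℝ) (i j k : Fin 8) : ℝ :=
  ∑ m, (G m i * t m j k + G m j * t i m k + G m k * t i j m)

/-- The Lie algebra of skew matrices that annihilate the tensor `d`. -/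
def InStabilizer (d : Fin 8 → Fin 8 → Fin 8 → ℝ) (G : Matrix (Fin 8) (Fin 8) ℝ) : Prop :=
  Gᵀ = -G ∧ ∀ i j k, actTensor G d i j k = 0

lemma InStabilizer.skew {d : Fin 8 → Fin 8 → Fin 8 → ℝ} {G : Matrix (Fin 8) (Fin 8) ℝ}
    (h : InStabilizer d G) (i j : Fin 8) : G i j = - G j i := by
  have := congrFun (congrFun h.1 j) i
  simpa using this

lemma sliceMatrix_actTensor {G : Matrix (Fin 8) (Fin 8) ℝ} (hG : Gᵀ = -G)
    (t : Fin 8 → Fin 8 → Fin 8 → ℝ) (i : Fin 8) :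
    sliceMatrix (actTensor G t) i
      = ∑ x, G x i • sliceMatrix t x - (G * sliceMatrix t i - sliceMatrix t i * G) := by
  have : -(G * sliceMatrix t i) = Gᵀ * sliceMatrix t i := by rw [hG, neg_mul]
  rw [sub_eq_add_neg, neg_sub, sub_eq_add_neg, this]
  ext j k
  simp only [sliceMatrix_apply, actTensor, Matrix.add_apply, Matrix.sum_apply, Matrix.smul_apply,
    smul_eq_mul, Matrix.mul_apply, Matrix.transpose_apply, Finset.sum_add_distrib]
  simp only [mul_comm (G _ k)]
  ring

lemma InStabilizer.commutator {d : Fin 8 → Fin 8 → Fin 8 → ℝ} {G : Matrix (Fin 8) (Fin 8) ℝ}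
    (h : InStabilizer d G) (i : Fin 8) :
    G * sliceMatrix d i - sliceMatrix d i * G = ∑ x, G x i • sliceMatrix d x := by
  have h0 : sliceMatrix (actTensor G d) i = 0 := by ext j k; exact h.2 i j k
  rw [sliceMatrix_actTensor h.1] at h0
  exact (sub_eq_zero.mp h0).symm

lemma inStabilizer_of_commutator {d : Fin 8 → Fin 8 → Fin 8 → ℝ} {G : Matrix (Fin 8) (Fin 8) ℝ}
    (hG : Gᵀ = -G)
    (h : ∀ i, G * sliceMatrix d i - sliceMatrix d i * G = ∑ x, G x i • sliceMatrix d x) :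
    InStabilizer d G := by
  refine ⟨hG, fun i j k => ?_⟩
  have h0 : sliceMatrix (actTensor G d) i = 0 := by
    rw [sliceMatrix_actTensor hG, h i, sub_self]
  exact congrFun (congrFun h0 j) k

lemma InStabilizer.lie {d : Fin 8 → Fin 8 → Fin 8 → ℝ} {G H : Matrix (Fin 8) (Fin 8) ℝ}
    (hG : InStabilizer d G) (hH : InStabilizer d H) : InStabilizer d (G * H - H * G) := by
  refine inStabilizer_of_commutator ?_ fun i => ?_
  · rw [Matrix.transpose_sub, Matrix.transpose_mul, Matrix.transpose_mul, hG.1, hH.1]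
    noncomm_ring
  · have e : ∀ {A B : Matrix (Fin 8) (Fin 8) ℝ}, InStabilizer d A → InStabilizer d B →
        A * (B * sliceMatrix d i - sliceMatrix d i * B)
            - (B * sliceMatrix d i - sliceMatrix d i * B) * A
          = ∑ x, (A * B) x i • sliceMatrix d x := by
      intro A B hA hB
      rw [hB.commutator, Matrix.mul_sum, Matrix.sum_mul, ← Finset.sum_sub_distrib]
      simp only [Matrix.mul_smul, Matrix.smul_mul, ← smul_sub, hA.commutator, Matrix.mul_apply,
        Finset.smul_sum, Finset.sum_smul, smul_smul]
      rw [Finset.sum_comm]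
      simp only [mul_comm (B _ i)]
    simp only [Matrix.sub_apply, sub_smul, Finset.sum_sub_distrib]
    rw [← e hG hH, ← e hH hG]
    noncomm_ring

lemma InStabilizer.sub {d : Fin 8 → Fin 8 → Fin 8 → ℝ} {G H : Matrix (Fin 8) (Fin 8) ℝ}
    (hG : InStabilizer d G) (hH : InStabilizer d H) : InStabilizer d (G - H) := by
  refine ⟨by rw [Matrix.transpose_sub, hG.1, hH.1]; abel, fun i j k => ?_⟩
  have e : actTensor (G - H) d i j k = actTensor G d i j k - actTensor H d i j k := by
    simp only [actTensor, ← Finset.sum_sub_distrib, Matrix.sub_apply]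
    exact Finset.sum_congr rfl fun _ _ => by ring
  rw [e, hG.2, hH.2, sub_zero]

lemma InStabilizer.add {d : Fin 8 → Fin 8 → Fin 8 → ℝ} {G H : Matrix (Fin 8) (Fin 8) ℝ}
    (hG : InStabilizer d G) (hH : InStabilizer d H) : InStabilizer d (G + H) := by
  refine ⟨by rw [Matrix.transpose_add, hG.1, hH.1]; abel, fun i j k => ?_⟩
  have e : actTensor (G + H) d i j k = actTensor G d i j k + actTensor H d i j k := by
    simp only [actTensor, ← Finset.sum_add_distrib, Matrix.add_apply]
    exact Finset.sum_congr rfl fun _ _ => by ring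
  rw [e, hG.2, hH.2, add_zero]

/-- The operator `skewOp` commutes with the stabilizer of `d`. -/
lemma InStabilizer.skewOp_actTensor {d : Fin 8 → Fin 8 → Fin 8 → ℝ}
    {G : Matrix (Fin 8) (Fin 8) ℝ} (hG : InStabilizer d G) (t : Fin 8 → Fin 8 → Fin 8 → ℝ)
    (i j k : Fin 8) :
    skewOp d (actTensor G t) i j k = actTensor G (skewOp d t) i j k := by
  have e : ∀ i j k, (sliceMatrix (actTensor G t) k * sliceMatrix d j * sliceMatrix d i).trace
      = ∑ x, (G x k * (sliceMatrix t x * sliceMatrix d j * sliceMatrix d i).trace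
        + G x j * (sliceMatrix t k * sliceMatrix d x * sliceMatrix d i).trace
        + G x i * (sliceMatrix t k * sliceMatrix d j * sliceMatrix d x).trace) := by
    intro i j k
    have h1 : ∑ x, G x j * (sliceMatrix t k * sliceMatrix d x * sliceMatrix d i).trace
        = (sliceMatrix t k * (G * sliceMatrix d j - sliceMatrix d j * G) * sliceMatrix d i).trace
            := by
      rw [hG.commutator]
      simp only [Matrix.mul_sum, Matrix.sum_mul, Matrix.trace_sum, Matrix.mul_smul,
        Matrix.smul_mul, Matrix.trace_smul, smul_eq_mul]
    have h2 : ∑ x, G x i * (sliceMatrix t k * sliceMatrix d j * sliceMatrix d x).trace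
        = (sliceMatrix t k * sliceMatrix d j * (G * sliceMatrix d i - sliceMatrix d i * G)).trace
            := by
      rw [hG.commutator]
      simp only [Matrix.mul_sum, Matrix.trace_sum, Matrix.mul_smul,
        Matrix.trace_smul, smul_eq_mul]
    have h3 : ∑ x, G x k * (sliceMatrix t x * sliceMatrix d j * sliceMatrix d i).trace
        = ((∑ x, G x k • sliceMatrix t x) * sliceMatrix d j * sliceMatrix d i).trace := by
      simp only [Matrix.sum_mul, Matrix.trace_sum, Matrix.smul_mul, Matrix.trace_smul,
        smul_eq_mul]
    rw [Finset.sum_add_distrib, Finset.sum_add_distrib, h1, h2, h3, sliceMatrix_actTensor hG.1]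
    have h4 : (G * (sliceMatrix t k * sliceMatrix d j * sliceMatrix d i)).trace
        = ((sliceMatrix t k * sliceMatrix d j * sliceMatrix d i) * G).trace :=
      Matrix.trace_mul_comm _ _
    simp only [sub_mul, mul_sub, Matrix.trace_sub, ← mul_assoc] at h4 ⊢
    linarith
  unfold skewOp
  rw [e, e, e]
  simp only [actTensor, ← Finset.sum_add_distrib]
  exact Finset.sum_congr rfl fun _ _ => by ring

lemma InStabilizer.isVectorial_actTensor {d t : Fin 8 → Fin 8 → Fin 8 → ℝ}
    {G : Matrix (Fin 8) (Fin 8) ℝ} (hG : InStabilizer d G) (ht : IsVectorial d t) :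
    IsVectorial d (actTensor G t) := by
  intro i j k
  have : skewOp d t = fun i j k => 3 * t i j k := by
    funext i j k; exact ht i j k
  rw [hG.skewOp_actTensor, this]
  simp only [actTensor, Finset.mul_sum]
  exact Finset.sum_congr rfl fun _ _ => by ring

/-- Suppose that `R` is a curvature tensor with values in the stabilizer of `Υ`, satisfying the
first Bianchi identity of a connection whose torsion is skew with covariant derivative `N`, where
each `N_a` lies in the vectorial module; `Q` is the part of the identity that is quadratic in the
torsion. Then the divergence `τ_{JK} = N_{a;aJK}` vanishes.

The trace of the Bianchi identity over `a = e` gives `ρ - ρᵀ = τ`, where `ρ_{JK} = R_{aJKa}`.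
Contracting instead with `Υ_{aKm} Υ_{bem}` and skewing in `J, K` gives
`(5/2) τ + P τ = 3 τ - P τ`, where `P` is `contractOp`. So `P τ = τ / 4`, which is impossible for
`τ ≠ 0` because the eigenvalues of `P` on 2-forms are `5/2` and `-2`. -/
theorem IsSU3Tensor.divergence_eq_zero {d : Fin 8 → Fin 8 → Fin 8 → ℝ} (hd : IsSU3Tensor d)
    {R : Fin 8 → Fin 8 → Matrix (Fin 8) (Fin 8) ℝ} (hR : ∀ a b, InStabilizer d (R a b))
    (hR' : ∀ a b, R a b = - R b a)
    {N : Fin 8 → Fin 8 → Fin 8 → Fin 8 → ℝ} (hN : ∀ a, IsSkew3 (N a))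
    (hNv : ∀ a, IsVectorial d (N a))
    {Q : Fin 8 → Fin 8 → Fin 8 → Fin 8 → ℝ} (hQ : ∀ a b c e, Q a b c e = - Q b a c e)
    (hQ' : ∀ a b c e, Q a b c e = - Q a c b e) (hQ'' : ∀ a b c e, Q a b c e = - Q a b e c)
    (bianchi : ∀ a b c e, R a b c e + R b c a e + R c a b e
      = N a b c e + N b c a e + N c a b e + Q a b c e) (J K : Fin 8) :
    ∑ a, N a a J K = 0 := by
  set D := sliceMatrix d with hD
  have hDt : ∀ a, (D a)ᵀ = D a := hd.transpose_slice
  let ρ : Matrix (Fin 8) (Fin 8) ℝ := Matrix.of fun j k => ∑ a, R a j k a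
  let τ : Matrix (Fin 8) (Fin 8) ℝ := Matrix.of fun j k => ∑ a, N a a j k
  have hτ : τᵀ = -τ := by
    ext j k
    simp only [τ, Matrix.transpose_apply, Matrix.of_apply, Matrix.neg_apply,
      ← Finset.sum_neg_distrib]
    exact Finset.sum_congr rfl fun a _ => (hN a).2 a k j
  -- the trace of the Bianchi identity
  have hρ : ρ - ρᵀ = τ := by
    ext j k
    simp only [ρ, τ, Matrix.sub_apply, Matrix.transpose_apply, Matrix.of_apply,
      ← Finset.sum_sub_distrib]
    refine Finset.sum_congr rfl fun a _ => ?_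
    have h := bianchi a j k a
    have r1 : R j k a a = 0 := by have := (hR j k).skew a a; linarith
    have r2 : R k a j a = - R a k j a := by rw [hR' k a, Matrix.neg_apply]
    have n1 : N j k a a = 0 := by have := (hN j).2 k a a; linarith
    have n2 : N k a j a = 0 := by
      have := (hN k).cyc a j a; have := (hN k).2 j a a; linarith
    have n3 : N a j k a = N a a j k := by rw [(hN a).cyc a j k]
    have q : Q a j k a = 0 := by
      have h1 := hQ'' a j k a
      have h2 := hQ a j a k
      have h3 := hQ' j a a k
      linarith
    linarith
  -- the three contractions of the curvature
  have hY : ∀ j k, ∑ b, (R b j * D b * D k).trace = (5 / 2) * ρ j k := by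
    intro j k
    have h : ∀ b, (R b j * D b * D k).trace = - (R b j * D b * D k).trace + 5 * R b j k b := by
      intro b
      have h1 : R b j * D b = D b * R b j + ∑ x, R b j x b • D x := by
        rw [← (hR b j).commutator]; abel
      have h2 : (D b * R b j * D k).trace = - (R b j * D b * D k).trace := by
        rw [← Matrix.trace_transpose, Matrix.transpose_mul, Matrix.transpose_mul, hDt, hDt,
          (hR b j).1, neg_mul, mul_neg, Matrix.trace_neg, Matrix.trace_mul_comm]
      conv_lhs => rw [h1, add_mul, Matrix.trace_add, h2]
      simp only [Matrix.sum_mul, Matrix.smul_mul, Matrix.trace_sum, Matrix.trace_smul, hD,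
        hd.trace_mul_slice, smul_eq_mul]
      congr 1
      simp [Matrix.one_apply, mul_comm]
    have h' : ∑ b, (R b j * D b * D k).trace
        = - ∑ b, (R b j * D b * D k).trace + 5 * ρ j k := by
      simp only [ρ, Matrix.of_apply, Finset.mul_sum, ← Finset.sum_neg_distrib,
        ← Finset.sum_add_distrib]
      exact Finset.sum_congr rfl fun b _ => h b
    linarith
  have hZ : ∑ a, ∑ b, R a b * D b * D a - (∑ a, ∑ b, R a b * D b * D a)ᵀ = contractOp d τ := by
    have h1 : ∑ a, ∑ b, R a b * D b * D a
        = ∑ a, ∑ b, D b * R a b * D a - ∑ a, ∑ x, ρ a x • (D x * D a) := by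
      rw [← Finset.sum_sub_distrib]
      refine Finset.sum_congr rfl fun a _ => ?_
      have h2 : ∑ x, ρ a x • (D x * D a) = - ∑ b, (∑ x, R a b x b • D x) * D a := by
        simp only [Matrix.sum_mul, ρ, Matrix.of_apply, Finset.sum_smul, Matrix.smul_mul]
        rw [Finset.sum_comm, ← Finset.sum_neg_distrib]
        refine Finset.sum_congr rfl fun b _ => ?_
        rw [← Finset.sum_neg_distrib]
        refine Finset.sum_congr rfl fun x _ => ?_
        rw [hR' a b, Matrix.neg_apply, neg_smul, neg_neg]
      rw [h2, sub_neg_eq_add, ← Finset.sum_add_distrib]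
      refine Finset.sum_congr rfl fun b _ => ?_
      rw [← (hR a b).commutator, ← add_mul]
      congr 1; abel
    have h3 : (∑ a, ∑ b, D b * R a b * D a)ᵀ = ∑ a, ∑ b, D b * R a b * D a := by
      simp only [Matrix.transpose_sum, Matrix.transpose_mul, hDt]
      rw [Finset.sum_comm]
      refine Finset.sum_congr rfl fun a _ => Finset.sum_congr rfl fun b _ => ?_
      rw [(hR b a).1, hR' a b, mul_assoc]
    rw [h1, Matrix.transpose_sub, h3, hd.contractOp_eq_sum, ← hρ]
    simp only [Matrix.transpose_sum, Matrix.transpose_smul, Matrix.transpose_mul, hDt,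
      Matrix.sub_apply, Matrix.transpose_apply, sub_smul, Finset.sum_sub_distrib]
    rw [Finset.sum_comm (f := fun a x => ρ x a • (sliceMatrix d a * sliceMatrix d x))]
    abel
  -- contraction with `Υ_{aKm} Υ_{bem}`
  have hcontr : ∀ (X : Fin 8 → Fin 8 → Matrix (Fin 8) (Fin 8) ℝ) (j k : Fin 8),
      ∑ a, ∑ b, ∑ e, (D b * D a) e k * X a b j e = (∑ a, ∑ b, X a b * D b * D a) j k := by
    intro X j k
    simp only [Matrix.sum_apply, mul_assoc]
    refine Finset.sum_congr rfl fun a _ => Finset.sum_congr rfl fun b _ => ?_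
    rw [Matrix.mul_apply]
    exact Finset.sum_congr rfl fun e _ => mul_comm _ _
  have hDsymm : ∀ a b e k, (D b * D a) e k = (D e * D a) b k := by
    intro a b e k
    simp only [Matrix.mul_apply, hD, sliceMatrix_apply]
    exact Finset.sum_congr rfl fun m _ => by rw [hd.symm₁₂]
  have hskew : ∀ (x : Fin 8 → Fin 8 → Fin 8 → ℝ), (∀ a b e, x a b e = - x a e b) →
      ∀ k, ∑ a, ∑ b, ∑ e, (D b * D a) e k * x a b e = 0 := by
    intro x hx k
    refine Finset.sum_eq_zero fun a _ => ?_
    have := sum_skew_mul_symm (x := x a) (y := fun b e => (D b * D a) e k) (hx a)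
      (fun b e => hDsymm a b e k)
    rw [← this]
    exact Finset.sum_congr rfl fun b _ => Finset.sum_congr rfl fun e _ => mul_comm _ _
  have hmid : ∀ (x : Fin 8 → Fin 8 → Fin 8 → ℝ) (k : Fin 8),
      ∑ a, ∑ b, ∑ e, (D b * D a) e k * x b a e
        = ∑ b, (sliceMatrix x b * D b * D k).trace := by
    intro x k
    rw [Finset.sum_comm]
    refine Finset.sum_congr rfl fun b _ => ?_
    simp only [Matrix.trace, Matrix.diag, mul_assoc]
    refine Finset.sum_congr rfl fun a _ => ?_
    rw [Matrix.mul_apply]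
    refine Finset.sum_congr rfl fun e _ => ?_
    rw [mul_comm]
    congr 1
    simp only [Matrix.mul_apply, hD, sliceMatrix_apply]
    exact Finset.sum_congr rfl fun m _ => by rw [hd.swap₁₃ k m a, hd.symm₂₃ a m k]
  have hfull : ∀ j k, (∑ a, ∑ b, R a b * D b * D a) j k + (5 / 2) * ρ j k
      = ∑ b, (sliceMatrix (N b) j * D b * D k).trace := by
    intro j k
    have h0 : ∑ a, ∑ b, ∑ e, (D b * D a) e k * (R a b j e + R b j a e + R j a b e)
        = ∑ a, ∑ b, ∑ e, (D b * D a) e k * (N a b j e + N b j a e + N j a b e + Q a b j e) := by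
      simp only [bianchi]
    simp only [mul_add, Finset.sum_add_distrib] at h0
    rw [hcontr, hmid (fun b a e => R b j a e), hmid (fun b a e => N b j a e),
      hskew (fun a b e => R j a b e) (fun a b e => (hR j a).skew b e),
      hskew (fun a b e => N j a b e) (fun a b e => (hN j).2 a b e),
      hskew (fun a b e => N a b j e) (fun a b e => by
        rw [(hN a).cyc b j e, (hN a).2 j e b, (hN a).cyc e j b]),
      hskew (fun a b e => Q a b j e) (fun a b e => by
        have h1 := hQ' a b j e
        have h2 := hQ'' a j b e
        have h3 := hQ' a j e b
        linarith)] at h0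
    have e1 : ∀ b, sliceMatrix (fun b a e => R b j a e) b = R b j := fun _ => rfl
    have e2 : ∀ b, sliceMatrix (fun b a e => N b j a e) b = sliceMatrix (N b) j := fun _ => rfl
    simp only [e1, e2, hY] at h0
    linarith
  have hNcontr : ∀ j k, ∑ b, (sliceMatrix (N b) j * D b * D k).trace
      - ∑ b, (sliceMatrix (N b) k * D b * D j).trace = 3 * τ j k - contractOp d τ j k := by
    intro j k
    have e1 : contractOp d τ j k = ∑ b, (sliceMatrix (N b) b * D k * D j).trace := by
      have : τ = ∑ b, sliceMatrix (N b) b := by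
        ext x y; simp [τ, Matrix.sum_apply]
      rw [contractOp_apply, mul_assoc, Matrix.trace_mul_comm, this]
      simp only [Matrix.sum_mul, Matrix.trace_sum, hD]
    rw [e1, ← Finset.sum_sub_distrib]
    simp only [τ, Matrix.of_apply, Finset.mul_sum, ← Finset.sum_sub_distrib]
    refine Finset.sum_congr rfl fun b _ => ?_
    have h := hNv b k b j
    have e2 : (sliceMatrix (N b) k * D j * D b).trace
        = - (sliceMatrix (N b) k * D b * D j).trace := by
      rw [← Matrix.trace_transpose, Matrix.transpose_mul, Matrix.transpose_mul, hDt, hDt,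
        (hN b).transpose_slice, mul_neg, mul_neg, Matrix.trace_neg, ← mul_assoc,
        Matrix.trace_mul_comm, ← mul_assoc]
    rw [skewOp, ← hD, e2, (hN b).cyc k b j] at h
    linarith
  have hPτ : contractOp d τ = (1 / 4 : ℝ) • τ := by
    ext j k
    have h1 := hfull j k
    have h2 := hfull k j
    have h3 := hNcontr j k
    have h4 := congrFun (congrFun hZ j) k
    have h5 := congrFun (congrFun hρ j) k
    simp only [Matrix.sub_apply, Matrix.transpose_apply] at h4 h5
    rw [Matrix.smul_apply, smul_eq_mul]
    linarith
  have hfinal := congrFun (congrFun (hd.contractOp_contractOp hτ) J) K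
  rw [hPτ, contractOp_smul, hPτ] at hfinal
  simp only [Matrix.smul_apply, Matrix.add_apply, smul_eq_mul] at hfinal
  change τ J K = 0
  linarith

end SU3Dim8

/-! ### The hermitian matrix model of `Υ` and `ψ` -/

namespace SU3Dim8

open Matrix

lemma sqrt_three_sq : (((Real.sqrt 3 : ℝ) : ℂ)) ^ 2 = 3 := by
  rw [← Complex.ofReal_pow, Real.sq_sqrt (by norm_num)]; norm_num

lemma hermMatrix_eq (x : Fin 8 → ℝ) : hermMatrix x =
    !![(x 4 : ℂ) - (Real.sqrt 3 : ℝ) * x 3, (Real.sqrt 3 : ℝ) * (x 2 + x 7 * Complex.I),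
        (Real.sqrt 3 : ℝ) * (x 1 + x 6 * Complex.I);
      (Real.sqrt 3 : ℝ) * (x 2 - x 7 * Complex.I), (x 4 : ℂ) + (Real.sqrt 3 : ℝ) * x 3,
        (Real.sqrt 3 : ℝ) * (x 0 + x 5 * Complex.I);
      (Real.sqrt 3 : ℝ) * (x 1 - x 6 * Complex.I), (Real.sqrt 3 : ℝ) * (x 0 - x 5 * Complex.I),
        -2 * (x 4 : ℂ)] := by
  have h : ∀ a b : ℝ, star (⟨a, b⟩ : ℂ) = a - b * Complex.I := by
    intro a b; apply Complex.ext <;> simp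
  simp only [hermMatrix, h]
  simp only [Complex.mk_eq_add_mul_I]

lemma hermMatrix_add (x y : Fin 8 → ℝ) : hermMatrix (x + y) = hermMatrix x + hermMatrix y := by
  simp only [hermMatrix_eq]
  ext i j
  fin_cases i <;> fin_cases j <;> simp <;> ring

lemma conjTranspose_hermMatrix (x : Fin 8 → ℝ) : (hermMatrix x)ᴴ = hermMatrix x := by
  simp only [hermMatrix_eq]
  ext i j
  fin_cases i <;> fin_cases j <;> simp [sub_eq_add_neg]

lemma trace_mul_hermMatrix (A : Matrix (Fin 3) (Fin 3) ℂ) (x : Fin 8 → ℝ) :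
    (A * hermMatrix x).trace = (A 0 0 + A 1 1 - 2 * A 2 2) * x 4
      + (Real.sqrt 3 : ℝ) * ((A 1 1 - A 0 0) * x 3
      + (A 1 2 + A 2 1) * x 0 + (A 2 1 - A 1 2) * Complex.I * x 5
      + (A 0 2 + A 2 0) * x 1 + (A 2 0 - A 0 2) * Complex.I * x 6
      + (A 0 1 + A 1 0) * x 2 + (A 1 0 - A 0 1) * Complex.I * x 7) := by
  simp only [hermMatrix_eq, Matrix.trace_fin_three, Matrix.mul_apply, Fin.sum_univ_three]
  simp
  ring

lemma trace_hermMatrix_mul (x y : Fin 8 → ℝ) :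
    (hermMatrix x * hermMatrix y).trace = 6 * ((∑ i, x i * y i : ℝ) : ℂ) := by
  rw [trace_mul_hermMatrix]
  simp only [hermMatrix_eq, Fin.sum_univ_eight]
  simp
  linear_combination (2 * ((x 0 : ℂ) * y 0 + x 1 * y 1 + x 2 * y 2 + x 3 * y 3)
    - 2 * Complex.I ^ 2 * (x 5 * y 5 + x 6 * y 6 + x 7 * y 7)) * sqrt_three_sq
    - 6 * ((x 5 : ℂ) * y 5 + x 6 * y 6 + x 7 * y 7) * Complex.I_sq

/-- The matrices attached to the standard basis of `ℝ⁸`. -/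
noncomputable def basisMatrix (a : Fin 8) : Matrix (Fin 3) (Fin 3) ℂ := hermMatrix (Pi.single a 1)

/-- Completeness of the basis of trace-free hermitian matrices. -/
lemma sum_trace_mul_trace (A B : Matrix (Fin 3) (Fin 3) ℂ) :
    ∑ m, (A * basisMatrix m).trace * (B * basisMatrix m).trace
      = 6 * (A * B).trace - 2 * A.trace * B.trace := by
  have h : ∀ (A : Matrix (Fin 3) (Fin 3) ℂ) (m : Fin 8), (A * basisMatrix m).trace = _ :=
    fun A m => trace_mul_hermMatrix A _
  simp only [h, Fin.sum_univ_eight]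
  simp only [Matrix.trace_fin_three, Matrix.mul_apply, Fin.sum_univ_three, Pi.single_apply]
  simp
  ring_nf
  simp only [sqrt_three_sq, Complex.I_sq]
  ring

/-- The trilinear form `θ^i ∧ θ^j ∧ θ^k` evaluated on three vectors. -/
noncomputable def wedgeForm (i j k : Fin 8) (x y z : Fin 8 → ℝ) : ℝ :=
  Matrix.det (Matrix.of fun r s : Fin 3 => ![x, y, z] s (![i, j, k] r))

lemma wedgeForm_eq (i j k : Fin 8) (x y z : Fin 8 → ℝ) : wedgeForm i j k x y z =
    x i * y j * z k - x i * z j * y k - y i * x j * z k + y i * z j * x k + z i * x j * y k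
      - z i * y j * x k := by
  simp [wedgeForm, Matrix.det_fin_three]

lemma wedge3_eq_wedgeForm (i j k a b c : Fin 8) :
    wedge3 i j k a b c = wedgeForm i j k (Pi.single a 1) (Pi.single b 1) (Pi.single c 1) := by
  rw [wedge3, wedgeForm]
  congr 1
  ext r s
  fin_cases s <;> simp [Pi.single_apply] <;> congr

lemma trace_commutator_mul (x y z : Fin 8 → ℝ) :
    ((hermMatrix x * hermMatrix y - hermMatrix y * hermMatrix x) * hermMatrix z).trace
      = 6 * (Real.sqrt 3 : ℝ) * Complex.I * ((wedgeForm 0 3 5 x y z + wedgeForm 1 2 5 x y z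
        + Real.sqrt 3 * wedgeForm 0 4 5 x y z + wedgeForm 0 2 6 x y z + wedgeForm 3 1 6 x y z
        + Real.sqrt 3 * wedgeForm 1 4 6 x y z + wedgeForm 0 1 7 x y z
        + 2 * wedgeForm 3 2 7 x y z + wedgeForm 5 6 7 x y z : ℝ) : ℂ) := by
  have hs3 : ((Real.sqrt 3 : ℝ) : ℂ) ^ 3 = 3 * (Real.sqrt 3 : ℝ) := by
    rw [pow_succ, sqrt_three_sq]
  have hI3 : Complex.I ^ 3 = - Complex.I := by
    rw [pow_succ, Complex.I_sq]; ring
  rw [trace_mul_hermMatrix]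
  simp only [hermMatrix_eq, Matrix.sub_apply, Matrix.mul_apply, Fin.sum_univ_three, wedgeForm_eq]
  simp
  ring_nf
  simp only [sqrt_three_sq, hs3, hI3]
  ring

/-- In the matrix model `ψ` is the skew-symmetrized trace of a triple product. -/
lemma psi_eq_trace (a b c : Fin 8) :
    ((basisMatrix a * basisMatrix b - basisMatrix b * basisMatrix a) * basisMatrix c).trace
      = 6 * (Real.sqrt 3 : ℝ) * Complex.I * (psi a b c : ℂ) := by
  simp only [basisMatrix, trace_commutator_mul, psi, wedge3_eq_wedgeForm]

/-- The cubic form is a multiple of the trace of the cube. -/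
lemma trace_cube_hermMatrix (x : Fin 8 → ℝ) :
    (hermMatrix x * hermMatrix x * hermMatrix x).trace = 6 * (modelCubic x : ℂ) := by
  have hs3 : ((Real.sqrt 3 : ℝ) : ℂ) ^ 3 = 3 * (Real.sqrt 3 : ℝ) := by
    rw [pow_succ, sqrt_three_sq]
  have hreal : ((hermMatrix x).det.re : ℂ) = (hermMatrix x).det := by
    apply Complex.conj_eq_iff_re.mp
    rw [starRingEnd_apply, ← Matrix.det_conjTranspose, conjTranspose_hermMatrix]
  have h3 : (hermMatrix x * hermMatrix x * hermMatrix x).trace = 3 * (hermMatrix x).det := by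
    rw [trace_mul_hermMatrix, Matrix.det_fin_three]
    simp only [hermMatrix_eq, Matrix.mul_apply, Fin.sum_univ_three]
    simp
    ring_nf
  rw [h3, modelCubic]
  push_cast
  rw [hreal]; ring

/-- The components of a tensor in an adapted basis: a symmetric tensor whose cubic form is the
model one. -/
structure IsAdaptedTensor (d : Fin 8 → Fin 8 → Fin 8 → ℝ) : Prop where
  symm₁₂ : ∀ i j k, d i j k = d j i k
  symm₂₃ : ∀ i j k, d i j k = d i k j
  cubic : ∀ x : Fin 8 → ℝ, ∑ a, ∑ b, ∑ c, x a * x b * x c * d a b c = modelCubic x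

/-- A symmetric trilinear form is determined by its cubic form. -/
lemma eq_zero_of_cubic_eq_zero {V : Type*} [AddCommGroup V] {S : V → V → V → ℝ}
    (hadd : ∀ x x' y z, S (x + x') y z = S x y z + S x' y z)
    (h₁₂ : ∀ x y z, S x y z = S y x z) (h₂₃ : ∀ x y z, S x y z = S x z y)
    (h0 : ∀ x, S x x x = 0) (x y z : V) : S x y z = 0 := by
  have hadd₂ : ∀ x y y' z, S x (y + y') z = S x y z + S x y' z := fun x y y' z => by
    rw [h₁₂ x, hadd, h₁₂ y, h₁₂ y']
  have hadd₃ : ∀ x y z z', S x y (z + z') = S x y z + S x y z' := fun x y z z' => by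
    rw [h₂₃ x, hadd₂, h₂₃ x z, h₂₃ x z']
  have e0 := h0 (x + y + z)
  have e1 := h0 (x + y)
  have e2 := h0 (y + z)
  have e3 := h0 (x + z)
  simp only [hadd, hadd₂, hadd₃, h0] at e0 e1 e2 e3
  have s1 := h₂₃ x y z
  have s2 := h₁₂ x y z
  have s3 := h₂₃ y x z
  have s4 := h₁₂ x z y
  have s5 := h₂₃ z x y
  linarith

lemma star_trace_anticommutator (x y z : Fin 8 → ℝ) :
    (starRingEnd ℂ) ((hermMatrix x * hermMatrix y + hermMatrix y * hermMatrix x)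
      * hermMatrix z).trace
      = ((hermMatrix x * hermMatrix y + hermMatrix y * hermMatrix x) * hermMatrix z).trace := by
  rw [starRingEnd_apply, ← Matrix.trace_conjTranspose]
  simp only [Matrix.conjTranspose_mul, Matrix.conjTranspose_add, conjTranspose_hermMatrix]
  rw [Matrix.trace_mul_comm, add_comm]

/-- In an adapted basis, `12 Υ(x, y, z) = tr((H_x H_y + H_y H_x) H_z)`. -/
lemma IsAdaptedTensor.trace_anticommutator {d : Fin 8 → Fin 8 → Fin 8 → ℝ}
    (hd : IsAdaptedTensor d) (a b c : Fin 8) :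
    ((basisMatrix a * basisMatrix b + basisMatrix b * basisMatrix a) * basisMatrix c).trace
      = 12 * (d a b c : ℂ) := by
  let D : (Fin 8 → ℝ) → (Fin 8 → ℝ) → (Fin 8 → ℝ) → ℝ := fun x y z =>
    ∑ a, ∑ b, ∑ c, x a * y b * z c * d a b c
  let F : (Fin 8 → ℝ) → (Fin 8 → ℝ) → (Fin 8 → ℝ) → ℝ := fun x y z =>
    ((hermMatrix x * hermMatrix y + hermMatrix y * hermMatrix x) * hermMatrix z).trace.re
  have hDF : ∀ x y z, F x y z - 12 * D x y z = 0 := by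
    refine eq_zero_of_cubic_eq_zero (S := fun x y z => F x y z - 12 * D x y z) ?_ ?_ ?_ ?_
    · intro x x' y z
      have e : D (x + x') y z = D x y z + D x' y z := by
        simp only [D, ← Finset.sum_add_distrib, Pi.add_apply]
        exact Finset.sum_congr rfl fun _ _ => Finset.sum_congr rfl fun _ _ =>
          Finset.sum_congr rfl fun _ _ => by ring
      have e' : F (x + x') y z = F x y z + F x' y z := by
        simp only [F, hermMatrix_add, add_mul, mul_add, Matrix.trace_add, Complex.add_re]
        ring
      simp only [e, e']; ring
    · intro x y z
      have e : D x y z = D y x z := by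
        simp only [D]
        rw [Finset.sum_comm]
        exact Finset.sum_congr rfl fun _ _ => Finset.sum_congr rfl fun _ _ =>
          Finset.sum_congr rfl fun _ _ => by rw [hd.symm₁₂]; ring
      simp only [e, F, add_comm]
    · intro x y z
      have e : D x y z = D x z y := by
        simp only [D]
        refine Finset.sum_congr rfl fun _ _ => ?_
        rw [Finset.sum_comm]
        exact Finset.sum_congr rfl fun _ _ =>
          Finset.sum_congr rfl fun _ _ => by rw [hd.symm₂₃]; ring
      have e' : F x y z = F x z y := by
        simp only [F, add_mul, Matrix.trace_add, Complex.add_re]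
        rw [Matrix.trace_mul_cycle (hermMatrix x) (hermMatrix y) (hermMatrix z),
          Matrix.trace_mul_cycle (hermMatrix x) (hermMatrix z) (hermMatrix y), add_comm]
      simp only [e, e']
    · intro x
      have e : D x x x = modelCubic x := hd.cubic x
      have e' : F x x x = 12 * modelCubic x := by
        simp only [F, add_mul, Matrix.trace_add, trace_cube_hermMatrix]
        simp
        ring
      simp only [e, e', sub_self]
  have hD : D (Pi.single a 1) (Pi.single b 1) (Pi.single c 1) = d a b c := by
    simp [D, Pi.single_apply]
  have h := hDF (Pi.single a 1) (Pi.single b 1) (Pi.single c 1)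
  rw [hD, sub_eq_zero] at h
  have hreal := Complex.conj_eq_iff_re.mp
    (star_trace_anticommutator (Pi.single a 1) (Pi.single b 1) (Pi.single c 1))
  unfold basisMatrix
  rw [← hreal]
  simp only [F] at h
  rw [h]; push_cast; rfl

lemma isSkew3_psi : IsSkew3 psi := by
  have hne : 6 * ((Real.sqrt 3 : ℝ) : ℂ) * Complex.I ≠ 0 := by
    simp
  refine ⟨fun i j k => ?_, fun i j k => ?_⟩
  · have h : (6 * ((Real.sqrt 3 : ℝ) : ℂ) * Complex.I) * (psi i j k : ℂ)
        = (6 * ((Real.sqrt 3 : ℝ) : ℂ) * Complex.I) * ((-psi j i k : ℝ) : ℂ) := by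
      push_cast
      rw [mul_neg, ← psi_eq_trace, ← psi_eq_trace, ← Matrix.trace_neg, ← neg_mul, neg_sub]
    exact_mod_cast mul_left_cancel₀ hne h
  · have h : (6 * ((Real.sqrt 3 : ℝ) : ℂ) * Complex.I) * (psi i j k : ℂ)
        = (6 * ((Real.sqrt 3 : ℝ) : ℂ) * Complex.I) * ((-psi i k j : ℝ) : ℂ) := by
      push_cast
      rw [mul_neg, ← psi_eq_trace, ← psi_eq_trace]
      have h1 := Matrix.trace_mul_cycle (basisMatrix i) (basisMatrix j) (basisMatrix k)
      have h2 := Matrix.trace_mul_cycle (basisMatrix i) (basisMatrix k) (basisMatrix j)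
      simp only [sub_mul, Matrix.trace_sub]
      rw [h1, h2]; ring
    exact_mod_cast mul_left_cancel₀ hne h

lemma trace_anticommutator_basisMatrix (a b : Fin 8) :
    (basisMatrix a * basisMatrix b + basisMatrix b * basisMatrix a).trace
      = 12 * (((1 : Matrix (Fin 8) (Fin 8) ℝ) a b : ℝ) : ℂ) := by
  have h : ∀ a b : Fin 8, ∑ i, (Pi.single a 1 : Fin 8 → ℝ) i * (Pi.single b 1 : Fin 8 → ℝ) i
      = (1 : Matrix (Fin 8) (Fin 8) ℝ) a b := by
    intro a b
    simp [Pi.single_apply, Matrix.one_apply, eq_comm]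
  rw [Matrix.trace_add, Matrix.trace_mul_comm (basisMatrix b)]
  unfold basisMatrix
  rw [trace_hermMatrix_mul, h]
  ring

/-- The identity expressing `ψ_{ABM} ψ_{KLM}` through `Υ`. Both sides are traces of products of four
hermitian matrices, by the completeness relation `sum_trace_mul_trace`. -/
lemma IsAdaptedTensor.sum_psi_mul_psi {d : Fin 8 → Fin 8 → Fin 8 → ℝ}
    (hd : IsAdaptedTensor d) (a b k l : Fin 8) :
    ∑ m, psi a b m * psi k l m
      = (8 / 3) * ((1 : Matrix (Fin 8) (Fin 8) ℝ) a k * (1 : Matrix (Fin 8) (Fin 8) ℝ) b l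
          - (1 : Matrix (Fin 8) (Fin 8) ℝ) b k * (1 : Matrix (Fin 8) (Fin 8) ℝ) a l)
        + (4 / 3) * (∑ m, d a k m * d b l m - ∑ m, d b k m * d a l m) := by
  set A := basisMatrix a
  set B := basisMatrix b
  set K := basisMatrix k
  set L := basisMatrix l
  have h1 := sum_trace_mul_trace (A * B - B * A) (K * L - L * K)
  have h2 := sum_trace_mul_trace (B * K + K * B) (A * L + L * A)
  have h3 := sum_trace_mul_trace (A * K + K * A) (B * L + L * B)
  have h4 : ((A * B - B * A) * (K * L - L * K)).trace
      = ((B * K + K * B) * (A * L + L * A)).trace - ((A * K + K * A) * (B * L + L * B)).trace := by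
    have r1 : ∀ X Y Z U : Matrix (Fin 3) (Fin 3) ℂ,
        (X * Y * Z * U).trace = (Y * Z * U * X).trace := fun X Y Z U => by
      rw [mul_assoc, mul_assoc, Matrix.trace_mul_comm, ← mul_assoc]
    have r2 : ∀ X Y Z U : Matrix (Fin 3) (Fin 3) ℂ,
        (X * Y * Z * U).trace = (Z * U * X * Y).trace := fun X Y Z U => by
      rw [r1, r1]
    have r3 : ∀ X Y Z U : Matrix (Fin 3) (Fin 3) ℂ,
        (X * Y * Z * U).trace = (U * X * Y * Z).trace := fun X Y Z U => by
      rw [r1, r2]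
    simp only [sub_mul, mul_sub, add_mul, mul_add, Matrix.trace_sub, Matrix.trace_add,
      ← mul_assoc]
    rw [r1 B A K L, r1 B A L K, r2 B K A L, r3 B K L A, r2 K B A L, r3 K B L A, r1 K A B L,
      r1 K A L B]
    ring
  have h5 : ∀ X Y : Matrix (Fin 3) (Fin 3) ℂ, (X * Y - Y * X).trace = 0 := fun X Y => by
    rw [Matrix.trace_sub, Matrix.trace_mul_comm, sub_self]
  simp only [A, B, K, L, psi_eq_trace, hd.trace_anticommutator,
    trace_anticommutator_basisMatrix] at h1 h2 h3 h4
  rw [h5, mul_zero, zero_mul, sub_zero, h4] at h1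
  have g1 : ∑ m, 6 * ((Real.sqrt 3 : ℝ) : ℂ) * Complex.I * (psi a b m : ℂ)
      * (6 * ((Real.sqrt 3 : ℝ) : ℂ) * Complex.I * (psi k l m : ℂ))
      = -108 * ((∑ m, psi a b m * psi k l m : ℝ) : ℂ) := by
    push_cast
    rw [Finset.mul_sum]
    refine Finset.sum_congr rfl fun m _ => ?_
    linear_combination (36 * Complex.I ^ 2 * (psi a b m : ℂ) * psi k l m) * sqrt_three_sq
      + (108 * (psi a b m : ℂ) * psi k l m) * Complex.I_sq
  have g2 : ∀ a b k l, ∑ m, 12 * (d a b m : ℂ) * (12 * (d k l m : ℂ))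
      = 144 * ((∑ m, d a b m * d k l m : ℝ) : ℂ) := by
    intro a b k l
    push_cast
    rw [Finset.mul_sum]
    exact Finset.sum_congr rfl fun m _ => by ring
  rw [g1] at h1
  rw [g2] at h2 h3
  have h6 : ((-108 * ∑ m, psi a b m * psi k l m : ℝ) : ℂ)
      = ((144 * ∑ m, d b k m * d a l m - 144 * ∑ m, d a k m * d b l m
        + 288 * ((1 : Matrix (Fin 8) (Fin 8) ℝ) b k * (1 : Matrix (Fin 8) (Fin 8) ℝ) a l
          - (1 : Matrix (Fin 8) (Fin 8) ℝ) a k * (1 : Matrix (Fin 8) (Fin 8) ℝ) b l) : ℝ) : ℂ) := by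
    push_cast at *
    linear_combination h1 - h2 + h3
  have h7 := Complex.ofReal_injective h6
  linarith

end SU3Dim8

/-! ### The eigenvalue condition on `ψ(T)`, in terms of `Υ` -/

namespace SU3Dim8

open Matrix

/-- Contraction of a 2-form with `θ^a ∧ θ^b ∧ θ^c`. -/
lemma sum_wedge3_mul {X : Fin 8 → Fin 8 → ℝ} (hX : ∀ k l, X k l = - X l k) (a b c i : Fin 8) :
    ∑ k, ∑ l, wedge3 a b c i k l * X k l
      = 2 * ((if a = i then X b c else 0) + (if b = i then X c a else 0)
        + (if c = i then X a b else 0)) := by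
  have h : ∀ a b : Fin 8, ∑ k, ∑ l, (if a = k then (1 : ℝ) else 0) * (if b = l then 1 else 0)
      * X k l = X a b := by
    intro a b; simp
  have h' : ∀ k l, wedge3 a b c i k l * X k l =
      (if a = i then (1 : ℝ) else 0) * ((if b = k then (1 : ℝ) else 0) * (if c = l then 1 else 0)
        * X k l - (if c = k then (1 : ℝ) else 0) * (if b = l then 1 else 0) * X k l)
      + (if b = i then (1 : ℝ) else 0) * ((if c = k then (1 : ℝ) else 0) * (if a = l then 1 else 0)
        * X k l - (if a = k then (1 : ℝ) else 0) * (if c = l then 1 else 0) * X k l)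
      + (if c = i then (1 : ℝ) else 0) * ((if a = k then (1 : ℝ) else 0) * (if b = l then 1 else 0)
        * X k l - (if b = k then (1 : ℝ) else 0) * (if a = l then 1 else 0) * X k l) := by
    intro k l
    rw [wedge3_eq_wedgeForm, wedgeForm_eq]
    simp only [Pi.single_apply]
    ring
  simp only [h', Finset.sum_add_distrib, Finset.sum_sub_distrib, ← Finset.mul_sum, h]
  rw [hX c b, hX a c, hX b a]
  split_ifs <;> ring

/-- The linear equations on a 2-form `X` expressed by `ψ_{IKL} X_{KL} = 0`. The one for the fifth
value of `I` is used to simplify the one for the fourth. -/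
lemma sum_psi_mul {X : Fin 8 → Fin 8 → ℝ} (hX : ∀ k l, X k l = - X l k) :
    (∀ i, ∑ k, ∑ l, psi i k l * X k l = 0) →
    X 3 5 + Real.sqrt 3 * X 4 5 + X 2 6 + X 1 7 = 0 ∧
    X 2 5 + X 6 3 + Real.sqrt 3 * X 4 6 + X 7 0 = 0 ∧
    X 5 1 + X 6 0 + 2 * X 7 3 = 0 ∧
    X 0 5 = X 6 1 ∧ X 0 5 = X 2 7 ∧
    X 0 3 + X 1 2 + Real.sqrt 3 * X 0 4 + X 6 7 = 0 ∧
    X 0 2 + X 3 1 + Real.sqrt 3 * X 1 4 + X 7 5 = 0 ∧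
    X 0 1 + 2 * X 3 2 + X 5 6 = 0 := by
  intro h
  have e : ∀ i, ∑ k, ∑ l, psi i k l * X k l =
      (∑ k, ∑ l, wedge3 0 3 5 i k l * X k l + ∑ k, ∑ l, wedge3 1 2 5 i k l * X k l
        + Real.sqrt 3 * ∑ k, ∑ l, wedge3 0 4 5 i k l * X k l
        + ∑ k, ∑ l, wedge3 0 2 6 i k l * X k l + ∑ k, ∑ l, wedge3 3 1 6 i k l * X k l
        + Real.sqrt 3 * ∑ k, ∑ l, wedge3 1 4 6 i k l * X k l
        + ∑ k, ∑ l, wedge3 0 1 7 i k l * X k l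
        + 2 * ∑ k, ∑ l, wedge3 3 2 7 i k l * X k l + ∑ k, ∑ l, wedge3 5 6 7 i k l * X k l) := by
    intro i
    simp only [Finset.mul_sum, ← Finset.sum_add_distrib]
    exact Finset.sum_congr rfl fun k _ => Finset.sum_congr rfl fun l _ => by rw [psi]; ring
  simp only [e, sum_wedge3_mul hX] at h
  have h0 := h 0
  have h1 := h 1
  have h2 := h 2
  have h3 := h 3
  have h4 := h 4
  have h5 := h 5
  have h6 := h 6
  have h7 := h 7
  have hs : Real.sqrt 3 ≠ 0 := by simp
  simp (decide := true) only [if_true, if_false, add_zero, zero_add, mul_zero]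
    at h0 h1 h2 h3 h4 h5 h6 h7
  have h4' : X 5 0 + X 6 1 = 0 := by
    have : Real.sqrt 3 * (X 5 0 + X 6 1) = 0 := by linarith
    exact (mul_eq_zero.mp this).resolve_left hs
  have g1 := hX 5 0
  have g2 := hX 6 1
  have g3 := hX 2 7
  have g4 := hX 1 6
  refine ⟨?_, ?_, ?_, ?_, ?_, ?_, ?_, ?_⟩ <;> linarith

/-- A 3-form `T` is determined by the 2-tensor `ψ(T)`: the `64` linear equations `ψ(T)_{IJ} = 0`
for the `56` components `T_{ijk}` with `i < j < k` have only the zero solution. -/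
lemma eq_zero_of_psiContract_eq_zero {T : Fin 8 → Fin 8 → Fin 8 → ℝ} (hT : IsSkew3 T)
    (h : ∀ i j, psiContract T i j = 0) : T = 0 := by
  have key := fun j => sum_psi_mul (X := T j) (fun k l => hT.2 j k l) (fun i => h i j)
  -- rewriting rules that sort the indices of `T`
  have n1 : ∀ i j k, j < i → T i j k = - T j i k := fun i j k _ => hT.1 i j k
  have n2 : ∀ i j k, k < j → T i j k = - T i k j := fun i j k _ => hT.2 i j k
  have z1 : ∀ i k, T i i k = 0 := fun i k => by have := hT.1 i i k; linarith
  have z2 : ∀ i k, T i k k = 0 := fun i k => by have := hT.2 i k k; linarith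
  obtain ⟨a0, b0, c0, d0, e0, f0, g0, i0⟩ := key 0
  obtain ⟨a1, b1, c1, d1, e1, f1, g1, i1⟩ := key 1
  obtain ⟨a2, b2, c2, d2, e2, f2, g2, i2⟩ := key 2
  obtain ⟨a3, b3, c3, d3, e3, f3, g3, i3⟩ := key 3
  obtain ⟨a4, b4, c4, d4, e4, f4, g4, i4⟩ := key 4
  obtain ⟨a5, b5, c5, d5, e5, f5, g5, i5⟩ := key 5
  obtain ⟨a6, b6, c6, d6, e6, f6, g6, i6⟩ := key 6
  obtain ⟨a7, b7, c7, d7, e7, f7, g7, i7⟩ := key 7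
  have hs : Real.sqrt 3 * Real.sqrt 3 = 3 := Real.mul_self_sqrt (by norm_num)
  clear key h
  generalize Real.sqrt 3 = s at *
  simp (disch := decide) only [n1, n2, z1, z2, mul_zero, zero_add, add_zero, mul_neg, neg_neg,
    neg_eq_zero, neg_zero]
    at a0 a1 a2 a3 a4 a5 a6 a7 b0 b1 b2 b3 b4 b5 b6 b7
      c0 c1 c2 c3 c4 c5 c6 c7 d0 d1 d2 d3 d4 d5 d6 d7
      e0 e1 e2 e3 e4 e5 e6 e7 f0 f1 f2 f3 f4 f5 f6 f7
      g0 g1 g2 g3 g4 g5 g6 g7 i0 i1 i2 i3 i4 i5 i6 i7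
  -- the unknowns with an index `4` enter the other equations with a factor `√3`
  have hmul : ∀ x y : ℝ, x = y → s * x = s * y := fun x y hxy => by rw [hxy]
  replace a4 := hmul _ _ a4
  replace b4 := hmul _ _ b4
  replace c4 := hmul _ _ c4
  replace d4 := hmul _ _ d4
  replace e4 := hmul _ _ e4
  replace f4 := hmul _ _ f4
  replace g4 := hmul _ _ g4
  replace i4 := hmul _ _ i4
  simp only [mul_add, mul_zero, mul_neg, mul_left_comm s (2 : ℝ)] at a4 b4 c4 d4 e4 f4 g4 i4
  -- the equations decouple into eight systems
  obtain ⟨t012, t067, t157, t256⟩ : T 0 1 2 = 0 ∧ T 0 6 7 = 0 ∧ T 1 5 7 = 0 ∧ T 2 5 6 = 0 := by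
    refine ⟨?_, ?_, ?_, ?_⟩ <;> linarith only [a5, b6, c7, f0, g1, i2]
  obtain ⟨t013, t014, t057, t167, t234, t356, t456⟩ : T 0 1 3 = 0 ∧ s * T 0 1 4 = 0 ∧ T 0 5 7 =
      0 ∧ T 1 6 7 = 0 ∧ s * T 2 3 4 = 0 ∧ T 3 5 6 = 0 ∧ s * T 4 5 6 = 0 := by
    refine ⟨?_, ?_, ?_, ?_, ?_, ?_, ?_⟩ <;> linarith only [a6, b5, d7, e7, f1, g0, i3, i4]
  obtain ⟨t015, t037, t047, t127, t235, t245, t346⟩ : T 0 1 5 = 0 ∧ T 0 3 7 = 0 ∧ s * T 0 4 7 =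
      0 ∧ T 1 2 7 = 0 ∧ T 2 3 5 = 0 ∧ s * T 2 4 5 = 0 ∧ s * T 3 4 6 = 0 := by
    refine ⟨?_, ?_, ?_, ?_, ?_, ?_, ?_⟩ <;> linarith only [a2, b3, b4, c0, d1, e1, f7, i5]
  obtain ⟨t016, t027, t137, t147, t236, t246, t345⟩ : T 0 1 6 = 0 ∧ T 0 2 7 = 0 ∧ T 1 3 7 = 0 ∧
      s * T 1 4 7 = 0 ∧ T 2 3 6 = 0 ∧ s * T 2 4 6 = 0 ∧ s * T 3 4 5 = 0 := by
    refine ⟨?_, ?_, ?_, ?_, ?_, ?_, ?_⟩ <;> linarith only [a3, a4, b2, c1, d0, e0, g7, i6]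
  obtain ⟨t017, t026, t035, t045, t125, t136, t146, t237, t247, t567⟩ : T 0 1 7 = 0 ∧ T 0 2 6 =
      0 ∧ T 0 3 5 = 0 ∧ s * T 0 4 5 = 0 ∧ T 1 2 5 = 0 ∧ T 1 3 6 = 0 ∧ s * T 1 4 6 = 0 ∧ T 2 3 7
      = 0 ∧ s * T 2 4 7 = 0 ∧ T 5 6 7 = 0 := by
    refine ⟨?_, ?_, ?_, ?_, ?_, ?_, ?_, ?_, ?_, ?_⟩ <;> linarith only [a0, b1, c2, d3, d4, e3,
        e4, f5, g6, i7]
  obtain ⟨t023, t024, t056, t134, t267, t357, t457⟩ : T 0 2 3 = 0 ∧ s * T 0 2 4 = 0 ∧ T 0 5 6 =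
      0 ∧ s * T 1 3 4 = 0 ∧ T 2 6 7 = 0 ∧ T 3 5 7 = 0 ∧ s * T 4 5 7 = 0 := by
    refine ⟨?_, ?_, ?_, ?_, ?_, ?_, ?_⟩ <;> linarith only [a7, c5, d6, e6, f2, g3, g4, i0]
  obtain ⟨t025, t036, t046, t126, t135, t145, t347⟩ : T 0 2 5 = 0 ∧ T 0 3 6 = 0 ∧ s * T 0 4 6 =
      0 ∧ T 1 2 6 = 0 ∧ T 1 3 5 = 0 ∧ s * T 1 4 5 = 0 ∧ s * T 3 4 7 = 0 := by
    refine ⟨?_, ?_, ?_, ?_, ?_, ?_, ?_⟩ <;> linarith only [a1, b0, c3, c4, d2, e2, f6, g5]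
  obtain ⟨t034, t123, t124, t156, t257, t367, t467⟩ : s * T 0 3 4 = 0 ∧ T 1 2 3 = 0 ∧ s * T 1 2
      4 = 0 ∧ T 1 5 6 = 0 ∧ T 2 5 7 = 0 ∧ T 3 6 7 = 0 ∧ s * T 4 6 7 = 0 := by
    refine ⟨?_, ?_, ?_, ?_, ?_, ?_, ?_⟩ <;> linarith only [b7, c6, d5, e5, f3, f4, g2, i1]
  have hs0 : s ≠ 0 := fun h0 => by rw [h0] at hs; norm_num at hs
  simp only [mul_eq_zero, hs0, false_or]
    at t014 t024 t034 t045 t046 t047 t124 t134 t145 t146 t147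
      t234 t245 t246 t247 t345 t346 t347 t456 t457 t467
  have sorted : ∀ i j k, i < j → j < k → T i j k = 0 := by
    intro i j k hij hjk
    fin_cases i <;> fin_cases j <;> first
      | exact absurd hij (by decide)
      | (fin_cases k <;> first | exact absurd hjk (by decide) | assumption)
  funext i j k
  rcases lt_trichotomy i j with hij | rfl | hij
  · rcases lt_trichotomy j k with hjk | rfl | hjk
    · exact sorted i j k hij hjk
    · exact z2 i j
    · rw [hT.2]
      rcases lt_trichotomy i k with hik | rfl | hik
      · simp [sorted i k j hik hjk]
      · simp [z1]
      · rw [hT.1, sorted k i j hik hij]; simp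
  · exact z1 i k
  · rw [hT.1]
    rcases lt_trichotomy i k with hik | rfl | hik
    · simp [sorted j i k hij hik]
    · simp [z2]
    · rw [hT.2]
      rcases lt_trichotomy j k with hjk | rfl | hjk
      · simp [sorted j k i hjk hik]
      · simp [z1]
      · rw [hT.1, sorted k j i hjk hij]; simp

lemma hatUpsilon_eq_contractOp {d : Fin 8 → Fin 8 → Fin 8 → ℝ} (hd : IsSU3Tensor d)
    (W : Matrix (Fin 8) (Fin 8) ℝ) (i k : Fin 8) :
    hatUpsilon d (fun i j => W i j) i k = 4 * contractOp d W i k := by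
  simp only [hatUpsilon, contractOp_apply, Matrix.trace, Matrix.diag, Matrix.mul_apply,
    sliceMatrix_apply, Finset.sum_mul]
  congr 1
  rw [Finset.sum_congr rfl fun j _ => Finset.sum_comm, Finset.sum_comm]
  refine Finset.sum_congr rfl fun m _ => ?_
  rw [Finset.sum_comm]
  refine Finset.sum_congr rfl fun l _ => Finset.sum_congr rfl fun j _ => ?_
  rw [hd.symm₂₃ i m j]; ring

lemma contractOp_apply_sum {d : Fin 8 → Fin 8 → Fin 8 → ℝ} (hd : IsSU3Tensor d)
    (W : Matrix (Fin 8) (Fin 8) ℝ) (i k : Fin 8) :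
    contractOp d W i k = ∑ j, ∑ l, W j l * ∑ m, d i j m * d k l m := by
  have := hatUpsilon_eq_contractOp hd W i k
  simp only [hatUpsilon, mul_comm _ (W _ _), ← Finset.mul_sum] at this
  linarith

/-- An eigentensor of `W ↦ Υ_{IJM} Υ_{KLM} W_{JL}` with eigenvalue `-3/2` is of the form
`Υ_{IJM} t_M`. -/
lemma eq_of_contractOp_eq {d : Fin 8 → Fin 8 → Fin 8 → ℝ} (hd : IsSU3Tensor d)
    {W : Matrix (Fin 8) (Fin 8) ℝ} (hW : contractOp d W = (-(3 / 2) : ℝ) • W) :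
    W.trace = 0 ∧ Wᵀ = W ∧ ∀ x c, ∑ j, ∑ l, W j l * ∑ m, d j l m * d x c m = 5 * W x c := by
  have hsymm : Wᵀ = W := by
    set w := W - Wᵀ with hw
    have h1 : wᵀ = -w := by rw [hw]; simp
    have h2 : contractOp d w = (-(3 / 2) : ℝ) • w := by
      have : contractOp d w = contractOp d W - contractOp d Wᵀ := by
        ext i k; simp [contractOp_apply, hw, mul_sub, sub_mul]
      rw [this, hd.contractOp_transpose, hW, hw, smul_sub]
      simp
    have h3 := hd.contractOp_contractOp h1
    rw [h2, contractOp_smul, h2] at h3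
    have h4 : w = 0 := by
      ext i j
      have := congrFun (congrFun h3 i) j
      simp only [Matrix.smul_apply, Matrix.add_apply, smul_eq_mul] at this
      rw [Matrix.zero_apply]; linarith
    rw [hw] at h4
    exact (sub_eq_zero.mp h4).symm
  have hs : ∀ i j, W i j = W j i := fun i j => congrFun (congrFun hsymm j) i
  -- the quadratic identity contracted with `W`
  have hq : ∀ x c, 2 * contractOp d W x c + ∑ j, ∑ l, W j l * ∑ m, d j l m * d x c m
      = 2 * W x c + W.trace * (1 : Matrix (Fin 8) (Fin 8) ℝ) x c := by
    intro x c
    have h := Finset.sum_congr (rfl : (Finset.univ : Finset (Fin 8)) = Finset.univ)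
      fun j _ => Finset.sum_congr (rfl : (Finset.univ : Finset (Fin 8)) = Finset.univ)
      fun l _ => congrArg (W j l * ·) (hd.quadratic j x l c)
    simp only [Finset.sum_add_distrib, mul_add] at h
    have e1 : ∑ j, ∑ l, W j l * ∑ i, d j x i * d l c i = contractOp d W x c := by
      rw [contractOp_apply_sum hd]
      simp only [fun j i => hd.symm₁₂ j x i, fun l i => hd.symm₁₂ l c i]
    have e2 : ∑ j, ∑ l, W j l * ∑ i, d l j i * d x c i
        = ∑ j, ∑ l, W j l * ∑ m, d j l m * d x c m := by
      simp only [fun j l i => hd.symm₁₂ l j i]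
    have e3 : ∑ j, ∑ l, W j l * ∑ i, d x l i * d j c i = contractOp d W x c := by
      rw [contractOp_apply_sum hd, Finset.sum_comm]
      simp only [fun l i => hd.symm₁₂ l c i, fun j l => hs l j]
    have r1 : ∑ j, ∑ l, W j l * ((1 : Matrix (Fin 8) (Fin 8) ℝ) j x
        * (1 : Matrix (Fin 8) (Fin 8) ℝ) l c) = W x c := by
      simp [Matrix.one_apply]
    have r2 : ∑ j, ∑ l, W j l * ((1 : Matrix (Fin 8) (Fin 8) ℝ) l j
        * (1 : Matrix (Fin 8) (Fin 8) ℝ) x c) = W.trace * (1 : Matrix (Fin 8) (Fin 8) ℝ) x c := by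
      simp only [← mul_assoc, ← Finset.sum_mul]
      simp [Matrix.one_apply, Matrix.trace]
    have r3 : ∑ j, ∑ l, W j l * ((1 : Matrix (Fin 8) (Fin 8) ℝ) x l
        * (1 : Matrix (Fin 8) (Fin 8) ℝ) j c) = W x c := by
      rw [hs x c]; simp [Matrix.one_apply]
    rw [e1, e2, e3, r1, r2, r3] at h
    linarith
  have htr : W.trace = 0 := by
    have h := Finset.sum_congr (rfl : (Finset.univ : Finset (Fin 8)) = Finset.univ)
      fun x _ => hq x x
    rw [hW] at h
    have h0 : ∑ x, ∑ j, ∑ l, W j l * ∑ m, d j l m * d x x m = 0 := by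
      rw [Finset.sum_comm]
      refine Finset.sum_eq_zero fun j _ => ?_
      rw [Finset.sum_comm]
      refine Finset.sum_eq_zero fun l _ => ?_
      rw [← Finset.mul_sum, Finset.sum_comm]
      simp only [← Finset.mul_sum]
      refine mul_eq_zero_of_right _ (Finset.sum_eq_zero fun m _ => ?_)
      rw [Finset.sum_congr rfl fun x _ => hd.swap₁₃ x x m, hd.traceFree m, mul_zero]
    rw [Finset.sum_add_distrib, Finset.sum_add_distrib, h0, ← Finset.mul_sum, ← Finset.mul_sum,
      ← Finset.mul_sum] at h
    have h1 : ∑ x, W x x = W.trace := rfl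
    have h2 : ∑ x, (1 : Matrix (Fin 8) (Fin 8) ℝ) x x = 8 := by simp
    have h3 : ∑ x, ((-(3 / 2) : ℝ) • W) x x = -(3 / 2) * W.trace := by
      rw [← h1, Finset.mul_sum]; rfl
    rw [h1, h2, h3] at h
    linarith
  refine ⟨htr, hsymm, fun x c => ?_⟩
  have := hq x c
  rw [hW, htr] at this
  simp only [Matrix.smul_apply, smul_eq_mul] at this
  linarith

/-- The sum of `ψ_{IAB} W_{IC}` over the cyclic permutations of `A`, `B`, `C`. -/
noncomputable def psiExpand (W : Fin 8 → Fin 8 → ℝ) (a b c : Fin 8) : ℝ :=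
  ∑ i, (psi i a b * W i c + psi i b c * W i a + psi i c a * W i b)

lemma isSkew3_psiExpand (W : Fin 8 → Fin 8 → ℝ) : IsSkew3 (psiExpand W) := by
  constructor <;>
  · intro a b c
    rw [psiExpand, psiExpand, ← Finset.sum_neg_distrib]
    refine Finset.sum_congr rfl fun i _ => ?_
    rw [isSkew3_psi.2 i b a, isSkew3_psi.2 i c a, isSkew3_psi.2 i c b]
    ring

lemma sum_mul_one_mul_one (W : Matrix (Fin 8) (Fin 8) ℝ) (a b : Fin 8) :
    ∑ k, ∑ l, W k l * ((1 : Matrix (Fin 8) (Fin 8) ℝ) a k * (1 : Matrix (Fin 8) (Fin 8) ℝ) b l)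
      = W a b := by
  simp [Matrix.one_apply]

/-- Substituting `ψ(T)` back into `ψ` gives an operator on 3-forms that involves only `Υ`. -/
lemma psiExpand_psiContract {d T : Fin 8 → Fin 8 → Fin 8 → ℝ} (hd : IsSU3Tensor d)
    (ha : IsAdaptedTensor d) (hT : IsSkew3 T) (a b c : Fin 8) :
    psiExpand (psiContract T) a b c = 16 * T a b c + (8 / 3) * skewOp d T a b c := by
  have key : ∀ a b c, ∑ i, psi i a b * psiContract T i c
      = (16 / 3) * T c a b
        + (8 / 3) * (sliceMatrix T c * sliceMatrix d b * sliceMatrix d a).trace := by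
    intro a b c
    have h1 : ∑ i, psi i a b * psiContract T i c
        = ∑ k, ∑ l, T c k l * ∑ m, psi a b m * psi k l m := by
      simp only [psiContract, Finset.mul_sum]
      rw [Finset.sum_comm]
      refine Finset.sum_congr rfl fun k _ => ?_
      rw [Finset.sum_comm]
      refine Finset.sum_congr rfl fun l _ => Finset.sum_congr rfl fun i _ => ?_
      rw [isSkew3_psi.cyc i a b, isSkew3_psi.cyc i k l]; ring
    have h2 : (sliceMatrix T c * sliceMatrix d b * sliceMatrix d a).trace
        = ∑ k, ∑ l, T c k l * ∑ m, d a k m * d b l m := by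
      simp only [Matrix.trace, Matrix.diag, Matrix.mul_apply, sliceMatrix_apply, Finset.sum_mul,
        Finset.mul_sum]
      refine Finset.sum_congr rfl fun k _ => ?_
      rw [Finset.sum_comm]
      refine Finset.sum_congr rfl fun l _ => Finset.sum_congr rfl fun m _ => ?_
      rw [hd.symm₂₃ a m k]; ring
    have h3 : ∑ k, ∑ l, T c k l * ∑ m, d b k m * d a l m
        = - ∑ k, ∑ l, T c k l * ∑ m, d a k m * d b l m := by
      rw [Finset.sum_comm]
      simp only [← Finset.sum_neg_distrib]
      refine Finset.sum_congr rfl fun k _ => Finset.sum_congr rfl fun l _ => ?_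
      rw [hT.2 c l k, neg_mul]
      simp only [mul_comm]
    rw [h1, h2]
    simp only [ha.sum_psi_mul_psi, mul_add, mul_sub, Finset.sum_add_distrib,
      Finset.sum_sub_distrib, mul_left_comm (T c _ _) (_ / _ : ℝ), ← Finset.mul_sum]
    have h4 := sum_mul_one_mul_one (sliceMatrix T c) a b
    have h5 := sum_mul_one_mul_one (sliceMatrix T c) b a
    simp only [sliceMatrix_apply] at h4 h5
    rw [h3, h4, h5, hT.2 c b a]
    ring
  unfold psiExpand skewOp
  rw [Finset.sum_add_distrib, Finset.sum_add_distrib, key, key, key]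
  rw [hT.cyc c a b, hT.cyc b c a, hT.cyc c a b]
  ring

/-- On the eigenspace of 2-tensors that defines vectorial type, `psiExpand` inverts `ψ` up to the
factor `24`. -/
lemma psiContract_psiExpand {d : Fin 8 → Fin 8 → Fin 8 → ℝ} (hd : IsSU3Tensor d)
    (ha : IsAdaptedTensor d) {W : Matrix (Fin 8) (Fin 8) ℝ}
    (hW : contractOp d W = (-(3 / 2) : ℝ) • W) (x c : Fin 8) :
    psiContract (psiExpand fun i j => W i j) c x = 24 * W c x := by
  obtain ⟨htr, -, h5⟩ := eq_of_contractOp_eq hd hW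
  have hA : ∑ k, ∑ l, psi c k l * ∑ i, psi i k l * W i x = 12 * W c x := by
    have h : ∀ i, ∑ k, ∑ l, psi c k l * psi i k l
        = 12 * (1 : Matrix (Fin 8) (Fin 8) ℝ) c i := by
      intro i
      simp only [ha.sum_psi_mul_psi, Finset.sum_add_distrib, Finset.sum_sub_distrib,
        ← Finset.mul_sum]
      have e1 : ∑ k, ∑ m, d c i m * d k k m = 0 := by
        rw [Finset.sum_comm]
        simp only [← Finset.mul_sum]
        refine Finset.sum_eq_zero fun m _ => ?_
        rw [Finset.sum_congr rfl fun x _ => hd.swap₁₃ x x m, hd.traceFree m, mul_zero]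
      have e2 : ∑ k, ∑ m, d k i m * d c k m = 5 * (1 : Matrix (Fin 8) (Fin 8) ℝ) c i := by
        rw [← hd.sum_mul_eq]
        refine Finset.sum_congr rfl fun k _ => Finset.sum_congr rfl fun m _ => ?_
        rw [hd.symm₁₂ k i m, mul_comm]
      rw [e1, e2]
      simp only [Matrix.one_apply, mul_ite, mul_one, mul_zero, ite_mul, zero_mul,
        Finset.sum_ite_eq, Finset.mem_univ, if_true, Finset.sum_const,
        Finset.card_univ, Fintype.card_fin, nsmul_eq_mul]
      split_ifs <;> norm_num
    have e : ∑ k, ∑ l, psi c k l * ∑ i, psi i k l * W i x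
        = ∑ i, W i x * ∑ k, ∑ l, psi c k l * psi i k l := by
      simp only [Finset.mul_sum]
      rw [Finset.sum_congr rfl fun k _ => Finset.sum_comm, Finset.sum_comm]
      refine Finset.sum_congr rfl fun i _ => Finset.sum_congr rfl fun k _ =>
        Finset.sum_congr rfl fun l _ => ?_
      ring
    rw [e]
    simp only [h]
    simp [Matrix.one_apply, mul_comm]
  have hB : ∑ k, ∑ l, psi c k l * ∑ i, psi i x k * W i l = 6 * W c x := by
    have e : ∑ k, ∑ l, psi c k l * ∑ i, psi i x k * W i l
        = ∑ i, ∑ l, W i l * ∑ k, psi l c k * psi i x k := by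
      simp only [Finset.mul_sum]
      rw [Finset.sum_comm, Finset.sum_congr rfl fun k _ => Finset.sum_comm, Finset.sum_comm]
      refine Finset.sum_congr rfl fun i _ => Finset.sum_congr rfl fun k _ =>
        Finset.sum_congr rfl fun l _ => ?_
      rw [isSkew3_psi.cyc k c l, isSkew3_psi.cyc c l k, isSkew3_psi.cyc l k c]; ring
    rw [e]
    simp only [ha.sum_psi_mul_psi, mul_add, mul_sub, Finset.sum_add_distrib,
      Finset.sum_sub_distrib, mul_left_comm (W _ _) (_ / _ : ℝ), ← Finset.mul_sum]
    have h1 : ∑ i, ∑ l, W i l * ((1 : Matrix (Fin 8) (Fin 8) ℝ) l i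
        * (1 : Matrix (Fin 8) (Fin 8) ℝ) c x) = W.trace * (1 : Matrix (Fin 8) (Fin 8) ℝ) c x := by
      simp only [← mul_assoc, ← Finset.sum_mul]
      simp [Matrix.one_apply, Matrix.trace]
    have h2 : ∑ i, ∑ l, W i l * ((1 : Matrix (Fin 8) (Fin 8) ℝ) c i
        * (1 : Matrix (Fin 8) (Fin 8) ℝ) l x) = W c x := by
      simp [Matrix.one_apply]
    have h3 : ∑ i, ∑ l, W i l * ∑ m, d l i m * d c x m = 5 * W c x := by
      rw [← h5 c x]
      refine Finset.sum_congr rfl fun i _ => Finset.sum_congr rfl fun l _ => ?_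
      rw [Finset.sum_congr rfl fun m _ => congrArg (· * _) (hd.symm₁₂ l i m)]
    have h4 : ∑ i, ∑ l, W i l * ∑ m, d c i m * d l x m = -(3 / 2) * W c x := by
      have := contractOp_apply_sum hd W c x
      rw [hW] at this
      simp only [Matrix.smul_apply, smul_eq_mul, fun l m => hd.symm₁₂ x l m] at this
      exact this.symm
    rw [h1, h2, h3, h4, htr]
    ring
  have hC : ∑ k, ∑ l, psi c k l * ∑ i, psi i l x * W i k = 6 * W c x := by
    rw [← hB, Finset.sum_comm]
    refine Finset.sum_congr rfl fun k _ => Finset.sum_congr rfl fun l _ => ?_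
    simp only [isSkew3_psi.2 c l k, fun i => isSkew3_psi.2 i k x, neg_mul, Finset.sum_neg_distrib,
      mul_neg, neg_neg]
  simp only [psiContract, psiExpand, Finset.sum_add_distrib, mul_add]
  rw [hA, hB, hC]
  ring

/-- The eigenvalue condition on `ψ(T)` that defines vectorial type, in terms of `T` and `Υ` only. By
injectivity of `ψ`, `24 T` is the expansion of `ψ(T)`, which is also `16 T + (8/3) skewOp d T`. -/
lemma isVectorial_of_hatUpsilon {d T : Fin 8 → Fin 8 → Fin 8 → ℝ} (hd : IsSU3Tensor d)
    (ha : IsAdaptedTensor d) (hT : IsSkew3 T)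
    (h : ∀ i j, hatUpsilon d (psiContract T) i j = -6 * psiContract T i j) :
    IsVectorial d T := by
  set W : Matrix (Fin 8) (Fin 8) ℝ := Matrix.of (psiContract T) with hWdef
  have hWf : (fun i j => W i j) = psiContract T := rfl
  have hW : contractOp d W = (-(3 / 2) : ℝ) • W := by
    ext i j
    have h1 := h i j
    have h2 := hatUpsilon_eq_contractOp hd W i j
    rw [hWf] at h2
    rw [Matrix.smul_apply, smul_eq_mul, hWdef, Matrix.of_apply, ← hWdef]
    linarith
  have h24 := psiContract_psiExpand hd ha hW
  rw [hWf] at h24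
  have hS := isSkew3_psiExpand (psiContract T)
  have h0 : (fun i j k => T i j k - (1 / 24) * psiExpand (psiContract T) i j k) = 0 := by
    refine eq_zero_of_psiContract_eq_zero ⟨fun i j k => ?_, fun i j k => ?_⟩ fun i j => ?_
    · beta_reduce; rw [hT.1, hS.1]; ring
    · beta_reduce; rw [hT.2, hS.2]; ring
    · have e : psiContract (fun i j k => T i j k - (1 / 24) * psiExpand (psiContract T) i j k) i j
          = psiContract T i j - (1 / 24) * psiContract (psiExpand (psiContract T)) i j := by
        simp only [psiContract, Finset.mul_sum, ← Finset.sum_sub_distrib]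
        refine Finset.sum_congr rfl fun k _ => Finset.sum_congr rfl fun l _ => ?_
        ring
      rw [e, h24, hWdef, Matrix.of_apply]; ring
  intro i j k
  have h1 := congrFun (congrFun (congrFun h0 i) j) k
  have h2 := psiExpand_psiContract hd ha hT i j k
  simp only [Pi.zero_apply] at h1
  linarith

end SU3Dim8

/-! ### Orthonormal bases -/

namespace SU3Dim8

open Matrix

/-- The components of a 3-tensor in the basis `e'_i = O_{ij} e_j`. -/
def rotateTensor (O : Matrix (Fin 8) (Fin 8) ℝ) (t : Fin 8 → Fin 8 → Fin 8 → ℝ) (i j k : Fin 8) :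
    ℝ :=
  ∑ x, ∑ y, ∑ z, O i x * O j y * O k z * t x y z

lemma sliceMatrix_rotateTensor (O : Matrix (Fin 8) (Fin 8) ℝ) (t : Fin 8 → Fin 8 → Fin 8 → ℝ)
    (i : Fin 8) : sliceMatrix (rotateTensor O t) i = ∑ x, O i x • (O * sliceMatrix t x * Oᵀ) := by
  ext j k
  simp only [sliceMatrix_apply, rotateTensor, Matrix.sum_apply, Matrix.smul_apply, smul_eq_mul,
    Matrix.mul_apply, Matrix.transpose_apply, Finset.sum_mul, Finset.mul_sum]
  refine Finset.sum_congr rfl fun x _ => ?_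
  rw [Finset.sum_comm]
  refine Finset.sum_congr rfl fun y _ => Finset.sum_congr rfl fun z _ => ?_
  ring

lemma trace_rotateTensor {O : Matrix (Fin 8) (Fin 8) ℝ} (hO : Oᵀ * O = 1)
    (d t : Fin 8 → Fin 8 → Fin 8 → ℝ) (i j k : Fin 8) :
    (sliceMatrix (rotateTensor O t) k * sliceMatrix (rotateTensor O d) j
        * sliceMatrix (rotateTensor O d) i).trace
      = ∑ x, ∑ y, ∑ z, O i x * O j y * O k z
          * (sliceMatrix t z * sliceMatrix d y * sliceMatrix d x).trace := by
  have key : ∀ A B C : Matrix (Fin 8) (Fin 8) ℝ,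
      ((O * A * Oᵀ) * (O * B * Oᵀ) * (O * C * Oᵀ)).trace = (A * B * C).trace := by
    intro A B C
    have : (O * A * Oᵀ) * (O * B * Oᵀ) * (O * C * Oᵀ)
        = O * (A * (Oᵀ * O) * B * (Oᵀ * O) * C * Oᵀ) := by simp only [mul_assoc]
    rw [this, hO, Matrix.trace_mul_comm, mul_assoc, hO]
    simp only [mul_one]
  simp only [sliceMatrix_rotateTensor, Finset.sum_mul, Finset.mul_sum, Matrix.smul_mul,
    Matrix.mul_smul, Matrix.trace_sum, Matrix.trace_smul, key, smul_eq_mul]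
  refine Finset.sum_congr rfl fun x _ => Finset.sum_congr rfl fun y _ =>
    Finset.sum_congr rfl fun z _ => ?_
  ring

lemma IsVectorial.rotateTensor {O : Matrix (Fin 8) (Fin 8) ℝ} (hO : Oᵀ * O = 1)
    {d t : Fin 8 → Fin 8 → Fin 8 → ℝ} (h : IsVectorial d t) :
    IsVectorial (rotateTensor O d) (rotateTensor O t) := by
  intro i j k
  unfold skewOp
  rw [trace_rotateTensor hO, trace_rotateTensor hO, trace_rotateTensor hO]
  rw [show SU3Dim8.rotateTensor O t i j k = ∑ x, ∑ y, ∑ z, O i x * O j y * O k z * t x y z from rfl]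
  have h1 : ∀ f : Fin 8 → Fin 8 → Fin 8 → ℝ, ∑ x, ∑ y, ∑ z, f x y z = ∑ z, ∑ x, ∑ y, f x y z := by
    intro f
    rw [Finset.sum_congr rfl fun x _ => Finset.sum_comm, Finset.sum_comm]
  rw [h1 fun x y z => O j x * O k y * O i z
      * (sliceMatrix t z * sliceMatrix d y * sliceMatrix d x).trace,
    ← h1 fun y z x => O k x * O i y * O j z
      * (sliceMatrix t z * sliceMatrix d y * sliceMatrix d x).trace]
  simp only [Finset.mul_sum, ← Finset.sum_add_distrib]
  refine Finset.sum_congr rfl fun x _ => Finset.sum_congr rfl fun y _ =>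
    Finset.sum_congr rfl fun z _ => ?_
  have := h x y z
  unfold skewOp at this
  linear_combination O i x * O j y * O k z * this

variable {M : Type*} [TopologicalSpace M] [ChartedSpace E8 M]

/-- A real function of three vectors that is linear in each of them. -/
structure IsTrilinear {V : Type*} [AddCommGroup V] [Module ℝ V] (f : V → V → V → ℝ) : Prop where
  left : ∀ v w, IsLinearMap ℝ fun u => f u v w
  mid : ∀ u w, IsLinearMap ℝ fun v => f u v w
  right : ∀ u v, IsLinearMap ℝ fun w => f u v w

lemma IsTrilinear.sum {V : Type*} [AddCommGroup V] [Module ℝ V] {f : V → V → V → ℝ}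
    (hf : IsTrilinear f) (e : Fin 8 → V) (a b c : Fin 8 → ℝ) :
    f (∑ i, a i • e i) (∑ j, b j • e j) (∑ k, c k • e k)
      = ∑ i, ∑ j, ∑ k, a i * b j * c k * f (e i) (e j) (e k) := by
  have h1 : ∀ v w, f (∑ i, a i • e i) v w = ∑ i, a i * f (e i) v w := fun v w => by
    have := map_sum ((hf.left v w).mk' _) (fun i => a i • e i) Finset.univ
    simpa only [map_smul, IsLinearMap.mk'_apply, smul_eq_mul] using this
  have h2 : ∀ u w, f u (∑ i, b i • e i) w = ∑ i, b i * f u (e i) w := fun u w => by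
    have := map_sum ((hf.mid u w).mk' _) (fun i => b i • e i) Finset.univ
    simpa only [map_smul, IsLinearMap.mk'_apply, smul_eq_mul] using this
  have h3 : ∀ u v, f u v (∑ i, c i • e i) = ∑ i, c i * f u v (e i) := fun u v => by
    have := map_sum ((hf.right u v).mk' _) (fun i => c i • e i) Finset.univ
    simpa only [map_smul, IsLinearMap.mk'_apply, smul_eq_mul] using this
  simp only [h1, h2, h3, Finset.mul_sum, mul_assoc]

lemma Tensor3.isTrilinear (Υ : Tensor3 M) (p : M) : IsTrilinear fun u v w => Υ p u v w where
  left v w := ⟨fun x y => by rw [ContinuousLinearMap.map_add]; rfl,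
    fun c x => by rw [ContinuousLinearMap.map_smul]; rfl⟩
  mid u w := ⟨fun x y => by rw [ContinuousLinearMap.map_add]; rfl,
    fun c x => by rw [ContinuousLinearMap.map_smul]; rfl⟩
  right u v := ⟨fun x y => ContinuousLinearMap.map_add _ x y,
    fun c x => ContinuousLinearMap.map_smul _ c x⟩

variable [RiemannianBundle (fun p : M => TangentSpace (𝓡 8) p)]

/-- Eight orthonormal tangent vectors form a basis. -/
noncomputable def frameBasis {p : M} {e : Fin 8 → TangentSpace (𝓡 8) p} (he : Orthonormal ℝ e) :
    OrthonormalBasis (Fin 8) ℝ (TangentSpace (𝓡 8) p) :=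
  (basisOfOrthonormalOfCardEqFinrank he
    (by rw [show Module.finrank ℝ (TangentSpace (𝓡 8) p) = Module.finrank ℝ E8 from rfl]; simp)
    ).toOrthonormalBasis (by simpa using he)

@[simp] lemma frameBasis_apply {p : M} {e : Fin 8 → TangentSpace (𝓡 8) p} (he : Orthonormal ℝ e)
    (i : Fin 8) : frameBasis he i = e i := by
  simp [frameBasis]

lemma sum_inner_smul_frame {p : M} {e : Fin 8 → TangentSpace (𝓡 8) p} (he : Orthonormal ℝ e)
    (v : TangentSpace (𝓡 8) p) : ∑ i, inner ℝ (e i) v • e i = v := by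
  simpa using (frameBasis he).sum_repr' v

lemma sum_inner_mul_inner_frame {p : M} {e : Fin 8 → TangentSpace (𝓡 8) p} (he : Orthonormal ℝ e)
    (v w : TangentSpace (𝓡 8) p) : ∑ i, inner ℝ (e i) v * inner ℝ (e i) w = inner ℝ v w := by
  have := (frameBasis he).sum_inner_mul_inner v w
  simp only [frameBasis_apply] at this
  rw [← this]
  exact Finset.sum_congr rfl fun i _ => by rw [real_inner_comm]

lemma inner_frame {p : M} {e : Fin 8 → TangentSpace (𝓡 8) p} (he : Orthonormal ℝ e)
    (i j : Fin 8) : inner ℝ (e i) (e j) = (1 : Matrix (Fin 8) (Fin 8) ℝ) i j := by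
  rw [orthonormal_iff_ite.mp he, Matrix.one_apply]

/-- The change of basis matrix between two orthonormal bases of a tangent space. -/
noncomputable def frameMatrix {p : M} (e e' : Fin 8 → TangentSpace (𝓡 8) p) :
    Matrix (Fin 8) (Fin 8) ℝ :=
  Matrix.of fun i j => inner ℝ (e j) (e' i)

lemma transpose_frameMatrix_mul {p : M} {e e' : Fin 8 → TangentSpace (𝓡 8) p}
    (he : Orthonormal ℝ e) (he' : Orthonormal ℝ e') :
    (frameMatrix e e')ᵀ * frameMatrix e e' = 1 := by
  ext i j
  rw [Matrix.mul_apply, ← inner_frame he, ← sum_inner_mul_inner_frame he']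
  exact Finset.sum_congr rfl fun k _ => by
    rw [Matrix.transpose_apply, frameMatrix, Matrix.of_apply, Matrix.of_apply, real_inner_comm,
      real_inner_comm (e j)]

lemma IsTrilinear.comp_eq_rotateTensor {p : M}
    {f : TangentSpace (𝓡 8) p → TangentSpace (𝓡 8) p → TangentSpace (𝓡 8) p → ℝ}
    (hf : IsTrilinear f) {e : Fin 8 → TangentSpace (𝓡 8) p}
    (he : Orthonormal ℝ e) (e' : Fin 8 → TangentSpace (𝓡 8) p) :
    (fun i j k => f (e' i) (e' j) (e' k))
      = rotateTensor (frameMatrix e e') fun i j k => f (e i) (e j) (e k) := by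
  funext i j k
  conv_lhs => rw [← sum_inner_smul_frame he (e' i), ← sum_inner_smul_frame he (e' j),
    ← sum_inner_smul_frame he (e' k)]
  rw [hf.sum]
  rfl

variable [IsManifold (𝓡 8) ∞ M]

lemma IsSU3Structure.isSU3Tensor {Υ : Tensor3 M} (hΥ : IsSU3Structure Υ) {p : M}
    {e : Fin 8 → TangentSpace (𝓡 8) p} (he : Orthonormal ℝ e) : IsSU3Tensor (comp Υ e) where
  symm₁₂ i j k := hΥ.symm₁₂ p _ _ _
  symm₂₃ i j k := hΥ.symm₂₃ p _ _ _
  traceFree i := by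
    have := hΥ.traceFree p (frameBasis he) (e i)
    simp only [frameBasis_apply] at this
    exact this
  quadratic j k l m := by
    have := hΥ.quadratic p (frameBasis he) (e j) (e k) (e l) (e m)
    simp only [frameBasis_apply, inner_frame he] at this
    exact this

lemma IsSU3Structure.isAdaptedTensor {Υ : Tensor3 M} (hΥ : IsSU3Structure Υ) {p : M}
    {e : Fin 8 → TangentSpace (𝓡 8) p} (he : IsAdaptedAt Υ e) : IsAdaptedTensor (comp Υ e) where
  symm₁₂ i j k := hΥ.symm₁₂ p _ _ _
  symm₂₃ i j k := hΥ.symm₂₃ p _ _ _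
  cubic x := by
    rw [← he.2 x]
    exact ((Υ.isTrilinear p).sum e x x x).symm

/-- The components of `Υ` are the same in all adapted frames. -/
lemma IsSU3Structure.comp_eq_of_isAdaptedAt {Υ : Tensor3 M} (hΥ : IsSU3Structure Υ) {p q : M}
    {e : Fin 8 → TangentSpace (𝓡 8) p} {e' : Fin 8 → TangentSpace (𝓡 8) q}
    (he : IsAdaptedAt Υ e) (he' : IsAdaptedAt Υ e') : comp Υ e = comp Υ e' := by
  funext a b c
  have h1 := (hΥ.isAdaptedTensor he).trace_anticommutator a b c
  have h2 := (hΥ.isAdaptedTensor he').trace_anticommutator a b c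
  rw [h1] at h2
  have h3 := h2
  norm_num at h3
  exact_mod_cast h3

end SU3Dim8

/-! ### Derivatives of functions and of vector fields -/

namespace SU3Dim8

open Filter Topology

variable {M : Type*} [TopologicalSpace M] [ChartedSpace E8 M]

/-- The real function `f` is differentiable at `p`. -/
abbrev FDiffAt (f : M → ℝ) (p : M) : Prop := MDifferentiableAt (𝓡 8) 𝓘(ℝ) f p

lemma mvfderiv_congr {f g : M → ℝ} {p : M} (h : ∀ᶠ q in 𝓝 p, f q = g q)
    (v : TangentSpace (𝓡 8) p) : mvfderiv (𝓡 8) f p v = mvfderiv (𝓡 8) g p v := by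
  have : f =ᶠ[𝓝 p] g := h
  simp only [mvfderiv, this.mfderiv_eq]
  rfl

lemma mvfderiv_mul_apply {f g : M → ℝ} {p : M} (hf : FDiffAt f p) (hg : FDiffAt g p)
    (v : TangentSpace (𝓡 8) p) : mvfderiv (𝓡 8) (fun q => f q * g q) p v
      = f p * mvfderiv (𝓡 8) g p v + g p * mvfderiv (𝓡 8) f p v := by
  have := congrArg (fun L => L v) (mvfderiv_mul hf hg)
  simp only [_root_.add_apply, _root_.smul_apply, smul_eq_mul] at this
  exact this

lemma mvfderiv_finset_sum {ι : Type*} {f : ι → M → ℝ} {p : M} (hf : ∀ i, FDiffAt (f i) p)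
    (v : TangentSpace (𝓡 8) p) (s : Finset ι) : FDiffAt (fun q => ∑ i ∈ s, f i q) p ∧
      mvfderiv (𝓡 8) (fun q => ∑ i ∈ s, f i q) p v = ∑ i ∈ s, mvfderiv (𝓡 8) (f i) p v := by
  classical
  induction s using Finset.induction_on with
  | empty =>
    simp only [Finset.sum_empty]
    exact ⟨mdifferentiableAt_const, by rw [mvfderiv_const]; rfl⟩
  | insert a s ha ih =>
    simp only [Finset.sum_insert ha]
    refine ⟨(hf a).add ih.1, ?_⟩
    have := mvfderiv_add (hf a) ih.1
    rw [← ih.2, ← _root_.add_apply, ← this]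
    rfl

lemma fdiffAt_sum {ι : Type*} [Fintype ι] {f : ι → M → ℝ} {p : M} (hf : ∀ i, FDiffAt (f i) p) :
    FDiffAt (fun q => ∑ i, f i q) p := (mvfderiv_finset_sum hf 0 _).1

lemma mvfderiv_fsum {ι : Type*} [Fintype ι] {f : ι → M → ℝ} {p : M} (hf : ∀ i, FDiffAt (f i) p)
    (v : TangentSpace (𝓡 8) p) :
    mvfderiv (𝓡 8) (fun q => ∑ i, f i q) p v = ∑ i, mvfderiv (𝓡 8) (f i) p v :=
  (mvfderiv_finset_sum hf v _).2

/-- Directional derivatives commute with linear functionals. -/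
lemma mvfderiv_linear {ι : Type*} [Fintype ι] (L : (ι → ℝ) →ₗ[ℝ] ℝ) {f : ι → M → ℝ} {p : M}
    (hf : ∀ i, FDiffAt (f i) p) (v : TangentSpace (𝓡 8) p) :
    mvfderiv (𝓡 8) (fun q => L fun i => f i q) p v = L fun i => mvfderiv (𝓡 8) (f i) p v := by
  classical
  have e : ∀ y : ι → ℝ, L y = ∑ i, y i * L fun j => if i = j then 1 else 0 :=
    fun y => L.pi_apply_eq_sum_univ y
  rw [e fun i => mvfderiv (𝓡 8) (f i) p v,
    show (fun q => L fun i => f i q) = fun q => ∑ i, f i q * L fun j => if i = j then 1 else 0 from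
      funext fun q => e _]
  rw [mvfderiv_fsum (f := fun i q => f i q * L fun j => if i = j then 1 else 0)
    fun i => (hf i).mul mdifferentiableAt_const]
  refine Finset.sum_congr rfl fun i _ => ?_
  rw [mvfderiv_mul_apply (hf i) mdifferentiableAt_const, mvfderiv_const,
    _root_.zero_apply, mul_zero, zero_add, mul_comm]

variable [IsManifold (𝓡 8) ∞ M]

/-- The vector field `X` is differentiable at `p`. -/
def DiffAt (X : VField M) (p : M) : Prop :=
  MDifferentiableAt (𝓡 8) (𝓡 8).tangent (fun q => (⟨q, X q⟩ : TangentBundle (𝓡 8) M)) p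

/-- The vector field `X` is smooth in a neighbourhood of `p`. -/
def SmoothNear (X : VField M) (p : M) : Prop := ∃ U, IsOpen U ∧ p ∈ U ∧ SmoothOn X U

lemma SmoothOn.smoothNear {X : VField M} {U : Set M} (hX : SmoothOn X U) (hU : IsOpen U) {p : M}
    (hp : p ∈ U) : SmoothNear X p := ⟨U, hU, hp, hX⟩

lemma SmoothOn.mono {X : VField M} {U V : Set M} (hX : SmoothOn X U) (h : V ⊆ U) : SmoothOn X V :=
  ContMDiffOn.mono hX h

lemma SmoothNear.eventually {X : VField M} {p : M} (h : SmoothNear X p) :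
    ∀ᶠ q in 𝓝 p, SmoothNear X q := by
  obtain ⟨U, hU, hp, hX⟩ := h
  filter_upwards [hU.mem_nhds hp] with q hq using ⟨U, hU, hq, hX⟩

lemma SmoothNear.diffAt {X : VField M} {p : M} (h : SmoothNear X p) : DiffAt X p := by
  obtain ⟨U, hU, hp, hX⟩ := h
  exact (ContMDiffOn.contMDiffAt hX (hU.mem_nhds hp)).mdifferentiableAt (by simp)

lemma DiffAt.congr {X Y : VField M} {p : M} (h : DiffAt X p) (hXY : ∀ᶠ q in 𝓝 p, Y q = X q) :
    DiffAt Y p := by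
  refine MDifferentiableAt.congr_of_eventuallyEq h ?_
  filter_upwards [hXY] with q hq
  rw [hq]

lemma SmoothNear.congr {X Y : VField M} {p : M} (h : SmoothNear X p)
    (hXY : ∀ᶠ q in 𝓝 p, Y q = X q) : SmoothNear Y p := by
  obtain ⟨U, hU, hp, hX⟩ := h
  obtain ⟨V, hV, hVo, hpV⟩ := eventually_nhds_iff.mp hXY
  refine ⟨U ∩ V, hU.inter hVo, ⟨hp, hpV⟩, ?_⟩
  refine ContMDiffOn.congr (hX.mono inter_subset_left) fun q hq => ?_
  rw [hV q hq.2]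

lemma SmoothNear.sub {X Y : VField M} {p : M} (hX : SmoothNear X p) (hY : SmoothNear Y p) :
    SmoothNear (fun q => X q - Y q) p := by
  obtain ⟨U, hU, hp, hX⟩ := hX
  obtain ⟨V, hV, hpV, hY⟩ := hY
  exact ⟨U ∩ V, hU.inter hV, ⟨hp, hpV⟩,
    ContMDiffOn.sub_section (hX.mono inter_subset_left) (hY.mono inter_subset_right)⟩

lemma SmoothNear.mlieBracket {X Y : VField M} {p : M} (hX : SmoothNear X p)
    (hY : SmoothNear Y p) : SmoothNear (VectorField.mlieBracket (𝓡 8) X Y) p := by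
  obtain ⟨U, hU, hp, hX⟩ := hX
  obtain ⟨V, hV, hpV, hY⟩ := hY
  refine ⟨U ∩ V, hU.inter hV, ⟨hp, hpV⟩, fun q hq => ContMDiffAt.contMDiffWithinAt ?_⟩
  have : IsManifold (𝓡 8) (((⊤ : ℕ∞) : WithTop ℕ∞) + 1) M := by
    simpa using (inferInstance : IsManifold (𝓡 8) ∞ M)
  have : IsManifold (𝓡 8) (minSmoothness ℝ 2) M := by
    simpa using IsManifold.of_le (I := 𝓡 8) (M := M) (m := 2) (n := ∞) (WithTop.coe_le_coe.mpr
        (le_top : (2 : ℕ∞) ≤ ⊤))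
  exact ContMDiffAt.mlieBracket_vectorField (m := ⊤) (n := ⊤)
    (ContMDiffOn.contMDiffAt hX (hU.mem_nhds hq.1)) (ContMDiffOn.contMDiffAt hY (hV.mem_nhds hq.2))
    (by simp)

lemma smoothNear_extend {p : M} (v : TangentSpace (𝓡 8) p) :
    SmoothNear (FiberBundle.extend E8 v) p := by
  obtain ⟨s, hs, h⟩ := FiberBundle.exists_contMDiffOn_extend (k := ∞) (𝓡 8) E8 v
  obtain ⟨U, hUs, hU, hp⟩ := mem_nhds_iff.mp hs
  exact ⟨U, hU, hp, ContMDiffOn.mono h hUs⟩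

lemma DiffAt.smul {f : M → ℝ} {X : VField M} {p : M} (hf : FDiffAt f p) (hX : DiffAt X p) :
    DiffAt (f • X) p := MDifferentiableAt.smul_section hf hX

lemma DiffAt.add {X Y : VField M} {p : M} (hX : DiffAt X p) (hY : DiffAt Y p) :
    DiffAt (X + Y) p := mdifferentiableAt_add_section hX hY

lemma cov_congr (nabla : Connection M) {X Y : VField M} {p : M} (hX : DiffAt X p)
    (hXY : ∀ᶠ q in 𝓝 p, Y q = X q) : nabla Y p = nabla X p :=
  nabla.isCovariantDerivativeOnUniv.congr_of_eventuallyEq (hX.congr hXY) hX Filter.univ_mem hXY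

lemma cov_add (nabla : Connection M) {X Y : VField M} {p : M} (hX : DiffAt X p)
    (hY : DiffAt Y p) (v : TangentSpace (𝓡 8) p) :
    nabla (X + Y) p v = nabla X p v + nabla Y p v := by
  rw [nabla.isCovariantDerivativeOnUniv.add hX hY]; rfl

lemma cov_smul (nabla : Connection M) {f : M → ℝ} {X : VField M} {p : M} (hf : FDiffAt f p)
    (hX : DiffAt X p) (v : TangentSpace (𝓡 8) p) :
    nabla (f • X) p v = f p • nabla X p v + mvfderiv (𝓡 8) f p v • X p := by
  rw [nabla.isCovariantDerivativeOnUniv.leibniz hX hf]; rfl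

lemma cov_sub (nabla : Connection M) {X Y : VField M} {p : M} (hX : DiffAt X p)
    (hY : DiffAt Y p) (v : TangentSpace (𝓡 8) p) :
    nabla (fun q => X q - Y q) p v = nabla X p v - nabla Y p v := by
  have h : DiffAt (fun q => X q - Y q) p := mdifferentiableAt_sub_section hX hY
  have := cov_add nabla h hY v
  rw [show (fun q => X q - Y q) + Y = X from funext fun q => sub_add_cancel _ _] at this
  rw [this, add_sub_cancel_right]

lemma DiffAt.sum {f : Fin 8 → M → ℝ} {X : Fin 8 → VField M} {p : M}
    (hf : ∀ i, FDiffAt (f i) p) (hX : ∀ i, DiffAt (X i) p) (s : Finset (Fin 8)) :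
    DiffAt (fun q => ∑ i ∈ s, f i q • X i q) p :=
  MDifferentiableAt.sum_section fun i _ => (hX i).smul (hf i)

lemma cov_sum (nabla : Connection M) {f : Fin 8 → M → ℝ} {X : Fin 8 → VField M} {p : M}
    (hf : ∀ i, FDiffAt (f i) p) (hX : ∀ i, DiffAt (X i) p) (v : TangentSpace (𝓡 8) p) :
    nabla (fun q => ∑ i, f i q • X i q) p v
      = ∑ i, (f i p • nabla (X i) p v + mvfderiv (𝓡 8) (f i) p v • X i p) := by
  suffices h : ∀ s : Finset (Fin 8), nabla (fun q => ∑ i ∈ s, f i q • X i q) p v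
      = ∑ i ∈ s, (f i p • nabla (X i) p v + mvfderiv (𝓡 8) (f i) p v • X i p) from h _
  intro s
  induction s using Finset.induction_on with
  | empty =>
    simp only [Finset.sum_empty]
    rw [show (fun q : M => (0 : TangentSpace (𝓡 8) q)) = 0 from rfl, nabla.zero]; rfl
  | insert a s ha ih =>
    have h : (fun q => ∑ i ∈ insert a s, f i q • X i q)
        = f a • X a + fun q => ∑ i ∈ s, f i q • X i q := by
      funext q; rw [Finset.sum_insert ha]; rfl
    rw [h, cov_add nabla ((hX a).smul (hf a)) (DiffAt.sum hf hX s), cov_smul nabla (hf a) (hX a),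
      Finset.sum_insert ha, ih]

lemma SmoothNear.cov [T2Space M] {nabla : Connection M}
    (h : nabla.ContMDiffCovariantDerivative ∞) {X Y : VField M} {p : M} (hX : SmoothNear X p)
    (hY : SmoothNear Y p) : SmoothNear (fun q => nabla Y q (X q)) p := by
  obtain ⟨V, hV, hpV, hYV⟩ := hY
  -- cut off `Y`, the smoothness of the connection being formulated with global fields
  obtain ⟨φ, -, hφ⟩ :=
    ((SmoothBumpFunction.nhds_basis_tsupport (I := 𝓡 8) p).mem_iff).mp (hV.mem_nhds hpV)
  have hφs : ContMDiff (𝓡 8) 𝓘(ℝ) ∞ (φ : M → ℝ) := φ.contMDiff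
  have hZ : ContMDiff (𝓡 8) (𝓡 8).tangent ∞
      (fun q => (⟨q, ((φ : M → ℝ) • Y) q⟩ : TangentBundle (𝓡 8) M)) :=
    ContMDiffOn.smul_section_of_tsupport hφs.contMDiffOn hV hφ hYV
  have h1 := h.contMDiff.contMDiff (σ := (φ : M → ℝ) • Y)
    (by rw [contMDiffOn_univ]; simpa using hZ)
  have h2 : SmoothNear (fun q => nabla ((φ : M → ℝ) • Y) q (X q)) p := by
    obtain ⟨U, hU, hpU, hX⟩ := hX
    exact ⟨U, hU, hpU, ContMDiffOn.clm_bundle_apply (ContMDiffOn.mono h1 (subset_univ _)) hX⟩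
  refine h2.congr ?_
  filter_upwards [φ.eventuallyEq_one.eventually_nhds, hV.mem_nhds hpV] with q hq hqV
  have hYq : DiffAt Y q := (hYV.smoothNear hV hqV).diffAt
  rw [cov_congr nabla hYq (Y := (φ : M → ℝ) • Y)]
  filter_upwards [hq] with r hr
  simp only [Pi.smul_apply', hr, Pi.one_apply, one_smul]

end SU3Dim8

/-! ### Covariant derivatives of tensor fields -/

namespace SU3Dim8

open Filter Topology

variable {M : Type*} [TopologicalSpace M] [ChartedSpace E8 M] [IsManifold (𝓡 8) ∞ M]

/-- A differentiable tensor field of type `(0, 3)`, given by its values on tangent vectors. -/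
structure IsDiffTensor
    (S : (p : M) → TangentSpace (𝓡 8) p → TangentSpace (𝓡 8) p → TangentSpace (𝓡 8) p → ℝ) :
    Prop where
  trilinear : ∀ p, IsTrilinear (S p)
  diff : ∀ {p : M} {X Y Z : VField M}, DiffAt X p → DiffAt Y p → DiffAt Z p →
    FDiffAt (fun q => S q (X q) (Y q) (Z q)) p

/-- `(∇_x S)(X, Y, Z)`, computed with vector fields. -/
noncomputable def covDerivAux (nabla : Connection M)
    (S : (p : M) → TangentSpace (𝓡 8) p → TangentSpace (𝓡 8) p → TangentSpace (𝓡 8) p → ℝ)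
    (p : M) (x : TangentSpace (𝓡 8) p) (X Y Z : VField M) : ℝ :=
  mvfderiv (𝓡 8) (fun q => S q (X q) (Y q) (Z q)) p x
    - (S p (nabla X p x) (Y p) (Z p) + S p (X p) (nabla Y p x) (Z p)
      + S p (X p) (Y p) (nabla Z p x))

/-- The covariant derivative `(∇_x S)(u, v, w)` of a `(0, 3)` tensor field, computed with arbitrary
extensions of `u`, `v`, `w` to vector fields. -/
noncomputable def covDeriv (nabla : Connection M)
    (S : (p : M) → TangentSpace (𝓡 8) p → TangentSpace (𝓡 8) p → TangentSpace (𝓡 8) p → ℝ)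
    (p : M) (x u v w : TangentSpace (𝓡 8) p) : ℝ :=
  covDerivAux nabla S p x (FiberBundle.extend E8 u) (FiberBundle.extend E8 v)
    (FiberBundle.extend E8 w)

section

variable {S : (p : M) → TangentSpace (𝓡 8) p → TangentSpace (𝓡 8) p → TangentSpace (𝓡 8) p → ℝ}
  {nabla : Connection M} {p : M} {x : TangentSpace (𝓡 8) p}

lemma tensorialAt_covDerivAux₁ (hS : IsDiffTensor S) {Y Z : VField M} (hY : DiffAt Y p)
    (hZ : DiffAt Z p) : TensorialAt (𝓡 8) E8 (fun X => covDerivAux nabla S p x X Y Z) p where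
  smul {f X} hf hX := by
    have h1 := (hS.trilinear p).left
    have e : (fun q => S q ((f • X) q) (Y q) (Z q)) = fun q => f q * S q (X q) (Y q) (Z q) :=
      funext fun q => ((hS.trilinear q).left _ _).map_smul _ _
    simp only [covDerivAux, e]
    rw [cov_smul nabla hf hX, mvfderiv_mul_apply hf (hS.diff hX hY hZ), (h1 _ _).map_add,
      (h1 _ _).map_smul, (h1 _ _).map_smul, show (f • X) p = f p • X p from rfl,
      (h1 _ _).map_smul, (h1 _ _).map_smul]
    simp only [smul_eq_mul]
    ring
  add {X X'} hX hX' := by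
    have h1 := (hS.trilinear p).left
    have e : (fun q => S q ((X + X') q) (Y q) (Z q))
        = (fun q => S q (X q) (Y q) (Z q)) + fun q => S q (X' q) (Y q) (Z q) :=
      funext fun q => ((hS.trilinear q).left _ _).map_add _ _
    simp only [covDerivAux, e]
    rw [cov_add nabla hX hX', mvfderiv_add (hS.diff hX hY hZ) (hS.diff hX' hY hZ), (h1 _ _).map_add,
      show (X + X') p = X p + X' p from rfl, (h1 _ _).map_add, (h1 _ _).map_add, _root_.add_apply]
    ring

lemma tensorialAt_covDerivAux₂ (hS : IsDiffTensor S) {X Z : VField M} (hX : DiffAt X p)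
    (hZ : DiffAt Z p) : TensorialAt (𝓡 8) E8 (fun Y => covDerivAux nabla S p x X Y Z) p where
  smul {f Y} hf hY := by
    have h1 := (hS.trilinear p).mid
    have e : (fun q => S q (X q) ((f • Y) q) (Z q)) = fun q => f q * S q (X q) (Y q) (Z q) :=
      funext fun q => ((hS.trilinear q).mid _ _).map_smul _ _
    simp only [covDerivAux, e]
    rw [cov_smul nabla hf hY, mvfderiv_mul_apply hf (hS.diff hX hY hZ), (h1 _ _).map_add,
      (h1 _ _).map_smul, (h1 _ _).map_smul, show (f • Y) p = f p • Y p from rfl,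
      (h1 _ _).map_smul, (h1 _ _).map_smul]
    simp only [smul_eq_mul]
    ring
  add {Y Y'} hY hY' := by
    have h1 := (hS.trilinear p).mid
    have e : (fun q => S q (X q) ((Y + Y') q) (Z q))
        = (fun q => S q (X q) (Y q) (Z q)) + fun q => S q (X q) (Y' q) (Z q) :=
      funext fun q => ((hS.trilinear q).mid _ _).map_add _ _
    simp only [covDerivAux, e]
    rw [cov_add nabla hY hY', mvfderiv_add (hS.diff hX hY hZ) (hS.diff hX hY' hZ), (h1 _ _).map_add,
      show (Y + Y') p = Y p + Y' p from rfl, (h1 _ _).map_add, (h1 _ _).map_add, _root_.add_apply]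
    ring

lemma tensorialAt_covDerivAux₃ (hS : IsDiffTensor S) {X Y : VField M} (hX : DiffAt X p)
    (hY : DiffAt Y p) : TensorialAt (𝓡 8) E8 (fun Z => covDerivAux nabla S p x X Y Z) p where
  smul {f Z} hf hZ := by
    have h1 := (hS.trilinear p).right
    have e : (fun q => S q (X q) (Y q) ((f • Z) q)) = fun q => f q * S q (X q) (Y q) (Z q) :=
      funext fun q => ((hS.trilinear q).right _ _).map_smul _ _
    simp only [covDerivAux, e]
    rw [cov_smul nabla hf hZ, mvfderiv_mul_apply hf (hS.diff hX hY hZ), (h1 _ _).map_add,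
      (h1 _ _).map_smul, (h1 _ _).map_smul, show (f • Z) p = f p • Z p from rfl,
      (h1 _ _).map_smul, (h1 _ _).map_smul]
    simp only [smul_eq_mul]
    ring
  add {Z Z'} hZ hZ' := by
    have h1 := (hS.trilinear p).right
    have e : (fun q => S q (X q) (Y q) ((Z + Z') q))
        = (fun q => S q (X q) (Y q) (Z q)) + fun q => S q (X q) (Y q) (Z' q) :=
      funext fun q => ((hS.trilinear q).right _ _).map_add _ _
    simp only [covDerivAux, e]
    rw [cov_add nabla hZ hZ', mvfderiv_add (hS.diff hX hY hZ) (hS.diff hX hY hZ'), (h1 _ _).map_add,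
      show (Z + Z') p = Z p + Z' p from rfl, (h1 _ _).map_add, (h1 _ _).map_add, _root_.add_apply]
    ring

lemma diffAt_extend (v : TangentSpace (𝓡 8) p) : DiffAt (FiberBundle.extend E8 v) p :=
  (smoothNear_extend v).diffAt

/-- `(∇_x S)(X, Y, Z)` only depends on the values of the fields `X`, `Y`, `Z` at the point. -/
lemma covDerivAux_eq (hS : IsDiffTensor S) {X Y Z : VField M} (hX : DiffAt X p) (hY : DiffAt Y p)
    (hZ : DiffAt Z p) :
    covDerivAux nabla S p x X Y Z = covDeriv nabla S p x (X p) (Y p) (Z p) := by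
  have hX' := diffAt_extend (X p)
  have hY' := diffAt_extend (Y p)
  have hZ' := diffAt_extend (Z p)
  rw [covDeriv, (tensorialAt_covDerivAux₁ hS hY hZ).pointwise hX hX' (by simp),
    (tensorialAt_covDerivAux₂ hS hX' hZ).pointwise hY hY' (by simp),
    (tensorialAt_covDerivAux₃ hS hX' hY').pointwise hZ hZ' (by simp)]

lemma mvfderiv_tensor (nabla : Connection M) (hS : IsDiffTensor S) {X Y Z : VField M}
    (hX : DiffAt X p) (hY : DiffAt Y p) (hZ : DiffAt Z p) (x : TangentSpace (𝓡 8) p) :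
    mvfderiv (𝓡 8) (fun q => S q (X q) (Y q) (Z q)) p x
      = covDeriv nabla S p x (X p) (Y p) (Z p) + (S p (nabla X p x) (Y p) (Z p)
        + S p (X p) (nabla Y p x) (Z p) + S p (X p) (Y p) (nabla Z p x)) := by
  rw [← covDerivAux_eq hS hX hY hZ, covDerivAux]
  ring

lemma isTrilinear_covDeriv (nabla : Connection M) (hS : IsDiffTensor S) (p : M)
    (x : TangentSpace (𝓡 8) p) : IsTrilinear (covDeriv nabla S p x) where
  left v w := (TensorialAt.mkHom _ p (tensorialAt_covDerivAux₁ (nabla := nabla) (x := x) hS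
    (diffAt_extend v) (diffAt_extend w))).toLinearMap.isLinear
  mid u w := (TensorialAt.mkHom _ p (tensorialAt_covDerivAux₂ (nabla := nabla) (x := x) hS
    (diffAt_extend u) (diffAt_extend w))).toLinearMap.isLinear
  right u v := (TensorialAt.mkHom _ p (tensorialAt_covDerivAux₃ (nabla := nabla) (x := x) hS
    (diffAt_extend u) (diffAt_extend v))).toLinearMap.isLinear

lemma isLinearMap_covDeriv (nabla : Connection M) (hS : IsDiffTensor S) (p : M)
    (u v w : TangentSpace (𝓡 8) p) : IsLinearMap ℝ fun x => covDeriv nabla S p x u v w where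
  map_add x y := by
    have h := hS.trilinear p
    simp only [covDeriv, covDerivAux, map_add, (h.left _ _).map_add, (h.mid _ _).map_add,
      (h.right _ _).map_add]
    ring
  map_smul c x := by
    have h := hS.trilinear p
    simp only [covDeriv, covDerivAux, map_smul, (h.left _ _).map_smul, (h.mid _ _).map_smul,
      (h.right _ _).map_smul, smul_eq_mul]
    ring

lemma covDeriv_skew₁₂ (hS : IsDiffTensor S) (h : ∀ p u v w, S p u v w = - S p v u w)
    (u v w : TangentSpace (𝓡 8) p) :
    covDeriv nabla S p x u v w = - covDeriv nabla S p x v u w := by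
  have h0 := mvfderiv_tensor nabla hS (diffAt_extend u) (diffAt_extend v) (diffAt_extend w) x
  have h1 := mvfderiv_tensor nabla hS (diffAt_extend v) (diffAt_extend u) (diffAt_extend w) x
  have e : (fun q => S q (FiberBundle.extend E8 u q) (FiberBundle.extend E8 v q)
      (FiberBundle.extend E8 w q)) = - fun q => S q (FiberBundle.extend E8 v q)
      (FiberBundle.extend E8 u q) (FiberBundle.extend E8 w q) := funext fun q => h q _ _ _
  rw [e, mvfderiv_neg, _root_.neg_apply, h1] at h0
  simp only [FiberBundle.extend_apply_self] at h0
  linarith [h p (nabla (FiberBundle.extend E8 u) p x) v w,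
    h p u (nabla (FiberBundle.extend E8 v) p x) w, h p u v (nabla (FiberBundle.extend E8 w) p x)]

lemma covDeriv_skew₂₃ (hS : IsDiffTensor S) (h : ∀ p u v w, S p u v w = - S p u w v)
    (u v w : TangentSpace (𝓡 8) p) :
    covDeriv nabla S p x u v w = - covDeriv nabla S p x u w v := by
  have h0 := mvfderiv_tensor nabla hS (diffAt_extend u) (diffAt_extend v) (diffAt_extend w) x
  have h1 := mvfderiv_tensor nabla hS (diffAt_extend u) (diffAt_extend w) (diffAt_extend v) x
  have e : (fun q => S q (FiberBundle.extend E8 u q) (FiberBundle.extend E8 v q)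
      (FiberBundle.extend E8 w q)) = - fun q => S q (FiberBundle.extend E8 u q)
      (FiberBundle.extend E8 w q) (FiberBundle.extend E8 v q) := funext fun q => h q _ _ _
  rw [e, mvfderiv_neg, _root_.neg_apply, h1] at h0
  simp only [FiberBundle.extend_apply_self] at h0
  linarith [h p (nabla (FiberBundle.extend E8 u) p x) v w,
    h p u (nabla (FiberBundle.extend E8 v) p x) w, h p u v (nabla (FiberBundle.extend E8 w) p x)]

end

end SU3Dim8

/-! ### Torsion and the first Bianchi identity -/

namespace SU3Dim8

open Filter Topology

variable {M : Type*} [TopologicalSpace M] [ChartedSpace E8 M] [IsManifold (𝓡 8) ∞ M]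
  [RiemannianBundle (fun p : M => TangentSpace (𝓡 8) p)]
  [IsContMDiffRiemannianBundle (𝓡 8) ∞ E8 (fun p : M => TangentSpace (𝓡 8) p)]

lemma DiffAt.inner {X Y : VField M} {p : M} (hX : DiffAt X p) (hY : DiffAt Y p) :
    FDiffAt (fun q => inner ℝ (X q) (Y q)) p :=
  MDifferentiableAt.inner_bundle (F := E8) (IB := 𝓡 8) (E := fun p : M => TangentSpace (𝓡 8) p)
    (b := id) (v := X) (w := Y) hX hY

lemma mvfderiv_inner {nabla : Connection M} (h : nabla.IsMetricCompatible) {X Y : VField M} {p : M}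
    (hX : DiffAt X p) (hY : DiffAt Y p) (v : TangentSpace (𝓡 8) p) :
    mvfderiv (𝓡 8) (fun q => inner ℝ (X q) (Y q)) p v
      = inner ℝ (nabla X p v) (Y p) + inner ℝ (X p) (nabla Y p v) := by
  have := h.mvfderiv_inner_eq (FiberBundle.extend E8 v) hX hY
  simpa using this

omit [RiemannianBundle (fun p : M => TangentSpace (𝓡 8) p)]
  [IsContMDiffRiemannianBundle (𝓡 8) ∞ E8 (fun p : M => TangentSpace (𝓡 8) p)] in
lemma torsion_eventually (nabla : Connection M) {X Y : VField M} {p : M} (hX : SmoothNear X p)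
    (hY : SmoothNear Y p) : ∀ᶠ q in 𝓝 p, nabla.torsion q (X q) (Y q)
      = nabla Y q (X q) - nabla X q (Y q) - VectorField.mlieBracket (𝓡 8) X Y q := by
  filter_upwards [hX.eventually, hY.eventually] with q hXq hYq
  exact nabla.torsion_apply hXq.diffAt hYq.diffAt

omit [RiemannianBundle (fun p : M => TangentSpace (𝓡 8) p)]
  [IsContMDiffRiemannianBundle (𝓡 8) ∞ E8 (fun p : M => TangentSpace (𝓡 8) p)] in
lemma SmoothNear.torsion [T2Space M] {nabla : Connection M}
    (h : nabla.ContMDiffCovariantDerivative ∞) {X Y : VField M} {p : M} (hX : SmoothNear X p)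
    (hY : SmoothNear Y p) : SmoothNear (fun q => nabla.torsion q (X q) (Y q)) p :=
  (((hX.cov h hY).sub (hY.cov h hX)).sub (hX.mlieBracket hY)).congr (torsion_eventually nabla hX hY)

omit [IsContMDiffRiemannianBundle (𝓡 8) ∞ E8 (fun p : M => TangentSpace (𝓡 8) p)] in
lemma isTrilinear_torsion3 (nabla : Connection M) (p : M) : IsTrilinear (torsion3 nabla p) where
  left v w := ⟨fun x y => by rw [torsion3, map_add, _root_.add_apply, inner_add_left]; rfl,
    fun c x => by rw [torsion3, map_smul, _root_.smul_apply, real_inner_smul_left]; rfl⟩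
  mid u w := ⟨fun x y => by rw [torsion3, map_add, inner_add_left]; rfl,
    fun c x => by rw [torsion3, map_smul, real_inner_smul_left]; rfl⟩
  right u v := ⟨fun x y => by rw [torsion3, inner_add_right]; rfl,
    fun c x => by rw [torsion3, real_inner_smul_right]; rfl⟩

omit [IsContMDiffRiemannianBundle (𝓡 8) ∞ E8 (fun p : M => TangentSpace (𝓡 8) p)] in
lemma torsion3_skew (nabla : Connection M) (p : M) (u v w : TangentSpace (𝓡 8) p) :
    torsion3 nabla p u v w = - torsion3 nabla p v u w := by
  rw [torsion3, nabla.torsion_antisymm, inner_neg_left]; rfl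

/-- The manifold has an orthonormal frame around every point. -/
def HasFrames (M : Type*) [TopologicalSpace M] [ChartedSpace E8 M] [IsManifold (𝓡 8) ∞ M]
    [RiemannianBundle (fun p : M => TangentSpace (𝓡 8) p)] : Prop :=
  ∀ p : M, ∃ (U : Set M) (e : Fin 8 → VField M), p ∈ U ∧ IsOrthonormalFrame e U

lemma isDiffTensor_torsion3 [T2Space M] (hM : HasFrames M) {nabla : Connection M}
    (h : nabla.ContMDiffCovariantDerivative ∞) : IsDiffTensor (torsion3 nabla) where
  trilinear := isTrilinear_torsion3 nabla
  diff {p X Y Z} hX hY hZ := by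
    obtain ⟨U, e, hpU, hU, hes, heo⟩ := hM p
    have he := fun i => (hes i).smoothNear hU hpU
    have h1 : FDiffAt (fun q => ∑ i, ∑ j, ∑ k, inner ℝ (e i q) (X q) * inner ℝ (e j q) (Y q)
        * inner ℝ (e k q) (Z q) * torsion3 nabla q (e i q) (e j q) (e k q)) p := by
      refine fdiffAt_sum fun i => fdiffAt_sum fun j => fdiffAt_sum fun k => ?_
      exact ((((he i).diffAt.inner hX).mul ((he j).diffAt.inner hY)).mul
        ((he k).diffAt.inner hZ)).mul (((he i).torsion h (he j)).diffAt.inner (he k).diffAt)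
    refine h1.congr_of_eventuallyEq ?_
    filter_upwards [hU.mem_nhds hpU] with q hq
    have ho := heo q hq
    conv_lhs => rw [← sum_inner_smul_frame ho (X q), ← sum_inner_smul_frame ho (Y q),
      ← sum_inner_smul_frame ho (Z q)]
    rw [(isTrilinear_torsion3 nabla q).sum]

omit [RiemannianBundle (fun p : M => TangentSpace (𝓡 8) p)]
  [IsContMDiffRiemannianBundle (𝓡 8) ∞ E8 (fun p : M => TangentSpace (𝓡 8) p)] in
lemma jacobi {X Y Z : VField M} {p : M} (hX : SmoothNear X p) (hY : SmoothNear Y p)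
    (hZ : SmoothNear Z p) :
    VectorField.mlieBracket (𝓡 8) X (VectorField.mlieBracket (𝓡 8) Y Z) p
      = VectorField.mlieBracket (𝓡 8) (VectorField.mlieBracket (𝓡 8) X Y) Z p
        + VectorField.mlieBracket (𝓡 8) Y (VectorField.mlieBracket (𝓡 8) X Z) p := by
  have : IsManifold (𝓡 8) (minSmoothness ℝ 3) M := by
    simpa using IsManifold.of_le (I := 𝓡 8) (M := M) (m := 3) (n := ∞)
      (WithTop.coe_le_coe.mpr (le_top : (3 : ℕ∞) ≤ ⊤))
  have h : ∀ {X : VField M}, SmoothNear X p → ContMDiffAt (𝓡 8) (𝓡 8).tangent (minSmoothness ℝ 2)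
      (fun q => (⟨q, X q⟩ : TangentBundle (𝓡 8) M)) p := by
    rintro X ⟨U, hU, hp, hX⟩
    simpa using (ContMDiffOn.contMDiffAt hX (hU.mem_nhds hp)).of_le
      (WithTop.coe_le_coe.mpr (le_top : (2 : ℕ∞) ≤ ⊤))
  exact VectorField.leibniz_identity_mlieBracket_apply (h hX) (h hY) (h hZ)

/-- The first Bianchi identity for a metric connection whose torsion `T` is a 3-form:
the cyclic sum of `R(X, Y)Z` is that of `(∇_X T)(Y, Z) + T(T(X, Y), Z)`. -/
lemma sum_inner_curvature [T2Space M] (hM : HasFrames M) {nabla : Connection M}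
    (h : nabla.ContMDiffCovariantDerivative ∞) (hmet : nabla.IsMetricCompatible)
    {X Y Z : VField M} {p : M} (hX : SmoothNear X p) (hY : SmoothNear Y p) (hZ : SmoothNear Z p)
    (w : TangentSpace (𝓡 8) p) :
    inner ℝ (curvature nabla X Y Z p) w + inner ℝ (curvature nabla Y Z X p) w
        + inner ℝ (curvature nabla Z X Y p) w
      = covDeriv nabla (torsion3 nabla) p (X p) (Y p) (Z p) w
        + covDeriv nabla (torsion3 nabla) p (Y p) (Z p) (X p) w
        + covDeriv nabla (torsion3 nabla) p (Z p) (X p) (Y p) w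
        + (torsion3 nabla p (nabla.torsion p (X p) (Y p)) (Z p) w
          + torsion3 nabla p (nabla.torsion p (Y p) (Z p)) (X p) w
          + torsion3 nabla p (nabla.torsion p (Z p) (X p)) (Y p) w) := by
  have hS := isDiffTensor_torsion3 hM h
  set W : VField M := FiberBundle.extend E8 w with hW
  have hWd : DiffAt W p := diffAt_extend w
  have hWp : W p = w := by simp [hW]
  -- covariant derivative of `T(Y, Z)`, expanded in two ways
  have key : ∀ {X Y Z : VField M}, SmoothNear X p → SmoothNear Y p → SmoothNear Z p →
      inner ℝ (nabla (fun q => nabla Z q (Y q)) p (X p)) w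
        - inner ℝ (nabla (fun q => nabla Y q (Z q)) p (X p)) w
        - inner ℝ (nabla (VectorField.mlieBracket (𝓡 8) Y Z) p (X p)) w
      = covDeriv nabla (torsion3 nabla) p (X p) (Y p) (Z p) w
        + torsion3 nabla p (nabla Y p (X p)) (Z p) w
        + torsion3 nabla p (Y p) (nabla Z p (X p)) w := by
    intro X Y Z hX hY hZ
    have hT := (hY.torsion h hZ).diffAt
    have h1 := mvfderiv_tensor nabla hS hY.diffAt hZ.diffAt hWd (X p)
    have h2 := mvfderiv_inner hmet hT hWd (X p)
    have h3 : nabla (fun q => nabla.torsion q (Y q) (Z q)) p (X p)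
        = nabla (fun q => nabla Z q (Y q)) p (X p) - nabla (fun q => nabla Y q (Z q)) p (X p)
          - nabla (VectorField.mlieBracket (𝓡 8) Y Z) p (X p) := by
      rw [← cov_sub nabla (hY.cov h hZ).diffAt (hZ.cov h hY).diffAt,
        ← cov_sub nabla ((hY.cov h hZ).sub (hZ.cov h hY)).diffAt (hY.mlieBracket hZ).diffAt,
        cov_congr nabla (((hY.cov h hZ).sub (hZ.cov h hY)).sub (hY.mlieBracket hZ)).diffAt
          (torsion_eventually nabla hY hZ)]
    rw [h3, inner_sub_left, inner_sub_left, hWp] at h2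
    rw [hWp] at h1
    simp only [torsion3] at h1 ⊢
    rw [h1] at h2
    linarith
  -- torsion of a field and a bracket
  have key2 : ∀ {X Y Z : VField M}, SmoothNear X p → SmoothNear Y p → SmoothNear Z p →
      inner ℝ (nabla (VectorField.mlieBracket (𝓡 8) Y Z) p (X p)) w
        - inner ℝ (nabla X p (VectorField.mlieBracket (𝓡 8) Y Z p)) w
      = torsion3 nabla p (X p) (nabla Z p (Y p)) w - torsion3 nabla p (X p) (nabla Y p (Z p)) w
        - torsion3 nabla p (X p) (nabla.torsion p (Y p) (Z p)) w
        + inner ℝ (VectorField.mlieBracket (𝓡 8) X (VectorField.mlieBracket (𝓡 8) Y Z) p) w := by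
    intro X Y Z hX hY hZ
    have h1 := nabla.torsion_apply hX.diffAt (hY.mlieBracket hZ).diffAt
    have h2 := nabla.torsion_apply hY.diffAt hZ.diffAt
    have h3 : VectorField.mlieBracket (𝓡 8) Y Z p
        = nabla Z p (Y p) - nabla Y p (Z p) - nabla.torsion p (Y p) (Z p) := by
      rw [h2]; abel
    have h4 : torsion3 nabla p (X p) (VectorField.mlieBracket (𝓡 8) Y Z p) w
        = torsion3 nabla p (X p) (nabla Z p (Y p)) w - torsion3 nabla p (X p) (nabla Y p (Z p)) w
          - torsion3 nabla p (X p) (nabla.torsion p (Y p) (Z p)) w := by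
      have hm := (isTrilinear_torsion3 nabla p).mid (X p) w
      rw [h3, hm.map_sub, hm.map_sub]
    rw [← h4, torsion3, h1, inner_sub_left, inner_sub_left]
    ring
  have jac : VectorField.mlieBracket (𝓡 8) X (VectorField.mlieBracket (𝓡 8) Y Z) p
      + VectorField.mlieBracket (𝓡 8) Y (VectorField.mlieBracket (𝓡 8) Z X) p
      + VectorField.mlieBracket (𝓡 8) Z (VectorField.mlieBracket (𝓡 8) X Y) p = 0 := by
    have h1 := jacobi hX hY hZ
    rw [VectorField.mlieBracket_swap_apply (V := VectorField.mlieBracket (𝓡 8) X Y),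
      VectorField.mlieBracket_swap (V := X) (W := Z),
      show -VectorField.mlieBracket (𝓡 8) Z X = (-1 : ℝ) • VectorField.mlieBracket (𝓡 8) Z X by
        funext q; simp, VectorField.mlieBracket_const_smul_right (hZ.mlieBracket hX).diffAt] at h1
    rw [h1]
    simp
  have jac' := congrArg (fun v => inner ℝ v w) jac
  simp only [inner_add_left, inner_zero_left] at jac'
  have k1 := key hX hY hZ
  have k2 := key hY hZ hX
  have k3 := key hZ hX hY
  have l1 := key2 hX hY hZ
  have l2 := key2 hY hZ hX
  have l3 := key2 hZ hX hY
  have s := torsion3_skew nabla p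
  simp only [curvature, inner_sub_left]
  rw [s (X p) (nabla.torsion p (Y p) (Z p)) w] at l1
  rw [s (Y p) (nabla.torsion p (Z p) (X p)) w] at l2
  rw [s (Z p) (nabla.torsion p (X p) (Y p)) w] at l3
  rw [s (nabla Y p (X p)) (Z p) w] at k1
  rw [s (nabla Z p (Y p)) (X p) w] at k2
  rw [s (nabla X p (Z p)) (Y p) w] at k3
  linarith

omit [RiemannianBundle (fun p : M => TangentSpace (𝓡 8) p)]
  [IsContMDiffRiemannianBundle (𝓡 8) ∞ E8 (fun p : M => TangentSpace (𝓡 8) p)] in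
/-- The commutator of two directional derivatives is the derivative along the Lie bracket. This
follows from the Jacobi identity for `X`, `Y` and `f Z`, where `Z` does not vanish. -/
lemma mvfderiv_mlieBracket {X Y : VField M} {f : M → ℝ} {p : M} {U : Set M} (hU : IsOpen U)
    (hpU : p ∈ U) (hX : SmoothNear X p)
    (hY : SmoothNear Y p) (hf : ContMDiffOn (𝓡 8) 𝓘(ℝ) ∞ f U)
    (hXf : FDiffAt (fun q => mvfderiv (𝓡 8) f q (X q)) p)
    (hYf : FDiffAt (fun q => mvfderiv (𝓡 8) f q (Y q)) p) :
    mvfderiv (𝓡 8) f p (VectorField.mlieBracket (𝓡 8) X Y p)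
      = mvfderiv (𝓡 8) (fun q => mvfderiv (𝓡 8) f q (Y q)) p (X p)
        - mvfderiv (𝓡 8) (fun q => mvfderiv (𝓡 8) f q (X q)) p (Y p) := by
  obtain ⟨w, hw⟩ : ∃ w : TangentSpace (𝓡 8) p, w ≠ 0 := exists_ne (0 : E8)
  set Z : VField M := FiberBundle.extend E8 w with hZdef
  have hZ : SmoothNear Z p := smoothNear_extend w
  have hZp : Z p = w := by simp [hZdef]
  have hfd : ∀ q ∈ U, FDiffAt f q := fun q hq =>
    (hf.contMDiffAt (hU.mem_nhds hq)).mdifferentiableAt (by simp)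
  have hfZ : SmoothNear (f • Z) p := by
    obtain ⟨V, hV, hpV, hZ⟩ := hZ
    exact ⟨U ∩ V, hU.inter hV, ⟨hpU, hpV⟩,
      (hf.mono inter_subset_left).smul_section (hZ.mono inter_subset_right)⟩
  -- the double bracket of two fields with `f Z`
  have key : ∀ {X Y : VField M}, SmoothNear X p → SmoothNear Y p →
      FDiffAt (fun q => mvfderiv (𝓡 8) f q (Y q)) p →
      VectorField.mlieBracket (𝓡 8) X (VectorField.mlieBracket (𝓡 8) Y (f • Z)) p
        = mvfderiv (𝓡 8) (fun q => mvfderiv (𝓡 8) f q (Y q)) p (X p) • w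
          + mvfderiv (𝓡 8) f p (Y p) • VectorField.mlieBracket (𝓡 8) X Z p
          + (mvfderiv (𝓡 8) f p (X p) • VectorField.mlieBracket (𝓡 8) Y Z p
          + f p • VectorField.mlieBracket (𝓡 8) X (VectorField.mlieBracket (𝓡 8) Y Z) p) := by
    intro X Y hX hY hYf
    have e : VectorField.mlieBracket (𝓡 8) Y (f • Z) =ᶠ[𝓝 p]
        (fun q => mvfderiv (𝓡 8) f q (Y q)) • Z + f • VectorField.mlieBracket (𝓡 8) Y Z := by
      filter_upwards [hU.mem_nhds hpU, hZ.eventually] with q hq hZq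
      exact VectorField.mlieBracket_smul_right (hfd q hq) hZq.diffAt
    rw [Filter.EventuallyEq.mlieBracket_vectorField_eq (Filter.EventuallyEq.refl _ X) e,
      VectorField.mlieBracket_add_right (hZ.diffAt.smul hYf)
        ((hY.mlieBracket hZ).diffAt.smul (hfd p hpU)),
      VectorField.mlieBracket_smul_right hYf hZ.diffAt,
      VectorField.mlieBracket_smul_right (hfd p hpU) (hY.mlieBracket hZ).diffAt, hZp]
  have h1 := jacobi hX hY hfZ
  have h2 := jacobi hX hY hZ
  rw [key hX hY hYf, key hY hX hXf, VectorField.mlieBracket_smul_right (hfd p hpU) hZ.diffAt, h2,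
    hZp] at h1
  have h3 : (mvfderiv (𝓡 8) (fun q => mvfderiv (𝓡 8) f q (Y q)) p (X p)
      - mvfderiv (𝓡 8) (fun q => mvfderiv (𝓡 8) f q (X q)) p (Y p)
      - mvfderiv (𝓡 8) f p (VectorField.mlieBracket (𝓡 8) X Y p)) • w = 0 := by
    rw [sub_smul, sub_smul]
    rw [← sub_eq_zero] at h1
    rw [← h1]
    module
  have h4 := (smul_eq_zero.mp h3).resolve_right hw
  linarith

end SU3Dim8

/-! ### Connection and curvature matrices -/

namespace SU3Dim8

open Filter Topology

lemma InStabilizer.neg {d : Fin 8 → Fin 8 → Fin 8 → ℝ} {G : Matrix (Fin 8) (Fin 8) ℝ}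
    (hG : InStabilizer d G) : InStabilizer d (-G) := by
  have h := (hG.sub hG).sub hG
  simpa using h

lemma isLinearMap_actTensor (d : Fin 8 → Fin 8 → Fin 8 → ℝ) (i j k : Fin 8) :
    IsLinearMap ℝ fun G : Fin 8 × Fin 8 → ℝ =>
      actTensor (Matrix.of fun a b => G (a, b)) d i j k where
  map_add G H := by
    simp only [actTensor, ← Finset.sum_add_distrib, Matrix.of_apply, Pi.add_apply]
    exact Finset.sum_congr rfl fun _ _ => by ring
  map_smul c G := by
    simp only [actTensor, smul_eq_mul, Finset.mul_sum, Matrix.of_apply, Pi.smul_apply]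
    exact Finset.sum_congr rfl fun _ _ => by ring

lemma isLinearMap_skewOp (d : Fin 8 → Fin 8 → Fin 8 → ℝ) (i j k : Fin 8) :
    IsLinearMap ℝ fun t : Fin 8 × Fin 8 × Fin 8 → ℝ =>
      skewOp d (fun a b c => t (a, b, c)) i j k where
  map_add s t := by
    have e : ∀ x, sliceMatrix (fun a b c => (s + t) (a, b, c)) x
      = sliceMatrix (fun a b c => s (a, b, c)) x + sliceMatrix (fun a b c => t (a, b, c)) x :=
      fun _ => rfl
    simp only [skewOp, e, add_mul, Matrix.trace_add]
    ring
  map_smul c t := by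
    have e : ∀ x, sliceMatrix (fun a b d => (c • t) (a, b, d)) x
      = c • sliceMatrix (fun a b c => t (a, b, c)) x := fun _ => rfl
    simp only [skewOp, e, Matrix.smul_mul, Matrix.trace_smul, smul_eq_mul]
    ring

lemma IsVectorial.sub {d s t : Fin 8 → Fin 8 → Fin 8 → ℝ} (hs : IsVectorial d s)
    (ht : IsVectorial d t) : IsVectorial d fun i j k => s i j k - t i j k := by
  intro i j k
  have h := (isLinearMap_skewOp d i j k).map_sub (fun x => s x.1 x.2.1 x.2.2)
    (fun x => t x.1 x.2.1 x.2.2)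
  simp only [Pi.sub_apply] at h
  rw [h, hs, ht]; ring

variable {M : Type*} [TopologicalSpace M] [ChartedSpace E8 M]

/-- Derivatives of families of matrices in the stabilizer lie in the stabilizer. -/
lemma InStabilizer.mvfderiv {d : Fin 8 → Fin 8 → Fin 8 → ℝ} {p : M}
    {F : M → Matrix (Fin 8) (Fin 8) ℝ} (hF : ∀ i j, FDiffAt (fun q => F q i j) p)
    (h : ∀ᶠ q in 𝓝 p, InStabilizer d (F q)) (x : TangentSpace (𝓡 8) p) :
    InStabilizer d (Matrix.of fun i j => mvfderiv (𝓡 8) (fun q => F q i j) p x) := by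
  constructor
  · ext i j
    simp only [Matrix.transpose_apply, Matrix.of_apply, Matrix.neg_apply]
    rw [mvfderiv_congr (g := -fun q => F q i j) (h.mono fun q hq => hq.skew j i), mvfderiv_neg]
    rfl
  · intro i j k
    have h1 := mvfderiv_linear ((isLinearMap_actTensor d i j k).mk' _)
      (f := fun x : Fin 8 × Fin 8 => fun q => F q x.1 x.2) (fun x => hF x.1 x.2) x
    simp only [IsLinearMap.mk'_apply] at h1
    refine h1.symm.trans ?_
    exact (mvfderiv_congr (g := fun _ => (0 : ℝ)) (h.mono fun q hq => hq.2 i j k) x).trans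
      (by rw [mvfderiv_const]; rfl)

/-- Derivatives of families of 3-forms of vectorial type are of vectorial type. -/
lemma IsVectorial.mvfderiv {d : Fin 8 → Fin 8 → Fin 8 → ℝ} {p : M}
    {t : M → Fin 8 → Fin 8 → Fin 8 → ℝ} (ht : ∀ i j k, FDiffAt (fun q => t q i j k) p)
    (h : ∀ᶠ q in 𝓝 p, IsVectorial d (t q)) (x : TangentSpace (𝓡 8) p) :
    IsVectorial d fun i j k => mvfderiv (𝓡 8) (fun q => t q i j k) p x := by
  intro i j k
  have h1 := mvfderiv_linear ((isLinearMap_skewOp d i j k).mk' _)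
    (f := fun x : Fin 8 × Fin 8 × Fin 8 => fun q => t q x.1 x.2.1 x.2.2)
    (fun x => ht x.1 x.2.1 x.2.2) x
  simp only [IsLinearMap.mk'_apply] at h1
  rw [mvfderiv_congr (g := fun q => 3 * t q i j k) (h.mono fun q hq => hq i j k),
    mvfderiv_mul_apply mdifferentiableAt_const (ht i j k), mvfderiv_const] at h1
  rw [_root_.zero_apply, mul_zero, add_zero] at h1
  exact h1.symm

variable [IsManifold (𝓡 8) ∞ M]
  [RiemannianBundle (fun p : M => TangentSpace (𝓡 8) p)]

/-- The connection matrix `g(e_i, ∇_x e_j)` of a connection in the frame `e`. -/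
noncomputable def connMatrix (nabla : Connection M) (e : Fin 8 → VField M) (q : M)
    (x : TangentSpace (𝓡 8) q) : Matrix (Fin 8) (Fin 8) ℝ :=
  Matrix.of fun i j => inner ℝ (e i q) (nabla (e j) q x)

lemma sum_connMatrix_smul (nabla : Connection M) {e : Fin 8 → VField M} {U : Set M}
    (he : IsOrthonormalFrame e U) {q : M} (hq : q ∈ U) (x : TangentSpace (𝓡 8) q) (j : Fin 8) :
    ∑ i, connMatrix nabla e q x i j • e i q = nabla (e j) q x :=
  sum_inner_smul_frame (he.2.2 q hq) _

variable [IsContMDiffRiemannianBundle (𝓡 8) ∞ E8 (fun p : M => TangentSpace (𝓡 8) p)]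

lemma connMatrix_skew {nabla : Connection M} (hmet : nabla.IsMetricCompatible)
    {e : Fin 8 → VField M} {U : Set M} (he : IsOrthonormalFrame e U) {q : M} (hq : q ∈ U)
    (x : TangentSpace (𝓡 8) q) (i j : Fin 8) :
    connMatrix nabla e q x i j = - connMatrix nabla e q x j i := by
  have hd := fun i => ((he.2.1 i).smoothNear he.1 hq).diffAt
  have h1 := mvfderiv_inner hmet (hd i) (hd j) x
  rw [mvfderiv_congr (g := fun _ => (1 : Matrix (Fin 8) (Fin 8) ℝ) i j)
    (by filter_upwards [he.1.mem_nhds hq] with r hr using inner_frame (he.2.2 r hr) i j),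
    mvfderiv_const, _root_.zero_apply, real_inner_comm] at h1
  simp only [connMatrix, Matrix.of_apply]
  linarith

/-- In a frame in which `Υ` has constant components, `∇g = 0` and `∇Υ = 0` say that the connection
matrix lies in the stabilizer of `Υ`. -/
lemma inStabilizer_connMatrix {Υ : Tensor3 M} {nabla : Connection M}
    (hmet : nabla.IsMetricCompatible) (hΥ : Preserves nabla Υ) {e : Fin 8 → VField M} {U : Set M}
    (he : IsOrthonormalFrame e U) {d : Fin 8 → Fin 8 → Fin 8 → ℝ}
    (hd : ∀ q ∈ U, comp Υ (fun i => e i q) = d) {q : M} (hq : q ∈ U)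
    (x : TangentSpace (𝓡 8) q) : InStabilizer d (connMatrix nabla e q x) := by
  constructor
  · ext i j
    exact connMatrix_skew hmet he hq x j i
  · intro i j k
    have h1 := hΥ q U (e i) (e j) (e k) he.1 hq (he.2.1 i) (he.2.1 j) (he.2.1 k) x
    rw [mvfderiv_congr (g := fun _ => d i j k) (by
      filter_upwards [he.1.mem_nhds hq] with r hr
      rw [← hd r hr]; rfl), mvfderiv_const, _root_.zero_apply] at h1
    have hT := Υ.isTrilinear q
    have e1 : ∀ u v, Υ q (nabla (e i) q x) u v
        = ∑ m, connMatrix nabla e q x m i * Υ q (e m q) u v := fun u v => by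
      rw [← sum_connMatrix_smul nabla he hq]
      have := map_sum ((hT.left u v).mk' _) (fun m => connMatrix nabla e q x m i • e m q)
          Finset.univ
      simpa only [map_smul, IsLinearMap.mk'_apply, smul_eq_mul] using this
    have e2 : ∀ u v, Υ q u (nabla (e j) q x) v
        = ∑ m, connMatrix nabla e q x m j * Υ q u (e m q) v := fun u v => by
      rw [← sum_connMatrix_smul nabla he hq]
      have := map_sum ((hT.mid u v).mk' _) (fun m => connMatrix nabla e q x m j • e m q) Finset.univ
      simpa only [map_smul, IsLinearMap.mk'_apply, smul_eq_mul] using this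
    have e3 : ∀ u v, Υ q u v (nabla (e k) q x)
        = ∑ m, connMatrix nabla e q x m k * Υ q u v (e m q) := fun u v => by
      rw [← sum_connMatrix_smul nabla he hq]
      have := map_sum ((hT.right u v).mk' _) (fun m => connMatrix nabla e q x m k • e m q)
        Finset.univ
      simpa only [map_smul, IsLinearMap.mk'_apply, smul_eq_mul] using this
    rw [e1, e2, e3, ← Finset.sum_add_distrib, ← Finset.sum_add_distrib] at h1
    rw [← hd q hq]
    exact h1.symm

/-- The structure equation for the curvature in an orthonormal frame, without its precise form: the
curvature matrix lies in the stabilizer of `Υ`. -/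
lemma inStabilizer_curvature [T2Space M] {Υ : Tensor3 M} {nabla : Connection M}
    (hsm : nabla.ContMDiffCovariantDerivative ∞)
    (hmet : nabla.IsMetricCompatible) (hΥ : Preserves nabla Υ) {e : Fin 8 → VField M} {U : Set M}
    (he : IsOrthonormalFrame e U) {d : Fin 8 → Fin 8 → Fin 8 → ℝ}
    (hd : ∀ q ∈ U, comp Υ (fun i => e i q) = d) {X Y : VField M} {p : M} (hp : p ∈ U)
    (hX : SmoothNear X p) (hY : SmoothNear Y p) :
    InStabilizer d
      (Matrix.of fun i j => inner ℝ (e i p) (curvature nabla X Y (e j) p)) := by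
  have hes := fun i => (he.2.1 i).smoothNear he.1 hp
  have hG : ∀ {Y : VField M}, SmoothNear Y p → ∀ i j,
      FDiffAt (fun q => connMatrix nabla e q (Y q) i j) p := fun hY i j =>
    (hes i).diffAt.inner (hY.cov hsm (hes j)).diffAt
  have hst : ∀ {Y : VField M}, SmoothNear Y p → ∀ x, InStabilizer d
      (Matrix.of fun i j => mvfderiv (𝓡 8) (fun q => connMatrix nabla e q (Y q) i j) p x) :=
    fun hY x => InStabilizer.mvfderiv (hG hY) (by
      filter_upwards [he.1.mem_nhds hp] with q hq
        using inStabilizer_connMatrix hmet hΥ he hd hq _) x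
  -- second covariant derivatives of the frame: `G(X) G(Y) + X(G(Y))`
  have key : ∀ {X Y : VField M}, SmoothNear X p → SmoothNear Y p → ∀ i j,
      inner ℝ (e i p) (nabla (fun q => nabla (e j) q (Y q)) p (X p))
        = (connMatrix nabla e p (X p) * connMatrix nabla e p (Y p)) i j
          + mvfderiv (𝓡 8) (fun q => connMatrix nabla e q (Y q) i j) p (X p) := by
    intro X Y hX hY i j
    have e1 : nabla (fun q => nabla (e j) q (Y q)) p
        = nabla (fun q => ∑ m, connMatrix nabla e q (Y q) m j • e m q) p := by
      refine cov_congr nabla (DiffAt.sum (fun m => hG hY m j) (fun m => (hes m).diffAt) _) ?_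
      filter_upwards [he.1.mem_nhds hp] with q hq
        using (sum_connMatrix_smul nabla he hq (Y q) j).symm
    rw [e1, cov_sum nabla (fun m => hG hY m j) (fun m => (hes m).diffAt), inner_sum]
    simp only [inner_add_right, real_inner_smul_right, inner_frame (he.2.2 p hp),
      Finset.sum_add_distrib, Matrix.mul_apply]
    congr 1
    · exact Finset.sum_congr rfl fun m _ => by
        rw [mul_comm]; rfl
    · simp [Matrix.one_apply]
  have e2 : (Matrix.of fun i j => inner ℝ (e i p) (curvature nabla X Y (e j) p))
      = (connMatrix nabla e p (X p) * connMatrix nabla e p (Y p)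
          - connMatrix nabla e p (Y p) * connMatrix nabla e p (X p))
        + ((Matrix.of fun i j =>
            mvfderiv (𝓡 8) (fun q => connMatrix nabla e q (Y q) i j) p (X p))
          - Matrix.of fun i j =>
            mvfderiv (𝓡 8) (fun q => connMatrix nabla e q (X q) i j) p (Y p))
        - connMatrix nabla e p (VectorField.mlieBracket (𝓡 8) X Y p) := by
    ext i j
    simp only [Matrix.of_apply, curvature, inner_sub_right, Matrix.sub_apply, Matrix.add_apply]
    rw [key hX hY, key hY hX,
      show connMatrix nabla e p (VectorField.mlieBracket (𝓡 8) X Y p) i j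
        = inner ℝ (e i p) (nabla (e j) p (VectorField.mlieBracket (𝓡 8) X Y p)) from rfl]
    ring
  rw [e2]
  have hs := fun x => inStabilizer_connMatrix hmet hΥ he hd hp x
  exact (((hs _).lie (hs _)).add ((hst hY _).sub (hst hX _))).sub (hs _)

end SU3Dim8

/-! ### The divergence of the torsion -/

namespace SU3Dim8

open Filter Topology

variable {M : Type*} [TopologicalSpace M] [ChartedSpace E8 M]
  [RiemannianBundle (fun p : M => TangentSpace (𝓡 8) p)]

/-- The trace of a bilinear form does not depend on the orthonormal basis. -/
lemma sum_bilin_frame {p : M} {F : TangentSpace (𝓡 8) p → TangentSpace (𝓡 8) p → ℝ}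
    (h₁ : ∀ y, IsLinearMap ℝ fun x => F x y) (h₂ : ∀ x, IsLinearMap ℝ fun y => F x y)
    {e e' : Fin 8 → TangentSpace (𝓡 8) p} (he : Orthonormal ℝ e) (he' : Orthonormal ℝ e') :
    ∑ i, F (e' i) (e' i) = ∑ i, F (e i) (e i) := by
  have h : ∀ i, F (e' i) (e' i)
      = ∑ j, ∑ k, inner ℝ (e' i) (e j) * inner ℝ (e' i) (e k) * F (e j) (e k) := by
    intro i
    conv_lhs => rw [← sum_inner_smul_frame he (e' i)]
    have e1 : ∀ y, F (∑ j, inner ℝ (e j) (e' i) • e j) y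
        = ∑ j, inner ℝ (e' i) (e j) * F (e j) y := fun y => by
      have := map_sum ((h₁ y).mk' _) (fun j => inner ℝ (e j) (e' i) • e j) Finset.univ
      simp only [map_smul, IsLinearMap.mk'_apply, smul_eq_mul, real_inner_comm (e' i)] at this ⊢
      exact this
    have e2 : ∀ x, F x (∑ j, inner ℝ (e j) (e' i) • e j)
        = ∑ j, inner ℝ (e' i) (e j) * F x (e j) := fun x => by
      have := map_sum ((h₂ x).mk' _) (fun j => inner ℝ (e j) (e' i) • e j) Finset.univ
      simp only [map_smul, IsLinearMap.mk'_apply, smul_eq_mul, real_inner_comm (e' i)] at this ⊢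
      exact this
    simp only [e1, e2, Finset.mul_sum, mul_assoc]
  simp only [h]
  rw [Finset.sum_comm]
  refine Finset.sum_congr rfl fun j _ => ?_
  rw [Finset.sum_comm]
  simp only [← Finset.sum_mul, sum_inner_mul_inner_frame he', inner_frame he]
  simp [Matrix.one_apply]

variable [IsManifold (𝓡 8) ∞ M]
  [IsContMDiffRiemannianBundle (𝓡 8) ∞ E8 (fun p : M => TangentSpace (𝓡 8) p)]

/-- Torsion of vectorial type, in an arbitrary orthonormal basis. -/
lemma HasVectorialTorsion.isVectorial {Υ : Tensor3 M} (hΥ : IsSU3Structure Υ)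
    {nabla : Connection M} (hn : IsCharacteristicConnection nabla Υ)
    (hT : HasVectorialTorsion nabla Υ) {p : M} {e : Fin 8 → TangentSpace (𝓡 8) p}
    (he : Orthonormal ℝ e) :
    IsVectorial (comp Υ e) fun a b c => torsion3 nabla p (e a) (e b) (e c) := by
  obtain ⟨e', he', h⟩ := hT p
  have hs : IsSkew3 fun a b c => torsion3 nabla p (e' a) (e' b) (e' c) :=
    ⟨fun _ _ _ => torsion3_skew nabla p _ _ _, fun _ _ _ => hn.skew p _ _ _⟩
  have h1 := isVectorial_of_hatUpsilon (hΥ.isSU3Tensor he'.1) (hΥ.isAdaptedTensor he') hs h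
  rw [show comp Υ e = _ from (Υ.isTrilinear p).comp_eq_rotateTensor he'.1 e,
    (isTrilinear_torsion3 nabla p).comp_eq_rotateTensor he'.1 e]
  exact h1.rotateTensor (transpose_frameMatrix_mul he'.1 he)

omit [IsContMDiffRiemannianBundle (𝓡 8) ∞ E8 (fun p : M => TangentSpace (𝓡 8) p)] in
/-- In a frame, the derivative of the components of a tensor field differs from its covariant
derivative by the action of the connection matrix. -/
lemma mvfderiv_components (nabla : Connection M)
    {S : (p : M) → TangentSpace (𝓡 8) p → TangentSpace (𝓡 8) p → TangentSpace (𝓡 8) p → ℝ}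
    (hS : IsDiffTensor S) {e : Fin 8 → VField M} {U : Set M} (he : IsOrthonormalFrame e U) {p : M}
    (hp : p ∈ U) (x : TangentSpace (𝓡 8) p) (i j k : Fin 8) :
    mvfderiv (𝓡 8) (fun q => S q (e i q) (e j q) (e k q)) p x
      = covDeriv nabla S p x (e i p) (e j p) (e k p)
        + actTensor (connMatrix nabla e p x) (fun i j k => S p (e i p) (e j p) (e k p)) i j k := by
  have hd := fun i => ((he.2.1 i).smoothNear he.1 hp).diffAt
  rw [mvfderiv_tensor nabla hS (hd i) (hd j) (hd k)]
  have hT := hS.trilinear p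
  have e1 : ∀ u v, S p (nabla (e i) p x) u v
      = ∑ m, connMatrix nabla e p x m i * S p (e m p) u v := fun u v => by
    rw [← sum_connMatrix_smul nabla he hp]
    have := map_sum ((hT.left u v).mk' _) (fun m => connMatrix nabla e p x m i • e m p) Finset.univ
    simpa only [map_smul, IsLinearMap.mk'_apply, smul_eq_mul] using this
  have e2 : ∀ u v, S p u (nabla (e j) p x) v
      = ∑ m, connMatrix nabla e p x m j * S p u (e m p) v := fun u v => by
    rw [← sum_connMatrix_smul nabla he hp]
    have := map_sum ((hT.mid u v).mk' _) (fun m => connMatrix nabla e p x m j • e m p) Finset.univ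
    simpa only [map_smul, IsLinearMap.mk'_apply, smul_eq_mul] using this
  have e3 : ∀ u v, S p u v (nabla (e k) p x)
      = ∑ m, connMatrix nabla e p x m k * S p u v (e m p) := fun u v => by
    rw [← sum_connMatrix_smul nabla he hp]
    have := map_sum ((hT.right u v).mk' _) (fun m => connMatrix nabla e p x m k • e m p)
      Finset.univ
    simpa only [map_smul, IsLinearMap.mk'_apply, smul_eq_mul] using this
  rw [e1, e2, e3, ← Finset.sum_add_distrib, ← Finset.sum_add_distrib]
  rfl

/-- The covariant derivative of a torsion of vectorial type is of vectorial type. -/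
lemma isVectorial_covDeriv [T2Space M] {Υ : Tensor3 M} (hΥ : IsSU3Structure Υ)
    {nabla : Connection M} (hn : IsCharacteristicConnection nabla Υ)
    (hT : HasVectorialTorsion nabla Υ) (hS : IsDiffTensor (torsion3 nabla))
    {e : Fin 8 → VField M} {U : Set M} (he : IsOrthonormalFrame e U)
    {d : Fin 8 → Fin 8 → Fin 8 → ℝ} (hd : ∀ q ∈ U, comp Υ (fun i => e i q) = d) {p : M}
    (hp : p ∈ U) (x : TangentSpace (𝓡 8) p) :
    IsVectorial d fun i j k => covDeriv nabla (torsion3 nabla) p x (e i p) (e j p) (e k p) := by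
  have hdiff := fun i => ((he.2.1 i).smoothNear he.1 hp).diffAt
  have hv : ∀ q ∈ U, IsVectorial d fun i j k => torsion3 nabla q (e i q) (e j q) (e k q) :=
    fun q hq => by
      have := hT.isVectorial hΥ hn (he.2.2 q hq)
      rwa [hd q hq] at this
  have h1 : IsVectorial d fun i j k =>
      mvfderiv (𝓡 8) (fun q => torsion3 nabla q (e i q) (e j q) (e k q)) p x :=
    IsVectorial.mvfderiv (t := fun q i j k => torsion3 nabla q (e i q) (e j q) (e k q))
      (fun i j k => hS.diff (hdiff i) (hdiff j) (hdiff k))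
      (by filter_upwards [he.1.mem_nhds hp] with q hq using hv q hq) x
  have hG := inStabilizer_connMatrix hn.metric hn.preserves he hd hp x
  have h2 := h1.sub (hG.isVectorial_actTensor (hv p hp))
  convert h2 using 4 with i j k
  rw [mvfderiv_components nabla hS he hp, add_sub_cancel_right]

/-- The manifold carries orthonormal frames adapted to `Υ`. -/
lemma IsRestrictedNearlyIntegrable.hasFrames {Υ : Tensor3 M}
    (hR : IsRestrictedNearlyIntegrable Υ) (p : M) :
    ∃ (U : Set M) (e : Fin 8 → VField M), p ∈ U ∧ IsAdaptedFrame Υ e U := by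
  obtain ⟨lc, -, h⟩ := hR
  obtain ⟨U, e, hp, he, -⟩ := h p
  exact ⟨U, e, hp, he⟩

/-- The divergence of the torsion, computed with the characteristic connection, vanishes. -/
theorem divergence_torsion [T2Space M] {Υ : Tensor3 M} (hΥ : IsSU3Structure Υ)
    (hR : IsRestrictedNearlyIntegrable Υ) {nabla : Connection M}
    (hn : IsCharacteristicConnection nabla Υ) (hT : HasVectorialTorsion nabla Υ) {p : M}
    {b : Fin 8 → TangentSpace (𝓡 8) p} (hb : Orthonormal ℝ b) (u v : TangentSpace (𝓡 8) p) :
    ∑ i, covDeriv nabla (torsion3 nabla) p (b i) (b i) u v = 0 := by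
  have hM : HasFrames M := fun p => by
    obtain ⟨U, e, hp, he⟩ := hR.hasFrames p
    exact ⟨U, e, hp, he.1⟩
  have hS := isDiffTensor_torsion3 hM hn.smooth
  obtain ⟨U, e, hp, he⟩ := hR.hasFrames p
  have hd : ∀ q ∈ U, comp Υ (fun i => e i q) = comp Υ fun i => e i p := fun q hq =>
    hΥ.comp_eq_of_isAdaptedAt (he.2 q hq) (he.2 p hp)
  have hes := fun i => (he.1.2.1 i).smoothNear he.1.1 hp
  have ho := he.1.2.2 p hp
  set T : Fin 8 → Fin 8 → TangentSpace (𝓡 8) p := fun a b => nabla.torsion p (e a p) (e b p)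
    with hTdef
  have hTs : ∀ a b, T a b = - T b a := fun a b => nabla.torsion_antisymm _ _
  have hTT : ∀ a b c d, torsion3 nabla p (nabla.torsion p (e a p) (e b p)) (e c p) (e d p)
      = inner ℝ (T a b) (T c d) := by
    intro a b c d
    rw [torsion3_skew, hn.skew, neg_neg, torsion3, real_inner_comm]
  have key : ∀ J K, ∑ a, covDeriv nabla (torsion3 nabla) p (e a p) (e a p) (e J p) (e K p) = 0 := by
    intro J K
    refine (hΥ.isSU3Tensor ho).divergence_eq_zero
      (R := fun a b => - Matrix.of fun i j =>
        inner ℝ (e i p) (curvature nabla (e a) (e b) (e j) p))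
      (N := fun a b c f => covDeriv nabla (torsion3 nabla) p (e a p) (e b p) (e c p) (e f p))
      (Q := fun a b c f => inner ℝ (T a b) (T c f) + inner ℝ (T b c) (T a f)
        + inner ℝ (T c a) (T b f)) ?_ ?_ ?_ ?_ ?_ ?_ ?_ ?_ J K
    · intro a b
      exact (inStabilizer_curvature hn.smooth hn.metric hn.preserves he.1 hd hp (hes a)
        (hes b)).neg
    · intro a b
      ext i j
      simp only [Matrix.neg_apply, Matrix.of_apply, curvature, inner_sub_right]
      rw [VectorField.mlieBracket_swap_apply (V := e b), map_neg, inner_neg_right]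
      ring
    · intro a
      exact ⟨fun _ _ _ => covDeriv_skew₁₂ hS (torsion3_skew nabla) _ _ _,
        fun _ _ _ => covDeriv_skew₂₃ hS hn.skew _ _ _⟩
    · intro a
      exact isVectorial_covDeriv hΥ hn hT hS he.1 hd hp (e a p)
    · intro a b c f
      rw [hTs b a, hTs a c, hTs c b]
      simp only [inner_neg_left]
      ring
    · intro a b c f
      rw [hTs a c, hTs c b, hTs b a]
      simp only [inner_neg_left]
      ring
    · intro a b c f
      rw [hTs f c, real_inner_comm (T a c), real_inner_comm (T b c), hTs f a, hTs a c]
      simp only [inner_neg_left, inner_neg_right]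
      ring
    · intro a b c f
      have hm : ∀ a b c, (- Matrix.of fun i j =>
          inner ℝ (e i p) (curvature nabla (e a) (e b) (e j) p)) c f
          = inner ℝ (curvature nabla (e a) (e b) (e c) p) (e f p) := by
        intro a b c
        have h1 := (inStabilizer_curvature hn.smooth hn.metric hn.preserves he.1 hd hp (hes a)
          (hes b)).skew c f
        rw [Matrix.neg_apply, h1, neg_neg, Matrix.of_apply, real_inner_comm]
      rw [hm, hm, hm, sum_inner_curvature hM hn.smooth hn.metric (hes a) (hes b) (hes c), hTT, hTT,
        hTT]
  have hN := isTrilinear_covDeriv nabla hS p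
  have hlin : ∀ u v, ∑ i, covDeriv nabla (torsion3 nabla) p (b i) (b i) u v
      = ∑ i, covDeriv nabla (torsion3 nabla) p (e i p) (e i p) u v := fun u v =>
    sum_bilin_frame (F := fun x y => covDeriv nabla (torsion3 nabla) p x y u v)
      (fun y => isLinearMap_covDeriv nabla hS p y u v) (fun x => (hN x).left u v) ho hb
  rw [hlin]
  have h1 : ∀ a, covDeriv nabla (torsion3 nabla) p (e a p) (e a p) u v
      = ∑ J, ∑ K, inner ℝ (e J p) u * inner ℝ (e K p) v
        * covDeriv nabla (torsion3 nabla) p (e a p) (e a p) (e J p) (e K p) := by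
    intro a
    have h2 := (hN (e a p)).sum (fun i => e i p) (Pi.single a 1)
      (fun J => inner ℝ (e J p) u) (fun K => inner ℝ (e K p) v)
    rw [sum_inner_smul_frame ho u, sum_inner_smul_frame ho v] at h2
    simpa [Pi.single_apply] using h2
  simp only [h1]
  rw [Finset.sum_comm]
  refine Finset.sum_eq_zero fun J _ => ?_
  rw [Finset.sum_comm]
  refine Finset.sum_eq_zero fun K _ => ?_
  rw [← Finset.mul_sum, key, mul_zero]

end SU3Dim8

/-! ### Symmetry of the Ricci tensor -/

namespace SU3Dim8

open Filter Topology

variable {M : Type*} [TopologicalSpace M] [ChartedSpace E8 M] [IsManifold (𝓡 8) ∞ M]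
  [RiemannianBundle (fun p : M => TangentSpace (𝓡 8) p)]

omit [RiemannianBundle (fun p : M => TangentSpace (𝓡 8) p)] in
lemma curvature_antisymm (nabla : Connection M) (X Y Z : VField M) (p : M) :
    curvature nabla X Y Z p = - curvature nabla Y X Z p := by
  simp only [curvature]
  rw [VectorField.mlieBracket_swap_apply (V := Y), map_neg]
  abel

variable [IsContMDiffRiemannianBundle (𝓡 8) ∞ E8 (fun p : M => TangentSpace (𝓡 8) p)]

/-- The curvature operator of a metric connection is skew. -/
lemma inner_curvature_self [T2Space M] {nabla : Connection M}
    (hsm : nabla.ContMDiffCovariantDerivative ∞) (hmet : nabla.IsMetricCompatible)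
    {X Y Z : VField M} {p : M} (hX : SmoothNear X p) (hY : SmoothNear Y p) (hZ : SmoothNear Z p) :
    inner ℝ (curvature nabla X Y Z p) (Z p) = 0 := by
  have h1 : ∀ {q : M}, SmoothNear Z q → ∀ x, mvfderiv (𝓡 8) (fun q => inner ℝ (Z q) (Z q)) q x
      = 2 * inner ℝ (nabla Z q x) (Z q) := by
    intro q hq x
    rw [mvfderiv_inner hmet hq.diffAt hq.diffAt, real_inner_comm (Z q)]
    ring
  have h2 : ∀ {Y : VField M}, SmoothNear Y p →
      FDiffAt (fun q => 2 * inner ℝ (nabla Z q (Y q)) (Z q)) p := fun hY =>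
    mdifferentiableAt_const.mul ((hY.cov hsm hZ).diffAt.inner hZ.diffAt)
  have h3 : ∀ {Y : VField M}, SmoothNear Y p → ∀ᶠ q in 𝓝 p,
      mvfderiv (𝓡 8) (fun q => inner ℝ (Z q) (Z q)) q (Y q)
        = 2 * inner ℝ (nabla Z q (Y q)) (Z q) := fun hY =>
    hZ.eventually.mono fun q hq => h1 hq _
  have h4 : ∀ {X Y : VField M}, SmoothNear X p → SmoothNear Y p →
      mvfderiv (𝓡 8) (fun q => mvfderiv (𝓡 8) (fun q => inner ℝ (Z q) (Z q)) q (Y q)) p (X p)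
        = 2 * inner ℝ (nabla (fun q => nabla Z q (Y q)) p (X p)) (Z p)
          + 2 * inner ℝ (nabla Z p (Y p)) (nabla Z p (X p)) := by
    intro X Y hX hY
    rw [mvfderiv_congr (h3 hY), mvfderiv_mul_apply mdifferentiableAt_const
      ((hY.cov hsm hZ).diffAt.inner hZ.diffAt), mvfderiv_const, _root_.zero_apply, mul_zero,
      add_zero, mvfderiv_inner hmet (hY.cov hsm hZ).diffAt hZ.diffAt]
    ring
  obtain ⟨U, hU, hpU, hZU⟩ := id hZ
  have h5 := mvfderiv_mlieBracket (f := fun q => inner ℝ (Z q) (Z q)) hU hpU hX hY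
    (ContMDiffOn.inner_bundle (F := E8) (IB := 𝓡 8) (E := fun p : M => TangentSpace (𝓡 8) p)
      (b := id) (v := Z) (w := Z) hZU hZU)
    ((h2 hX).congr_of_eventuallyEq (h3 hX)) ((h2 hY).congr_of_eventuallyEq (h3 hY))
  rw [h4 hX hY, h4 hY hX, h1 hZ, real_inner_comm (nabla Z p (X p))] at h5
  simp only [curvature, inner_sub_left]
  linarith

/-- The Ricci tensor of the characteristic connection is symmetric: by the Bianchi identity its skew
part is the divergence of the torsion. -/
theorem ricci_symm [T2Space M] {Υ : Tensor3 M} (hΥ : IsSU3Structure Υ)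
    (hR : IsRestrictedNearlyIntegrable Υ) {nabla : Connection M}
    (hn : IsCharacteristicConnection nabla Υ) (hT : HasVectorialTorsion nabla Υ) (p : M)
    (v w : TangentSpace (𝓡 8) p) : ricci nabla p v w = ricci nabla p w v := by
  have hM : HasFrames M := fun p => by
    obtain ⟨U, e, hp, he⟩ := hR.hasFrames p
    exact ⟨U, e, hp, he.1⟩
  have hS := isDiffTensor_torsion3 hM hn.smooth
  set b := stdOrthonormalBasis ℝ (TangentSpace (𝓡 8) p) with hb
  have hN := isTrilinear_covDeriv nabla hS p
  have hs1 : ∀ x u v w, covDeriv nabla (torsion3 nabla) p x u v w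
      = - covDeriv nabla (torsion3 nabla) p x v u w :=
    fun _ _ _ _ => covDeriv_skew₁₂ hS (torsion3_skew nabla) _ _ _
  have hs2 : ∀ x u v w, covDeriv nabla (torsion3 nabla) p x u v w
      = - covDeriv nabla (torsion3 nabla) p x u w v :=
    fun _ _ _ _ => covDeriv_skew₂₃ hS hn.skew _ _ _
  have key : ∀ u, inner ℝ (curvature nabla (FiberBundle.extend E8 u) (FiberBundle.extend E8 v)
      (FiberBundle.extend E8 w) p) u
      - inner ℝ (curvature nabla (FiberBundle.extend E8 u) (FiberBundle.extend E8 w)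
      (FiberBundle.extend E8 v) p) u = covDeriv nabla (torsion3 nabla) p u u v w := by
    intro u
    have hu := smoothNear_extend u
    have hv := smoothNear_extend v
    have hw := smoothNear_extend w
    have h1 := sum_inner_curvature hM hn.smooth hn.metric hu hv hw u
    have h2 := inner_curvature_self hn.smooth hn.metric hv hw hu
    rw [curvature_antisymm nabla (FiberBundle.extend E8 w) (FiberBundle.extend E8 u),
      inner_neg_left] at h1
    simp only [FiberBundle.extend_apply_self] at h1 h2
    have hTT : ∀ a b c d, torsion3 nabla p (nabla.torsion p a b) c d
        = inner ℝ (nabla.torsion p a b) (nabla.torsion p c d) := by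
      intro a b c d
      rw [torsion3_skew, hn.skew, neg_neg, torsion3, real_inner_comm]
    have h3 : inner ℝ (nabla.torsion p u v) (nabla.torsion p w u)
        + inner ℝ (nabla.torsion p v w) (nabla.torsion p u u)
        + inner ℝ (nabla.torsion p w u) (nabla.torsion p v u) = 0 := by
      rw [nabla.torsion_self, inner_zero_right, nabla.torsion_antisymm v u, inner_neg_right,
        real_inner_comm (nabla.torsion p u v)]
      ring
    rw [h2, hTT, hTT, hTT, h3] at h1
    linarith [hs1 u u v w, hs2 u v u w, hs2 v w u u, hs2 w u v u, hs1 w u u v]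
  rw [← sub_eq_zero]
  simp only [ricci, ← Finset.sum_sub_distrib, ← hb, key]
  have hcard : Module.finrank ℝ (TangentSpace (𝓡 8) p) = 8 := by
    rw [show Module.finrank ℝ (TangentSpace (𝓡 8) p) = Module.finrank ℝ E8 from rfl]; simp
  have h := divergence_torsion hΥ hR hn hT (b.reindex (finCongr hcard)).orthonormal v w
  rw [← h]
  simp only [OrthonormalBasis.reindex_apply]
  exact (Equiv.sum_comp (finCongr hcard).symm fun i =>
    covDeriv nabla (torsion3 nabla) p (b i) (b i) v w).symm

end SU3Dim8

/-! ### Forms, determinants and the Hodge star -/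

namespace SU3Dim8

open Matrix

/-- A linear map acts on the determinant, as a derivation in the columns, by its trace. -/
lemma sum_det_updateCol_mulVec (A B : Matrix (Fin 8) (Fin 8) ℝ) :
    ∑ b, (A.updateCol b (B *ᵥ A.col b)).det = B.trace * A.det := by
  have h : ∀ b, (A.updateCol b (B *ᵥ A.col b)).det = (A.adjugate * (B * A)) b b := by
    intro b
    rw [← Matrix.cramer_apply, Matrix.cramer_eq_adjugate_mulVec]
    rfl
  simp only [h]
  change (A.adjugate * (B * A)).trace = _
  rw [Matrix.trace_mul_comm, mul_assoc, Matrix.mul_adjugate, Matrix.mul_smul, mul_one,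
    Matrix.trace_smul, smul_eq_mul, mul_comm]

section

open Finset

variable {V : Type*} [AddCommGroup V]

/-- The two properties of a form of degree `n + 1` that the formula for its exterior derivative
uses: an argument can be moved to the front, with a sign, and the first argument enters additively.
-/
structure IsForm {n : ℕ} (φ : (Fin (n + 1) → V) → ℝ) : Prop where
  map_update : ∀ (v : Fin (n + 1) → V) (s : Fin (n + 1)) (y : V),
    φ (Function.update v s y) = (-1 : ℝ) ^ (s : ℕ) * φ (Matrix.vecCons y (s.removeNth v))
  map_sub : ∀ (y z : V) (v : Fin n → V),
    φ (Matrix.vecCons (y - z) v) = φ (Matrix.vecCons y v) - φ (Matrix.vecCons z v)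

lemma isForm_alternatingMap [Module ℝ V] {n : ℕ} (f : V [⋀^Fin (n + 1)]→ₗ[ℝ] ℝ) :
    IsForm fun v => f v where
  map_update v s y := by
    rw [← Fin.insertNth_removeNth, AlternatingMap.map_insertNth, zsmul_eq_mul]
    push_cast
    rfl
  map_sub y z v := by
    rw [sub_eq_add_neg, AlternatingMap.map_vecCons_add, ← neg_one_smul ℝ z,
      AlternatingMap.map_vecCons_smul, smul_eq_mul]
    ring

/-- For an alternating form `φ`, the terms `φ(∇_{X_i} X_j, …)` produced by the product rule in the
alternating sum of the derivatives `X_i(φ(…, X̂_i, …))` combine to the commutators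
`∇_{X_i} X_j - ∇_{X_j} X_i`; here `c i j` plays the role of `∇_{X_i} X_j`. -/
lemma IsForm.sum_update_eq_sum_commutator {n : ℕ} {φ : (Fin (n + 1) → V) → ℝ} (hφ : IsForm φ)
    (X : Fin (n + 2) → V) (c : Fin (n + 2) → Fin (n + 2) → V) :
    ∑ i : Fin (n + 2), (-1 : ℝ) ^ (i : ℕ) *
        ∑ s, φ (Function.update (i.removeNth X) s (c i (i.succAbove s)))
      = ∑ i : Fin (n + 1), ∑ j ∈ univ.filter (fun j : Fin (n + 1) => i ≤ j),
          (-1 : ℝ) ^ ((i : ℕ) + (j : ℕ)) *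
            φ (Matrix.vecCons (c i.castSucc j.succ - c j.succ i.castSucc)
              (j.removeNth (i.castSucc.removeNth X))) := by
  simp only [mul_sum]
  rw [Fin.sum_sum_eq_sum_triangle_add]
  refine Fintype.sum_congr _ _ fun i => ?_
  have hI : Finset.Ici i = univ.filter (fun j : Fin (n + 1) => i ≤ j) := by ext; simp
  rw [hI]
  refine sum_congr rfl fun j hj => ?_
  rw [mem_filter] at hj
  have hj := hj.2
  rw [hφ.map_update, hφ.map_update, Fin.removeNth_removeNth_eq_swap]
  have H₁ : i.castSucc.succAbove j = j.succ := by simp [Fin.succAbove_of_le_castSucc, hj]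
  have H₂ : j.predAbove i.castSucc = i := by simp [Fin.predAbove_of_le_castSucc, hj]
  have H₃ : j.succ.succAbove i = i.castSucc := by simp [Fin.succAbove_of_castSucc_lt, hj]
  rw [H₁, H₂, H₃, hφ.map_sub]
  simp only [Fin.val_castSucc, Fin.val_succ, pow_add, pow_one]
  ring

end

open Filter Topology

variable {M : Type*} [TopologicalSpace M] [ChartedSpace E8 M]

lemma mvfderiv_finset_prod {ι : Type*} [DecidableEq ι] {f : ι → M → ℝ} {p : M}
    (hf : ∀ i, FDiffAt (f i) p) (v : TangentSpace (𝓡 8) p) (s : Finset ι) :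
    FDiffAt (fun q => ∏ i ∈ s, f i q) p ∧ mvfderiv (𝓡 8) (fun q => ∏ i ∈ s, f i q) p v
      = ∑ b ∈ s, ∏ i ∈ s, if i = b then mvfderiv (𝓡 8) (f i) p v else f i p := by
  induction s using Finset.induction_on with
  | empty =>
    simp only [Finset.prod_empty, Finset.sum_empty]
    exact ⟨mdifferentiableAt_const, by rw [mvfderiv_const]; rfl⟩
  | insert a s ha ih =>
    simp only [Finset.prod_insert ha, Finset.sum_insert ha]
    refine ⟨(hf a).mul ih.1, ?_⟩
    rw [mvfderiv_mul_apply (hf a) ih.1, ih.2, if_pos trivial, add_comm, mul_comm, Finset.mul_sum]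
    congr 1
    · congr 1
      exact Finset.prod_congr rfl fun i hi => by
        rw [if_neg fun h => ha (by rwa [h] at hi)]
    · exact Finset.sum_congr rfl fun b hb => by rw [if_neg fun h => ha (by rwa [← h] at hb)]

/-- The Leibniz rule for a determinant. -/
lemma mvfderiv_det {f : M → Matrix (Fin 8) (Fin 8) ℝ} {p : M}
    (hf : ∀ a b, FDiffAt (fun q => f q a b) p) (v : TangentSpace (𝓡 8) p) :
    FDiffAt (fun q => (f q).det) p ∧ mvfderiv (𝓡 8) (fun q => (f q).det) p v
      = ∑ b, ((f p).updateCol b fun a => mvfderiv (𝓡 8) (fun q => f q a b) p v).det := by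
  simp only [Matrix.det_apply']
  have hp : ∀ σ : Equiv.Perm (Fin 8), FDiffAt (fun q => ∏ i, f q (σ i) i) p := fun σ => by
    exact (mvfderiv_finset_prod (f := fun i q => f q (σ i) i) (fun i => hf (σ i) i) v _).1
  have hs : ∀ σ : Equiv.Perm (Fin 8),
      FDiffAt (fun q => ((Equiv.Perm.sign σ : ℤ) : ℝ) * ∏ i, f q (σ i) i) p :=
    fun σ => mdifferentiableAt_const.mul (hp σ)
  refine ⟨fdiffAt_sum hs, ?_⟩
  rw [mvfderiv_fsum hs, Finset.sum_comm]
  refine Finset.sum_congr rfl fun σ _ => ?_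
  rw [mvfderiv_mul_apply mdifferentiableAt_const (hp σ), mvfderiv_const, _root_.zero_apply,
    mul_zero, add_zero, (mvfderiv_finset_prod (f := fun i q => f q (σ i) i)
      (fun i => hf (σ i) i) v _).2, Finset.mul_sum]
  refine Finset.sum_congr rfl fun b _ => ?_
  congr 1
  refine Finset.prod_congr rfl fun i _ => ?_
  rw [Matrix.updateCol_apply]
  split_ifs with h
  · rw [h]
  · rfl

lemma append_three {α : Type*} (a b c : α) (w : Fin 5 → α) :
    (Fin.append ![a, b, c] w : Fin 8 → α)
      = (Matrix.vecCons a (Matrix.vecCons b (Matrix.vecCons c w)) : Fin 8 → α) := by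
  ext i
  fin_cases i <;> rfl

section

variable {V : Type*} [NormedAddCommGroup V] [InnerProductSpace ℝ V]

/-- The volume form of a basis as an alternating map. -/
noncomputable def volAlternating {ι : Type*} [Fintype ι] [DecidableEq ι] (e : ι → V) :
    V [⋀^ι]→ₗ[ℝ] ℝ :=
  (Matrix.detRowAlternating (R := ℝ) (n := ι)).compLinearMap
    (LinearMap.pi fun a => (innerSL ℝ (e a)).toLinearMap)

lemma volAlternating_apply {ι : Type*} [Fintype ι] [DecidableEq ι] (e v : ι → V) :
    volAlternating e v = (Matrix.of fun a b : ι => inner ℝ (e a) (v b)).det := by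
  rw [← Matrix.det_transpose]
  rfl

/-- Expansion along the first row of a `9 × 9` determinant with two equal rows. -/
lemma sum_inner_mul_volAlternating_removeNth (e : Fin 8 → V) (a : Fin 8) (Z : Fin 9 → V) :
    ∑ j : Fin 9, (-1 : ℝ) ^ (j : ℕ) * (inner ℝ (e a) (Z j) * volAlternating e (j.removeNth Z))
      = 0 := by
  have h : (Matrix.of (Fin.cons (fun b => inner ℝ (e a) (Z b))
      (fun (r : Fin 8) b => inner ℝ (e r) (Z b)) : Fin 9 → Fin 9 → ℝ)).det = 0 :=
    Matrix.det_zero_of_row_eq (i := 0) (j := a.succ) (Fin.succ_ne_zero a).symm rfl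
  rw [Matrix.det_succ_row_zero] at h
  rw [← h]
  refine Finset.sum_congr rfl fun j _ => ?_
  rw [mul_assoc, volAlternating_apply]
  rfl

lemma alternatingMap_sum_apply {ι : Type*} {n : ℕ} (s : Finset ι) (f : ι → V [⋀^Fin n]→ₗ[ℝ] ℝ)
    (v : Fin n → V) : (∑ i ∈ s, f i) v = ∑ i ∈ s, f i v := by
  classical
  induction s using Finset.induction_on with
  | empty => simp
  | insert a s ha ih => rw [Finset.sum_insert ha, Finset.sum_insert ha, AlternatingMap.add_apply,
      ih]

/-- The Hodge star of a 3-form as an alternating map. -/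
noncomputable def starAlternating (T : V → V → V → ℝ) (e : Fin 8 → V) : V [⋀^Fin 5]→ₗ[ℝ] ℝ :=
  (1 / 6 : ℝ) • ∑ i, ∑ j, ∑ k, T (e i) (e j) (e k) •
    (((volAlternating e).curryLeft (e i)).curryLeft (e j)).curryLeft (e k)

lemma starAlternating_apply (T : V → V → V → ℝ) (e : Fin 8 → V) (w : Fin 5 → V) :
    starAlternating T e w = 1 / 6 * ∑ i, ∑ j, ∑ k, T (e i) (e j) (e k)
      * volAlternating e (Matrix.vecCons (e i) (Matrix.vecCons (e j) (Matrix.vecCons (e k) w)))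
          := by
  have h : ∀ (f : V [⋀^Fin 8]→ₗ[ℝ] ℝ) (t : Fin 8 → Fin 8 → Fin 8 → ℝ),
      ((1 / 6 : ℝ) • ∑ i, ∑ j, ∑ k, t i j k •
        ((f.curryLeft (e i)).curryLeft (e j)).curryLeft (e k)) w
      = 1 / 6 * ∑ i, ∑ j, ∑ k, t i j k
        * f (Matrix.vecCons (e i) (Matrix.vecCons (e j) (Matrix.vecCons (e k) w))) := by
    intro f t
    simp only [AlternatingMap.smul_apply, alternatingMap_sum_apply,
      AlternatingMap.curryLeft_apply_apply, smul_eq_mul]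
  exact h (volAlternating e) fun i j k => T (e i) (e j) (e k)

/-- If `N` is the covariant derivative of a 3-form, with the first argument the direction of
differentiation, then the alternation of `*N` vanishes as soon as the divergence of the 3-form
does. -/
lemma sum_starAlternating_eq_zero {e : Fin 8 → V} (he : Orthonormal ℝ e)
    (hspan : ∀ v : V, ∑ i, inner ℝ (e i) v • e i = v) {N : V → V → V → V → ℝ}
    (hlin : ∀ u v w, IsLinearMap ℝ fun x => N x u v w)
    (h₁₂ : ∀ x u v w, N x u v w = - N x v u w) (h₂₃ : ∀ x u v w, N x u v w = - N x u w v)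
    (hdiv : ∀ u v, ∑ i, N (e i) (e i) u v = 0) (X : Fin 6 → V) :
    ∑ s : Fin 6, (-1 : ℝ) ^ (s : ℕ) * starAlternating (N (X s)) e (s.removeNth X) = 0 := by
  set D : Fin 8 → Fin 8 → Fin 8 → (Fin 5 → V) → ℝ := fun i j k w => volAlternating e
    (Matrix.vecCons (e i) (Matrix.vecCons (e j) (Matrix.vecCons (e k) w))) with hD
  set C : Fin 8 → Fin 8 → ℝ := fun i j => volAlternating e
    (Matrix.vecCons (e i) (Matrix.vecCons (e j) X)) with hC
  -- Two equal rows: the alternating sum over the columns `X s` is minus that over `e i, e j, e k`.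
  have hrow : ∀ a i j k, ∑ s : Fin 6, (-1 : ℝ) ^ (s : ℕ) *
      (inner ℝ (e a) (X s) * D i j k (s.removeNth X))
      = (1 : Matrix (Fin 8) (Fin 8) ℝ) a i * C j k - (1 : Matrix (Fin 8) (Fin 8) ℝ) a j * C i k
        + (1 : Matrix (Fin 8) (Fin 8) ℝ) a k * C i j := by
    intro a i j k
    have h := sum_inner_mul_volAlternating_removeNth e a
      (Matrix.vecCons (e i) (Matrix.vecCons (e j) (Matrix.vecCons (e k) X)))
    have hone : ∀ b, inner ℝ (e a) (e b) = (1 : Matrix (Fin 8) (Fin 8) ℝ) a b := fun b => by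
      rw [orthonormal_iff_ite.mp he, Matrix.one_apply]
    have r : ∀ {n : ℕ} (s : Fin (n + 1)) (x : V) (Z : Fin (n + 1) → V),
        s.succ.removeNth (Matrix.vecCons x Z) = Matrix.vecCons x (s.removeNth Z) := by
      intro n s x Z
      ext b
      refine Fin.cases ?_ (fun b => ?_) b <;> simp [Fin.removeNth]
    rw [Fin.sum_univ_succ, Fin.sum_univ_succ, Fin.sum_univ_succ] at h
    simp only [r, Matrix.cons_val_succ, Matrix.cons_val_zero, Fin.removeNth_zero, hone,
      Fin.val_succ, Fin.val_zero, pow_zero, pow_add, pow_one, zero_add] at h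
    have r0 : ∀ {n : ℕ} (x : V) (Z : Fin n → V), Fin.tail (Matrix.vecCons x Z) = Z :=
      fun _ _ => rfl
    simp only [r0] at h
    have h' : (∑ s : Fin 6, (-1 : ℝ) ^ (s : ℕ) * (-1) * (-1) * (-1) *
        (inner ℝ (e a) (X s) * D i j k (s.removeNth X)))
        = - ∑ s : Fin 6, (-1 : ℝ) ^ (s : ℕ) * (inner ℝ (e a) (X s) * D i j k (s.removeNth X)) := by
      rw [← Finset.sum_neg_distrib]
      exact Finset.sum_congr rfl fun s _ => by ring
    rw [h'] at h
    linarith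
  have hN : ∀ s u v w, N (X s) u v w = ∑ a, inner ℝ (e a) (X s) * N (e a) u v w := by
    intro s u v w
    conv_lhs => rw [← hspan (X s)]
    have := map_sum ((hlin u v w).mk' _) (fun a => inner ℝ (e a) (X s) • e a) Finset.univ
    simpa only [map_smul, IsLinearMap.mk'_apply, smul_eq_mul] using this
  have hmain : ∑ s : Fin 6, (-1 : ℝ) ^ (s : ℕ) * starAlternating (N (X s)) e (s.removeNth X)
      = 1 / 6 * ∑ i, ∑ j, ∑ k, ∑ a, N (e a) (e i) (e j) (e k)
        * ((1 : Matrix (Fin 8) (Fin 8) ℝ) a i * C j k - (1 : Matrix (Fin 8) (Fin 8) ℝ) a j * C i k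
        + (1 : Matrix (Fin 8) (Fin 8) ℝ) a k * C i j) := by
    simp only [starAlternating_apply, hN, ← hrow, Finset.mul_sum, Finset.sum_mul]
    rw [Finset.sum_comm]
    refine Finset.sum_congr rfl fun i _ => ?_
    rw [Finset.sum_comm]
    refine Finset.sum_congr rfl fun j _ => ?_
    rw [Finset.sum_comm]
    refine Finset.sum_congr rfl fun k _ => ?_
    rw [Finset.sum_comm]
    refine Finset.sum_congr rfl fun a _ => Finset.sum_congr rfl fun s _ => ?_
    rw [hD]
    ring
  have c1 : ∀ u v, ∑ i, N (e i) u (e i) v = 0 := fun u v => by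
    simp only [h₁₂ _ u, Finset.sum_neg_distrib, hdiv, neg_zero]
  have c2 : ∀ u v, ∑ i, N (e i) u v (e i) = 0 := fun u v => by
    simp only [h₂₃ _ u v, Finset.sum_neg_distrib, c1, neg_zero]
  have t1 : ∑ i, ∑ j, ∑ k, N (e i) (e i) (e j) (e k) * C j k = 0 := by
    rw [Finset.sum_comm]
    refine Finset.sum_eq_zero fun j _ => ?_
    rw [Finset.sum_comm]
    refine Finset.sum_eq_zero fun k _ => ?_
    rw [← Finset.sum_mul, hdiv, zero_mul]
  have t2 : ∑ i, ∑ j, ∑ k, N (e j) (e i) (e j) (e k) * C i k = 0 := by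
    refine Finset.sum_eq_zero fun i _ => ?_
    rw [Finset.sum_comm]
    refine Finset.sum_eq_zero fun k _ => ?_
    rw [← Finset.sum_mul, c1, zero_mul]
  have t3 : ∑ i, ∑ j, ∑ k, N (e k) (e i) (e j) (e k) * C i j = 0 := by
    refine Finset.sum_eq_zero fun i _ => Finset.sum_eq_zero fun j _ => ?_
    rw [← Finset.sum_mul, c2, zero_mul]
  rw [hmain]
  simp only [mul_add, mul_sub, Finset.sum_add_distrib, Finset.sum_sub_distrib, Matrix.one_apply,
    ite_mul, one_mul, zero_mul, mul_ite, mul_zero, Finset.sum_ite_eq', Finset.mem_univ, if_true]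
  rw [t1, t2, t3]
  ring

end

variable [RiemannianBundle (fun p : M => TangentSpace (𝓡 8) p)]

lemma volForm_eq {p : M} (e v : Fin 8 → TangentSpace (𝓡 8) p) :
    volForm e v = volAlternating e v := (volAlternating_apply e v).symm

lemma hodgeStar3_eq {p : M}
    (T : TangentSpace (𝓡 8) p → TangentSpace (𝓡 8) p → TangentSpace (𝓡 8) p → ℝ)
    (e : Fin 8 → TangentSpace (𝓡 8) p) (w : Fin 5 → TangentSpace (𝓡 8) p) :
    hodgeStar3 T e w = starAlternating T e w := by
  have h : ∀ a b c : TangentSpace (𝓡 8) p, volForm e (Fin.append ![a, b, c] w)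
      = volAlternating e (Matrix.vecCons a (Matrix.vecCons b (Matrix.vecCons c w))) := by
    intro a b c
    have h1 : volForm e (Fin.append ![a, b, c] w)
        = volForm e (Matrix.vecCons a (Matrix.vecCons b (Matrix.vecCons c w))) :=
      congrArg (volForm e) (append_three a b c w)
    rw [h1]
    exact volForm_eq e (Matrix.vecCons a (Matrix.vecCons b (Matrix.vecCons c w)))
  rw [starAlternating_apply T e w, hodgeStar3]
  simp only [h]

/-- If `N` is the covariant derivative of a 3-form, with the first argument the direction of
differentiation, then the alternation of `*N` vanishes as soon as the divergence of the 3-form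
does. -/
lemma sum_hodgeStar3_eq_zero {p : M} {e : Fin 8 → TangentSpace (𝓡 8) p} (he : Orthonormal ℝ e)
    {N : TangentSpace (𝓡 8) p → TangentSpace (𝓡 8) p → TangentSpace (𝓡 8) p →
      TangentSpace (𝓡 8) p → ℝ} (hlin : ∀ u v w, IsLinearMap ℝ fun x => N x u v w)
    (h₁₂ : ∀ x u v w, N x u v w = - N x v u w) (h₂₃ : ∀ x u v w, N x u v w = - N x u w v)
    (hdiv : ∀ u v, ∑ i, N (e i) (e i) u v = 0) (X : Fin 6 → TangentSpace (𝓡 8) p) :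
    ∑ s : Fin 6, (-1 : ℝ) ^ (s : ℕ) * hodgeStar3 (N (X s)) e (s.removeNth X) = 0 := by
  have h := sum_starAlternating_eq_zero he (sum_inner_smul_frame he) hlin h₁₂ h₂₃ hdiv X
  simp only [hodgeStar3_eq]
  exact h

lemma isForm_hodgeStar3 {p : M}
    (T : TangentSpace (𝓡 8) p → TangentSpace (𝓡 8) p → TangentSpace (𝓡 8) p → ℝ)
    (e : Fin 8 → TangentSpace (𝓡 8) p) : IsForm (hodgeStar3 T e) := by
  have h := isForm_alternatingMap (starAlternating T e)
  rwa [show hodgeStar3 T e = fun w => starAlternating T e w from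
    funext fun w => hodgeStar3_eq T e w]

end SU3Dim8

/-! ### The Leibniz rule for the Hodge star -/

namespace SU3Dim8

open Matrix Filter Topology

/-- A skew matrix acts on 3-tensors by a skew operator. -/
lemma sum_actTensor_mul {G : Matrix (Fin 8) (Fin 8) ℝ} (hG : ∀ i j, G i j = - G j i)
    (t D : Fin 8 → Fin 8 → Fin 8 → ℝ) :
    ∑ i, ∑ j, ∑ k, (actTensor G t i j k * D i j k + t i j k * actTensor G D i j k) = 0 := by
  have h1 : ∑ i, ∑ j, ∑ k, ∑ m, (G m i * t m j k * D i j k + t i j k * (G m i * D m j k)) = 0 := by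
    simp only [Finset.sum_add_distrib]
    have : ∑ i, ∑ j, ∑ k, ∑ m, G m i * t m j k * D i j k
        = ∑ i, ∑ j, ∑ k, ∑ m, -(t i j k * (G m i * D m j k)) := by
      have e : ∀ f : Fin 8 → Fin 8 → Fin 8 → Fin 8 → ℝ,
          ∑ i, ∑ j, ∑ k, ∑ m, f i j k m = ∑ m, ∑ j, ∑ k, ∑ i, f i j k m := by
        intro f
        rw [Finset.sum_congr rfl fun i _ => (Finset.sum_congr rfl fun j _ =>
          Finset.sum_comm).trans Finset.sum_comm, Finset.sum_comm]
        refine Finset.sum_congr rfl fun m _ => ?_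
        rw [Finset.sum_comm]
        exact Finset.sum_congr rfl fun j _ => Finset.sum_comm
      rw [e]
      refine Finset.sum_congr rfl fun i _ => Finset.sum_congr rfl fun j _ =>
        Finset.sum_congr rfl fun k _ => Finset.sum_congr rfl fun m _ => ?_
      rw [hG i m]
      ring
    rw [this]
    simp only [Finset.sum_neg_distrib, neg_add_cancel]
  have h2 : ∑ i, ∑ j, ∑ k, ∑ m, (G m j * t i m k * D i j k + t i j k * (G m j * D i m k)) = 0 := by
    refine Finset.sum_eq_zero fun i _ => ?_
    simp only [Finset.sum_add_distrib]
    have : ∑ j, ∑ k, ∑ m, G m j * t i m k * D i j k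
        = ∑ j, ∑ k, ∑ m, -(t i j k * (G m j * D i m k)) := by
      rw [Finset.sum_congr rfl fun i _ => Finset.sum_comm, Finset.sum_comm]
      refine Finset.sum_congr rfl fun j _ => ?_
      rw [Finset.sum_comm]
      refine Finset.sum_congr rfl fun k _ => Finset.sum_congr rfl fun m _ => ?_
      rw [hG j m]
      ring
    rw [this]
    simp only [Finset.sum_neg_distrib, neg_add_cancel]
  have h3 : ∑ i, ∑ j, ∑ k, ∑ m, (G m k * t i j m * D i j k + t i j k * (G m k * D i j m)) = 0 := by
    refine Finset.sum_eq_zero fun i _ => Finset.sum_eq_zero fun j _ => ?_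
    simp only [Finset.sum_add_distrib]
    have : ∑ k, ∑ m, G m k * t i j m * D i j k = ∑ k, ∑ m, -(t i j k * (G m k * D i j m)) := by
      rw [Finset.sum_comm]
      refine Finset.sum_congr rfl fun k _ => Finset.sum_congr rfl fun m _ => ?_
      rw [hG k m]
      ring
    rw [this]
    simp only [Finset.sum_neg_distrib, neg_add_cancel]
  refine Eq.trans ?_ ((congrArg₂ (· + ·) (congrArg₂ (· + ·) h1 h2) h3).trans (by norm_num))
  simp only [← Finset.sum_add_distrib]
  refine Finset.sum_congr rfl fun i _ => Finset.sum_congr rfl fun j _ =>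
    Finset.sum_congr rfl fun k _ => ?_
  simp only [actTensor, Finset.sum_mul, Finset.mul_sum, ← Finset.sum_add_distrib]
  refine Finset.sum_congr rfl fun m _ => ?_
  ring

section

variable {V : Type*} [NormedAddCommGroup V] [InnerProductSpace ℝ V]

/-- The Hodge star is the contraction with an alternating 8-form `f`, the volume form. -/
lemma exists_starAlternating_eq (e : Fin 8 → V) : ∃ f : V [⋀^Fin 8]→ₗ[ℝ] ℝ,
    (∀ v, f v = (Matrix.of fun a b : Fin 8 => inner ℝ (e a) (v b)).det) ∧
      ∀ (T : V → V → V → ℝ) w, starAlternating T e w = 1 / 6 * ∑ i, ∑ j, ∑ k, T (e i) (e j) (e k)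
        * f (Matrix.vecCons (e i) (Matrix.vecCons (e j) (Matrix.vecCons (e k) w))) :=
  ⟨volAlternating e, volAlternating_apply e, fun T w => starAlternating_apply T e w⟩

lemma map_vecCons_sum {n : ℕ} (f : V [⋀^Fin (n + 1)]→ₗ[ℝ] ℝ) (g : Fin 8 → ℝ) (e : Fin 8 → V)
    (w : Fin n → V) :
    f (Matrix.vecCons (∑ m, g m • e m) w) = ∑ m, g m * f (Matrix.vecCons (e m) w) := by
  rw [← AlternatingMap.curryLeft_apply_apply, map_sum, alternatingMap_sum_apply]
  refine Finset.sum_congr rfl fun m _ => ?_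
  rw [map_smul]
  rfl

lemma sum_map_update_vecCons {n : ℕ} (f : V [⋀^Fin (n + 1)]→ₗ[ℝ] ℝ) (a a' : V) (w w' : Fin n → V) :
    ∑ b, f (Function.update (Matrix.vecCons a w) b (Matrix.vecCons a' w' b))
      = f (Matrix.vecCons a' w) + ∑ s, f.curryLeft a (Function.update w s (w' s)) := by
  rw [Fin.sum_univ_succ]
  congr 1
  · congr 1
    exact Fin.update_cons_zero (α := fun _ => V) a w a'
  · refine Finset.sum_congr rfl fun s _ => ?_
    rw [AlternatingMap.curryLeft_apply_apply]
    congr 1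
    exact (Fin.cons_update (α := fun _ => V) a w s (w' s)).symm

/-- The effect of replacing, one after the other, the arguments of an alternating form; the first
three are basis vectors, replaced by their images under a matrix. -/
lemma sum_map_update_frame (f : V [⋀^Fin 8]→ₗ[ℝ] ℝ) (G : Matrix (Fin 8) (Fin 8) ℝ) (e : Fin 8 → V)
    (i j k : Fin 8) (w w' : Fin 5 → V) :
    ∑ b, f (Function.update (Matrix.vecCons (e i) (Matrix.vecCons (e j) (Matrix.vecCons (e k) w))) b
        ((Matrix.vecCons (∑ m, G m i • e m) (Matrix.vecCons (∑ m, G m j • e m)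
          (Matrix.vecCons (∑ m, G m k • e m) w')) : Fin 8 → V) b))
      = actTensor G (fun i j k => f (Matrix.vecCons (e i) (Matrix.vecCons (e j)
          (Matrix.vecCons (e k) w)))) i j k
        + ∑ s, f (Matrix.vecCons (e i) (Matrix.vecCons (e j) (Matrix.vecCons (e k)
            (Function.update w s (w' s))))) := by
  rw [sum_map_update_vecCons, sum_map_update_vecCons, sum_map_update_vecCons]
  rw [map_vecCons_sum, map_vecCons_sum, map_vecCons_sum]
  simp only [AlternatingMap.curryLeft_apply_apply, actTensor, Finset.sum_add_distrib,
    add_assoc]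

end

variable {M : Type*} [TopologicalSpace M] [ChartedSpace E8 M] [IsManifold (𝓡 8) ∞ M]

lemma diffAt_vecCons {n : ℕ} {X : VField M} {Y : Fin n → VField M} {p : M} (hX : DiffAt X p)
    (hY : ∀ s, DiffAt (Y s) p) (s : Fin (n + 1)) : DiffAt (Matrix.vecCons X Y s) p := by
  refine Fin.cases ?_ (fun s => ?_) s
  · exact hX
  · exact hY s

variable [RiemannianBundle (fun p : M => TangentSpace (𝓡 8) p)]
  [IsContMDiffRiemannianBundle (𝓡 8) ∞ E8 (fun p : M => TangentSpace (𝓡 8) p)]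

/-- The volume form is parallel for a metric connection: the rotation of the frame contributes the
trace of a skew matrix. -/
lemma mvfderiv_volForm {nabla : Connection M} (hmet : nabla.IsMetricCompatible)
    {e : Fin 8 → VField M} {U : Set M} (he : IsOrthonormalFrame e U) {p : M} (hp : p ∈ U)
    {W : Fin 8 → VField M} (hW : ∀ b, DiffAt (W b) p) (x : TangentSpace (𝓡 8) p) :
    FDiffAt (fun q => volForm (fun i => e i q) fun b => W b q) p ∧
      mvfderiv (𝓡 8) (fun q => volForm (fun i => e i q) fun b => W b q) p x
        = ∑ b, volForm (fun i => e i p)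
            (Function.update (fun b => W b p) b (nabla (W b) p x)) := by
  have hd := fun i => ((he.2.1 i).smoothNear he.1 hp).diffAt
  obtain ⟨h1, h2⟩ := mvfderiv_det (f := fun q => Matrix.of fun a b => inner ℝ (e a q) (W b q))
    (fun a b => (hd a).inner (hW b)) x
  refine ⟨h1, ?_⟩
  change mvfderiv (𝓡 8) (fun q => (Matrix.of fun a b => inner ℝ (e a q) (W b q)).det) p x = _
  rw [h2]
  set F : Matrix (Fin 8) (Fin 8) ℝ := Matrix.of fun a b => inner ℝ (e a p) (W b p) with hF
  set G := connMatrix nabla e p x with hG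
  have hcol : ∀ b, (fun a => mvfderiv (𝓡 8) (fun q => inner ℝ (e a q) (W b q)) p x)
      = Gᵀ *ᵥ F.col b + fun a => inner ℝ (e a p) (nabla (W b) p x) := by
    intro b
    ext a
    rw [mvfderiv_inner hmet (hd a) (hW b), Pi.add_apply]
    congr 1
    rw [← sum_connMatrix_smul nabla he hp, sum_inner]
    simp only [real_inner_smul_left]
    rfl
  have htr : Gᵀ.trace = 0 := by
    rw [Matrix.trace_transpose, Matrix.trace]
    refine Finset.sum_eq_zero fun i _ => ?_
    have := connMatrix_skew hmet he hp x i i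
    rw [Matrix.diag_apply]
    linarith
  have h3 : ∀ b, (F.updateCol b fun a => mvfderiv (𝓡 8) (fun q => inner ℝ (e a q) (W b q)) p x).det
      = (F.updateCol b (Gᵀ *ᵥ F.col b)).det + volForm (fun i => e i p)
            (Function.update (fun b => W b p) b (nabla (W b) p x)) := by
    intro b
    rw [hcol, Matrix.det_updateCol_add]
    congr 1
    rw [volForm]
    congr 1
    ext a c
    rw [Matrix.updateCol_apply, Matrix.of_apply, Function.update_apply]
    split_ifs <;> rfl
  refine (Finset.sum_congr rfl fun b _ => h3 b).trans ?_
  rw [Finset.sum_add_distrib, sum_det_updateCol_mulVec, htr, zero_mul, zero_add]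

/-- The Leibniz rule for the Hodge star: `*` commutes with the covariant derivatives of a metric
connection. -/
lemma mvfderiv_hodgeStar3 {nabla : Connection M} (hmet : nabla.IsMetricCompatible)
    {S : (p : M) → TangentSpace (𝓡 8) p → TangentSpace (𝓡 8) p → TangentSpace (𝓡 8) p → ℝ}
    (hS : IsDiffTensor S) {e : Fin 8 → VField M} {U : Set M} (he : IsOrthonormalFrame e U) {p : M}
    (hp : p ∈ U) {Y : Fin 5 → VField M} (hY : ∀ s, DiffAt (Y s) p) (x : TangentSpace (𝓡 8) p) :
    mvfderiv (𝓡 8) (fun q => hodgeStar3 (S q) (fun i => e i q) fun s => Y s q) p x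
      = hodgeStar3 (covDeriv nabla S p x) (fun i => e i p) (fun s => Y s p)
        + ∑ s, hodgeStar3 (S p) (fun i => e i p)
            (Function.update (fun s => Y s p) s (nabla (Y s) p x)) := by
  have hd := fun i => ((he.2.1 i).smoothNear he.1 hp).diffAt
  set G := connMatrix nabla e p x with hG
  set t : Fin 8 → Fin 8 → Fin 8 → ℝ := fun i j k => S p (e i p) (e j p) (e k p) with ht
  set N : Fin 8 → Fin 8 → Fin 8 → ℝ :=
    fun i j k => covDeriv nabla S p x (e i p) (e j p) (e k p) with hN
  obtain ⟨f, hfv', hfs'⟩ := exists_starAlternating_eq fun i => e i p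
  have hfv : ∀ v, volForm (fun i => e i p) v = f v := fun v => (hfv' v).symm
  have hfs := fun T w => (hodgeStar3_eq T (fun i => e i p) w).trans (hfs' T w)
  -- the components of `vol(e_i, e_j, e_k, w)`
  set D : (Fin 5 → TangentSpace (𝓡 8) p) → Fin 8 → Fin 8 → Fin 8 → ℝ := fun w i j k =>
    f (Matrix.vecCons (e i p) (Matrix.vecCons (e j p) (Matrix.vecCons (e k p) w))) with hD
  obtain ⟨v, hv⟩ : ∃ v : Fin 8 → Fin 8 → Fin 8 → M → ℝ, ∀ i j k, v i j k = fun q =>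
      volForm (fun i => e i q) fun b =>
        (Matrix.vecCons (e i) (Matrix.vecCons (e j) (Matrix.vecCons (e k) Y)) : Fin 8 → VField M)
            b q
    := ⟨_, fun _ _ _ => rfl⟩
  have hvol : ∀ i j k, FDiffAt (v i j k) p ∧ mvfderiv (𝓡 8) (v i j k) p x
      = actTensor G (D fun s => Y s p) i j k
          + ∑ s, D (Function.update (fun s => Y s p) s (nabla (Y s) p x)) i j k := by
    intro i j k
    obtain ⟨h1, h2⟩ := mvfderiv_volForm hmet he hp
      (diffAt_vecCons (hd i) (diffAt_vecCons (hd j) (diffAt_vecCons (hd k) hY))) x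
    rw [hv]
    refine ⟨h1, h2.trans ?_⟩
    have h3 := sum_map_update_frame f G (fun i => e i p) i j k
      (fun s => Y s p) (fun s => nabla (Y s) p x)
    simp only [hG, sum_connMatrix_smul nabla he hp] at h3
    refine Eq.trans (Finset.sum_congr rfl fun b _ => ?_) h3
    rw [hfv]
    have e1 : (fun b => (Matrix.vecCons (e i) (Matrix.vecCons (e j) (Matrix.vecCons (e k) Y)) :
        Fin 8 → VField M) b p) = Matrix.vecCons (e i p) (Matrix.vecCons (e j p)
          (Matrix.vecCons (e k p) fun s => Y s p)) := by
      ext b : 1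
      refine Fin.cases rfl (fun b => Fin.cases rfl (fun b => Fin.cases rfl (fun b => rfl) b) b) b
    have e2 : nabla ((Matrix.vecCons (e i) (Matrix.vecCons (e j) (Matrix.vecCons (e k) Y)) :
        Fin 8 → VField M) b) p x = (Matrix.vecCons (nabla (e i) p x) (Matrix.vecCons
          (nabla (e j) p x) (Matrix.vecCons (nabla (e k) p x) fun s => nabla (Y s) p x)) :
            Fin 8 → TangentSpace (𝓡 8) p) b := by
      refine Fin.cases rfl (fun b => Fin.cases rfl (fun b => Fin.cases rfl (fun b => rfl) b) b) b
    rw [e1, e2]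
  have hterm : ∀ i j k, FDiffAt (fun q => S q (e i q) (e j q) (e k q)) p :=
    fun i j k => hS.diff (hd i) (hd j) (hd k)
  have hcons : ∀ (i j k : Fin 8) (q : M), (fun b =>
      (Matrix.vecCons (e i) (Matrix.vecCons (e j) (Matrix.vecCons (e k) Y)) : Fin 8 → VField M) b q)
      = Matrix.vecCons (e i q) (Matrix.vecCons (e j q) (Matrix.vecCons (e k q) fun s => Y s q))
          := by
    intro i j k q
    ext b : 1
    refine Fin.cases rfl (fun b => Fin.cases rfl (fun b => Fin.cases rfl (fun b => rfl) b) b) b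
  have hq : ∀ q, hodgeStar3 (S q) (fun i => e i q) (fun s => Y s q)
      = 1 / 6 * ∑ i, ∑ j, ∑ k, S q (e i q) (e j q) (e k q) * v i j k q := by
    intro q
    simp only [hv]
    rw [hodgeStar3]
    refine congrArg _ (Finset.sum_congr rfl fun i _ => Finset.sum_congr rfl fun j _ =>
      Finset.sum_congr rfl fun k _ => congrArg _ (congrArg _ ?_))
    rw [append_three, hcons]
  have hvp : ∀ i j k, v i j k p = D (fun s => Y s p) i j k := fun i j k => by
    simp only [hv]
    rw [hfv, hcons]
  have hm : ∀ i j k, FDiffAt (fun q => S q (e i q) (e j q) (e k q) * v i j k q) p :=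
    fun i j k => (hterm i j k).mul (hvol i j k).1
  have hm1 : ∀ i j, FDiffAt (fun q => ∑ k, S q (e i q) (e j q) (e k q) * v i j k q) p :=
    fun i j => fdiffAt_sum (hm i j)
  have hm2 : ∀ i, FDiffAt (fun q => ∑ j, ∑ k, S q (e i q) (e j q) (e k q) * v i j k q) p :=
    fun i => fdiffAt_sum (hm1 i)
  have hder : ∀ i j k, mvfderiv (𝓡 8) (fun q => S q (e i q) (e j q) (e k q) * v i j k q) p x
      = N i j k * D (fun s => Y s p) i j k
        + (actTensor G t i j k * D (fun s => Y s p) i j k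
          + t i j k * actTensor G (D fun s => Y s p) i j k)
        + ∑ s, t i j k * D (Function.update (fun s => Y s p) s (nabla (Y s) p x)) i j k := by
    intro i j k
    rw [mvfderiv_mul_apply (hterm i j k) (hvol i j k).1, (hvol i j k).2, hvp,
      mvfderiv_components nabla hS he hp, ← Finset.mul_sum]
    simp only [hN, ht, hG]
    ring
  simp only [hq]
  rw [mvfderiv_mul_apply mdifferentiableAt_const (fdiffAt_sum hm2), mvfderiv_const,
    _root_.zero_apply, mul_zero, add_zero, mvfderiv_fsum hm2]
  simp only [mvfderiv_fsum (hm1 _), mvfderiv_fsum (hm _ _), hder, Finset.sum_add_distrib]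
  have hskew := sum_actTensor_mul (connMatrix_skew hmet he hp x) t (D fun s => Y s p)
  simp only [Finset.sum_add_distrib] at hskew
  rw [hskew, add_zero, mul_add, hfs]
  congr 1
  simp only [hfs]
  rw [← Finset.mul_sum]
  congr 1
  have e4 : ∀ F : Fin 5 → Fin 8 → Fin 8 → Fin 8 → ℝ,
      ∑ i, ∑ j, ∑ k, ∑ s, F s i j k = ∑ s, ∑ i, ∑ j, ∑ k, F s i j k := by
    intro F
    rw [Finset.sum_congr rfl fun i _ => (Finset.sum_congr rfl fun j _ =>
      Finset.sum_comm).trans Finset.sum_comm, Finset.sum_comm]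
  exact e4 fun s i j k =>
    t i j k * D (Function.update (fun s => Y s p) s (nabla (Y s) p x)) i j k

end SU3Dim8

/-! ### Coclosedness of the torsion -/

namespace SU3Dim8

open Filter Topology

variable {M : Type*} [TopologicalSpace M] [ChartedSpace E8 M] [IsManifold (𝓡 8) ∞ M]
  [RiemannianBundle (fun p : M => TangentSpace (𝓡 8) p)]
  [IsContMDiffRiemannianBundle (𝓡 8) ∞ E8 (fun p : M => TangentSpace (𝓡 8) p)]

/-- A metric connection whose torsion `T` is a 3-form is `∇^{LC} + ½ T`. -/
lemma inner_sub_leviCivita {nabla lc : Connection M} (hlc : IsLeviCivita lc)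
    (hmet : nabla.IsMetricCompatible)
    (hsk : ∀ (p : M) (u v w : TangentSpace (𝓡 8) p),
      torsion3 nabla p u v w = - torsion3 nabla p u w v) {p : M} (x y z : TangentSpace (𝓡 8) p) :
    inner ℝ (nabla (FiberBundle.extend E8 y) p x - lc (FiberBundle.extend E8 y) p x) z
      = torsion3 nabla p x y z / 2 := by
  set B : TangentSpace (𝓡 8) p → TangentSpace (𝓡 8) p → TangentSpace (𝓡 8) p → ℝ := fun x y z =>
    inner ℝ (nabla (FiberBundle.extend E8 y) p x - lc (FiberBundle.extend E8 y) p x) z with hB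
  have h1 : ∀ x y z, B x y z = - B x z y := by
    intro x y z
    have e1 := mvfderiv_inner hmet (diffAt_extend y) (diffAt_extend z) x
    have e2 := mvfderiv_inner hlc.1 (diffAt_extend y) (diffAt_extend z) x
    simp only [FiberBundle.extend_apply_self] at e1 e2
    simp only [hB, inner_sub_left, real_inner_comm y]
    linarith
  have h2 : ∀ x y z, B x y z - B y x z = torsion3 nabla p x y z := by
    intro x y z
    have e1 := nabla.torsion_apply (diffAt_extend x) (diffAt_extend y)
    have e2 := lc.torsion_apply (diffAt_extend x) (diffAt_extend y)
    rw [hlc.2] at e2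
    simp only [FiberBundle.extend_apply_self] at e1 e2
    have e3 : nabla.torsion p x y = (nabla (FiberBundle.extend E8 y) p x
        - lc (FiberBundle.extend E8 y) p x)
        - (nabla (FiberBundle.extend E8 x) p y - lc (FiberBundle.extend E8 x) p y) := by
      have e4 : lc (FiberBundle.extend E8 y) p x - lc (FiberBundle.extend E8 x) p y
          = VectorField.mlieBracket (𝓡 8) (FiberBundle.extend E8 x) (FiberBundle.extend E8 y) p :=
        sub_eq_zero.mp e2.symm
      rw [e1, ← e4]
      abel
    rw [torsion3, e3, inner_sub_left]
  change B x y z = _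
  linarith [h1 x y z, h1 y x z, h1 z x y, h2 x y z, h2 y z x, h2 z x y, h1 y z x, h1 x z y,
    h1 z y x, hsk p x y z, hsk p y z x, hsk p z x y, torsion3_skew nabla p x y z,
    torsion3_skew nabla p y z x, torsion3_skew nabla p z x y]

/-- The divergence of the torsion is the same for the Levi-Civita connection: the difference is
quadratic in the torsion and cancels by skew-symmetry. -/
lemma divergence_leviCivita {nabla lc : Connection M} (hlc : IsLeviCivita lc)
    (hmet : nabla.IsMetricCompatible)
    (hsk : ∀ (p : M) (u v w : TangentSpace (𝓡 8) p),
      torsion3 nabla p u v w = - torsion3 nabla p u w v)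
    (hS : IsDiffTensor (torsion3 nabla)) {p : M} {b : Fin 8 → TangentSpace (𝓡 8) p}
    (hb : Orthonormal ℝ b) (u v : TangentSpace (𝓡 8) p) :
    ∑ i, covDeriv lc (torsion3 nabla) p (b i) (b i) u v
      = ∑ i, covDeriv nabla (torsion3 nabla) p (b i) (b i) u v := by
  have hT := hS.trilinear p
  have hA := fun x y z => inner_sub_leviCivita hlc hmet hsk (p := p) x y z
  set A : TangentSpace (𝓡 8) p → TangentSpace (𝓡 8) p → TangentSpace (𝓡 8) p := fun x y =>
    nabla (FiberBundle.extend E8 y) p x - lc (FiberBundle.extend E8 y) p x with hAdef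
  have h1 : ∀ x u v w, covDeriv lc (torsion3 nabla) p x u v w
      = covDeriv nabla (torsion3 nabla) p x u v w + torsion3 nabla p (A x u) v w
        + torsion3 nabla p u (A x v) w + torsion3 nabla p u v (A x w) := by
    intro x u v w
    have e1 := mvfderiv_tensor nabla hS (diffAt_extend u) (diffAt_extend v) (diffAt_extend w) x
    have e2 := mvfderiv_tensor lc hS (diffAt_extend u) (diffAt_extend v) (diffAt_extend w) x
    simp only [FiberBundle.extend_apply_self] at e1 e2
    have l1 := (hT.left v w).map_sub (nabla (FiberBundle.extend E8 u) p x)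
      (lc (FiberBundle.extend E8 u) p x)
    have l2 := (hT.mid u w).map_sub (nabla (FiberBundle.extend E8 v) p x)
      (lc (FiberBundle.extend E8 v) p x)
    have l3 := (hT.right u v).map_sub (nabla (FiberBundle.extend E8 w) p x)
      (lc (FiberBundle.extend E8 w) p x)
    simp only [hAdef]
    linarith
  have hself : ∀ x, A x x = 0 := by
    intro x
    rw [← inner_self_eq_zero (𝕜 := ℝ), hA, torsion3, nabla.torsion_self, inner_zero_left, zero_div]
  have hexp : ∀ y z, A y z = ∑ j, (torsion3 nabla p y z (b j) / 2) • b j := by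
    intro y z
    conv_lhs => rw [← sum_inner_smul_frame hb (A y z)]
    exact Finset.sum_congr rfl fun j _ => by rw [real_inner_comm, hA]
  have h2 : ∀ i, torsion3 nabla p (b i) (A (b i) u) v
      = ∑ j, torsion3 nabla p (b i) u (b j) / 2 * torsion3 nabla p (b i) (b j) v := by
    intro i
    rw [hexp]
    have := map_sum ((hT.mid (b i) v).mk' _)
      (fun j => (torsion3 nabla p (b i) u (b j) / 2) • b j) Finset.univ
    simpa only [map_smul, IsLinearMap.mk'_apply, smul_eq_mul] using this
  have h3 : ∀ i, torsion3 nabla p (b i) u (A (b i) v)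
      = ∑ j, torsion3 nabla p (b i) v (b j) / 2 * torsion3 nabla p (b i) u (b j) := by
    intro i
    rw [hexp]
    have := map_sum ((hT.right (b i) u).mk' _)
      (fun j => (torsion3 nabla p (b i) v (b j) / 2) • b j) Finset.univ
    simpa only [map_smul, IsLinearMap.mk'_apply, smul_eq_mul] using this
  refine Finset.sum_congr rfl fun i _ => ?_
  rw [h1, hself, (hT.left u v).map_zero, h2, h3, add_zero, add_assoc, ← Finset.sum_add_distrib,
    Finset.sum_eq_zero, add_zero]
  intro j _
  rw [hsk p (b i) v (b j)]
  ring

/-- The exterior derivative is the alternation of the covariant derivative of a torsion-free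
connection: if `X_i(φ(…, X̂_i, …))` is `N_i` plus the terms in which `∇_{X_i} X_j` is substituted
for `X_j`, then the latter cancel the bracket terms. -/
lemma extDerivative_eq_sum {n : ℕ} {lc : Connection M} (hlc : IsLeviCivita lc)
    {φ : (p : M) → (Fin (n + 1) → TangentSpace (𝓡 8) p) → ℝ} {X : Fin (n + 2) → VField M} {p : M}
    (hX : ∀ i, DiffAt (X i) p)
    (hφ : IsForm (φ p)) (N : Fin (n + 2) → ℝ)
    (hN : ∀ i, mvfderiv (𝓡 8) (fun q => φ q (i.removeNth fun a => X a q)) p (X i p)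
      = N i + ∑ s, φ p (Function.update (i.removeNth fun a => X a p) s
          (lc (X (i.succAbove s)) p (X i p)))) :
    extDerivative φ X p = ∑ i : Fin (n + 2), (-1 : ℝ) ^ (i : ℕ) * N i := by
  have hbr : ∀ i j, VectorField.mlieBracket (𝓡 8) (X i) (X j) p
      = lc (X j) p (X i p) - lc (X i) p (X j p) := by
    intro i j
    have e2 := lc.torsion_apply (hX i) (hX j)
    rw [hlc.2] at e2
    exact (sub_eq_zero.mp e2.symm).symm
  rw [extDerivative]
  simp only [hN, hbr, mul_add, Finset.sum_add_distrib]
  rw [add_sub_assoc, add_eq_left, sub_eq_zero]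
  exact hφ.sum_update_eq_sum_commutator (fun a => X a p) fun i a => lc (X a) p (X i p)

/-- A 3-form whose divergence with respect to the Levi-Civita connection vanishes is coclosed. -/
lemma isCoclosed3_of_divergence {lc : Connection M} (hlc : IsLeviCivita lc)
    {S : (p : M) → TangentSpace (𝓡 8) p → TangentSpace (𝓡 8) p → TangentSpace (𝓡 8) p → ℝ}
    (hS : IsDiffTensor S) (h₁₂ : ∀ p u v w, S p u v w = - S p v u w)
    (h₂₃ : ∀ p u v w, S p u v w = - S p u w v)
    (hdiv : ∀ (p : M) (b : Fin 8 → TangentSpace (𝓡 8) p), Orthonormal ℝ b →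
      ∀ u v, ∑ i, covDeriv lc S p (b i) (b i) u v = 0) : IsCoclosed3 S := by
  intro U e he X hX p hp
  have hd := fun i => ((hX i).smoothNear he.1 hp).diffAt
  have ho := he.2.2 p hp
  refine (extDerivative_eq_sum (φ := fun q w => hodgeStar3 (S q) (fun i => e i q) w) hlc hd
    (isForm_hodgeStar3 (S p) fun i => e i p)
    (fun i => hodgeStar3 (covDeriv lc S p (X i p)) (fun i => e i p) (i.removeNth fun a => X a p))
    fun i => ?_).trans (sum_hodgeStar3_eq_zero ho (isLinearMap_covDeriv lc hS p)
      (fun _ => covDeriv_skew₁₂ hS h₁₂) (fun _ => covDeriv_skew₂₃ hS h₂₃) (hdiv p _ ho)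
      fun a => X a p)
  exact mvfderiv_hodgeStar3 hlc.1 hS he hp (Y := fun s => X (i.succAbove s)) (fun s => hd _) (X i p)

/-- A torsion of vectorial type is coclosed. -/
theorem isCoclosed3_torsion [T2Space M] {Υ : Tensor3 M} (hΥ : IsSU3Structure Υ)
    (hR : IsRestrictedNearlyIntegrable Υ) {nabla : Connection M}
    (hn : IsCharacteristicConnection nabla Υ) (hT : HasVectorialTorsion nabla Υ) :
    IsCoclosed3 (torsion3 nabla) := by
  have hM : HasFrames M := fun p => by
    obtain ⟨U, e, hp, he⟩ := hR.hasFrames p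
    exact ⟨U, e, hp, he.1⟩
  have hS := isDiffTensor_torsion3 hM hn.smooth
  obtain ⟨lc, hlc, -⟩ := id hR
  refine isCoclosed3_of_divergence hlc hS (torsion3_skew nabla) hn.skew fun p b hb u v => ?_
  rw [divergence_leviCivita hlc hn.metric hn.skew hS hb, divergence_torsion hΥ hR hn hT hb]

end SU3Dim8

open SU3Dim8

theorem mainTheorem9 {M : Type*} [TopologicalSpace M] [T2Space M]
    [ChartedSpace (EuclideanSpace ℝ (Fin 8)) M] [IsManifold (𝓡 8) ∞ M]
    [RiemannianBundle (fun p : M => TangentSpace (𝓡 8) p)]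
    [IsContMDiffRiemannianBundle (𝓡 8) ∞ (EuclideanSpace ℝ (Fin 8))
      (fun p : M => TangentSpace (𝓡 8) p)]
    (Υ : Tensor3 M) (hΥ : IsSU3Structure Υ) (hR : IsRestrictedNearlyIntegrable Υ)
    (nabla : Connection M) (hnabla : IsCharacteristicConnection nabla Υ)
    (hT : HasVectorialTorsion nabla Υ) :
    IsCoclosed3 (torsion3 nabla) ∧
      ∀ (p : M) (v w : TangentSpace (𝓡 8) p), ricci nabla p v w = ricci nabla p w v := by
  exact ⟨isCoclosed3_torsion hΥ hR hnabla hT, ricci_symm hΥ hR hnabla hT⟩
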